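/- **Theorem 2.1 (Uniqueness).** Let $T>0$ and $Q_T=(0,T)\times\mathbb R$. Consider the nonlocal conservation law $$\partial_t u+\partial_x\big(f(u)\,\nu(\mu*\beta(u))\big)=0 \ \text{ in } Q_T,\qquad u(0,x)=u_0(x),\quad x\in\mathbb R, \tag{1}$$ where $(\mu*\beta(u))(t,x)=\int_{\mathbb R}\mu(x-\xi)\,\beta(u(t,\xi))\,d\xi$. Assume that $f:\mathbb R\to\mathbb R$ is Lipschitz continuous with $f(0)=0$, that $\beta,\nu,\mu\in (C^2\cap \mathrm{BV}\cap W^{2,\infty})(\mathbb R)$ (that is, each is $C^2$, has finite total variation, and is bounded together with its first two derivatives), and that $\nu(0)=\beta(0)=0$. A function $u\in C([0,T];L^1(\mathbb R))\cap L^\infty(Q_T)$ is an *entropy solution* of (1) with initial datum $u_0\in L^1(\mathbb R)$ if, with $\mathcal U(t,x)=\nu\big((\mu*\beta(u(t)))(x)\big)$, for every $k\in\mathbb R$ and every non-negative $\phi\in C_c^\infty([0,T)\times\mathbb R)$, $$\int_{Q_T}|u-k|\,\phi_t\,dt\,dx+\int_{Q_T}\operatorname{sgn}(u-k)\,\mathcal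 U\,(f(u)-f(k))\,\phi_x\,dt\,dx-\int_{Q_T}f(k)\operatorname{sgn}(u-k)\,\mathcal U_x\,\phi\,dt\,dx+\int_{\mathbb R}|u_0(x)-k|\,\phi(0,x)\,dx\ \ge\ 0 .$$ Write $|u|_{L^\infty_t \mathrm{BV}_x}=\sup_{t\in[0,T]}\mathrm{TV}(u(t,\cdot))$, where $\mathrm{TV}$ denotes the total variation of a Lebesgue equivalence class (the infimum of the pointwise variations of its representatives). Let $u$ and $v$ be entropy solutions of (1) with initial data $u_0,v_0\in L^1(\mathbb R)$ respectively, such that $|u|_{L^\infty_t \mathrm{BV}_x}<\infty$ and $|v|_{L^\infty_t \mathrm{BV}_x}<\infty$. Then there is a constant $\mathcal M>0$, depending only on $f,\mu,\nu,\beta,T,\|u\|_{L^1(Q_T)},\|v\|_{L^1(Q_T)},|u|_{L^\infty_t \mathrm{BV}_x}$ and $|v|_{L^\infty_t \mathrm{BV}_x}$, such that $$\|u(t,\cdot)-v(t,\cdot)\|_{L^1(\mathbb R)}\le \|u_0-v_0\|_{L^1(\mathbb R)}\,\big(1+\mathcal M\,t\,e^{\mathcal M t}\big)\qquad\text{for all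 } t\in[0,T].$$ In particular, if $u_0=v_0$ a.e., then $u=v$ a.e. in $[0,T]\times\mathbb R$. -/

import Mathlib

open MeasureTheory Set Filter
open scoped Topology NNReal ENNReal ContDiff

noncomputable section

namespace NonlocalCL

/-- The space-time strip `Q_T = (0,T) × ℝ`; points are written `(t, x)`. -/
def strip (T : ℝ) : Set (ℝ × ℝ) := Ioo 0 T ×ˢ univ

/-- `g ∈ (C² ∩ BV ∩ W^{2,∞})(ℝ)`, where `BV` means finite total variation.
For a `C²` function, the essential bounds of `W^{2,∞}` are pointwise bounds, and the
total variation is the pointwise one. -/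
structure IsC2BVW2Inf (g : ℝ → ℝ) : Prop where
  contDiff : ContDiff ℝ 2 g
  boundedVariation : BoundedVariationOn g univ
  bounded : ∃ C : ℝ, ∀ x, |g x| ≤ C
  bounded_deriv : ∃ C : ℝ, ∀ x, |deriv g x| ≤ C
  bounded_deriv_two : ∃ C : ℝ, ∀ x, |iteratedDeriv 2 g x| ≤ C

/-- The assumptions on the flux function `f`, the nonlinearities `ν`, `β` and the kernel `μ`. -/
structure Assumptions (f ν β μ : ℝ → ℝ) : Prop where
  f_lipschitz : ∃ L : ℝ≥0, LipschitzWith L f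
  f_zero : f 0 = 0
  ν_regular : IsC2BVW2Inf ν
  ν_zero : ν 0 = 0
  β_regular : IsC2BVW2Inf β
  β_zero : β 0 = 0
  μ_regular : IsC2BVW2Inf μ

/-- Total variation on `ℝ` of the Lebesgue class of `g`: the infimum of the pointwise
variations of the functions that agree with `g` almost everywhere. -/
def totalVariation (g : ℝ → ℝ) : ℝ≥0∞ :=
  ⨅ (h : ℝ → ℝ) (_ : h =ᵐ[volume] g), eVariationOn h univ

/-- The seminorm `|u|_{L^∞_t BV_x} = sup_{t ∈ [0,T]} TV(u(t,·))`, possibly infinite. -/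
def supTV (T : ℝ) (u : ℝ → ℝ → ℝ) : ℝ≥0∞ :=
  ⨆ t ∈ Icc 0 T, totalVariation (u t)

/-- The norm `‖u‖_{L¹(Q_T)}`. -/
def normL1Strip (T : ℝ) (u : ℝ → ℝ → ℝ) : ℝ :=
  ∫ p in strip T, |u p.1 p.2|

/-- `u ∈ C([0,T]; L¹(ℝ))`, for a function `u` of `(t, x)`. -/
structure IsContL1 (T : ℝ) (u : ℝ → ℝ → ℝ) : Prop where
  integrable : ∀ t ∈ Icc 0 T, Integrable (u t)
  continuous : ∀ t ∈ Icc 0 T,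
    Tendsto (fun s => ∫ x, |u s x - u t x|) (𝓝[Icc 0 T] t) (𝓝 0)

/-- The nonlocal coefficient `𝒰(t,x) = ν((μ * β(u(t)))(x))`. -/
def nonlocalCoeff (ν β μ : ℝ → ℝ) (u : ℝ → ℝ → ℝ) (t x : ℝ) : ℝ :=
  ν (∫ ξ, μ (x - ξ) * β (u t ξ))

/-- Non-negative elements of `C_c^∞([0,T) × ℝ)`, given through a smooth compactly supported
extension to `ℝ × ℝ`; only the values at times `t ≥ 0` matter. -/
structure IsTestFunction (T : ℝ) (φ : ℝ × ℝ → ℝ) : Prop where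
  smooth : ContDiff ℝ ∞ φ
  hasCompactSupport : HasCompactSupport φ
  tsupport_subset : tsupport φ ⊆ Iio T ×ˢ univ
  nonneg : ∀ t x : ℝ, 0 ≤ t → 0 ≤ φ (t, x)

/-- Entropy solutions on `[0,T]` of
`∂ₜ u + ∂ₓ (f(u) ν(μ * β(u))) = 0`, `u(0,·) = u₀`.
The field `essBounded` contains the joint measurability of `u`. -/
structure IsEntropySolution (f ν β μ : ℝ → ℝ) (T : ℝ) (u₀ : ℝ → ℝ) (u : ℝ → ℝ → ℝ) :
    Prop where
  contL1 : IsContL1 T u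
  essBounded : MemLp (fun p : ℝ × ℝ => u p.1 p.2) ⊤ (volume.restrict (strip T))
  entropy : ∀ (k : ℝ) (φ : ℝ × ℝ → ℝ), IsTestFunction T φ →
    0 ≤ (∫ p in strip T, |u p.1 p.2 - k| * deriv (fun s => φ (s, p.2)) p.1)
      + (∫ p in strip T, Real.sign (u p.1 p.2 - k) * nonlocalCoeff ν β μ u p.1 p.2
            * (f (u p.1 p.2) - f k) * deriv (fun y => φ (p.1, y)) p.2)
      - (∫ p in strip T, f k * Real.sign (u p.1 p.2 - k)
            * deriv (fun y => nonlocalCoeff ν β μ u p.1 y) p.2 * φ p)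
      + (∫ x, |u₀ x - k| * φ (0, x))

end NonlocalCL

end

open MeasureTheory Set Filter
open scoped Topology NNReal ENNReal ContDiff

/-! The nonlocal coefficient of a given solution is treated as a prescribed function `U(t,x)`, so
that `u` becomes a Kruzhkov solution of the scalar law `∂ₜ u + ∂ₓ(U f(u)) = 0` (`IsBVEntropyFlow`).
Two such flows, with coefficients `U` and `V`, are compared by doubling the variables (`doubling`).
If `|U - V| ≤ a g` and `|∂ₓU - ∂ₓV| ≤ b g`, the distance `D(t) = ‖u(t) - v(t)‖₁` satisfies `D' ≤ L
(C d a + m b) g` in the sense of distributions (`comparison_test`). Here `L` is the Lipschitz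
constant of `f`, `d` is a translation constant of `v` supplied by its total variation, `m` bounds
`‖v(t)‖₁`, and `C` comes from the mollifier.

The nonlocality closes the estimate: convolution with a bounded kernel turns `L¹` distance into
uniform distance, so `U - V` and `∂ₓU - ∂ₓV` are bounded by constants times `D(t)`, and one may take
`g = D`. Grönwall's lemma in tested form (`le_exp_of_forall_test`) gives `D(t) ≤ D(0) e^{Kt}`, and
`e^x ≤ 1 + x e^x` gives the stated form.

Two points remain. The constant may involve `v` only through its norm on the strip and its total
variation, whereas `m` is a bound at every time. Comparing `v` with its own initial profile, a
stationary solution with coefficient zero, bounds the growth of `‖v(t) - v(0)‖₁` by a rate depending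
only on the total variation; averaging over a short time interval then controls `‖v(0)‖₁` by the
space-time norm (`IsEntropySolution.integral_abs_le`). Finally `D(0)` concerns `u(0)` and `v(0)`,
while the initial data enter only through the entropy inequality; test functions concentrating at `t
= 0` identify the two (`IsEntropySolution.initial_ae_eq`). -/

namespace NonlocalCL

/-! ### Mollifiers, cut-offs and smooth indicators -/

/-- Smooth mollifiers of width `δ` with `∫ |z| |ρ'(z)| dz ≤ C`. -/
structure IsMollifier (C δ : ℝ) (ρ : ℝ → ℝ) : Prop where
  smooth : ContDiff ℝ ∞ ρ
  nonneg : ∀ z, 0 ≤ ρ z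
  eq_zero : ∀ z, δ ≤ |z| → ρ z = 0
  integral_eq_one : ∫ z, ρ z = 1
  moment_deriv_le : ∫ z, |z| * |deriv ρ z| ≤ C

theorem hasCompactSupport_of_abs_le {ρ : ℝ → ℝ} {δ : ℝ} (h : ∀ z, δ ≤ |z| → ρ z = 0) :
    HasCompactSupport ρ := by
  refine HasCompactSupport.intro (isCompact_Icc (a := -δ) (b := δ)) fun x hx => h x ?_
  by_contra hc
  exact hx (abs_le.1 (not_le.1 hc).le)

theorem IsMollifier.hasCompactSupport {C δ : ℝ} {ρ : ℝ → ℝ} (h : IsMollifier C δ ρ) :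
    HasCompactSupport ρ := hasCompactSupport_of_abs_le h.eq_zero

theorem IsMollifier.integrable {C δ : ℝ} {ρ : ℝ → ℝ} (h : IsMollifier C δ ρ) :
    Integrable ρ := h.smooth.continuous.integrable_of_hasCompactSupport h.hasCompactSupport

/-- The integral of `|z| |ρ'(z)|` is invariant under the rescaling `δ⁻¹ r(z/δ)`, so one `C` serves
every width. In the doubling argument this compensates for the singular factor `ρ'`: it is always
paired with a difference whose `L¹` size is of order `|x - y|`. -/
theorem exists_isMollifier : ∃ C : ℝ, 0 ≤ C ∧ ∀ δ : ℝ, 0 < δ → ∃ ρ, IsMollifier C δ ρ := by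
  let b : ContDiffBump (0 : ℝ) := ⟨1 / 2, 1, by norm_num, by norm_num⟩
  set r : ℝ → ℝ := b.normed volume with hr
  have hrs : ContDiff ℝ ∞ r := b.contDiff_normed
  refine ⟨∫ z, |z| * |deriv r z|, integral_nonneg fun z => by positivity, fun δ hδ => ?_⟩
  refine ⟨fun z => δ⁻¹ * r (z / δ), ?_, ?_, ?_, ?_, ?_⟩
  · exact contDiff_const.mul (hrs.comp (contDiff_id.div_const δ))
  · exact fun z => mul_nonneg (by positivity) (b.nonneg_normed _)
  · intro z hz
    have : r (z / δ) = 0 := by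
      rw [← Function.notMem_support, hr, b.support_normed_eq]
      simp only [Metric.mem_ball, dist_zero_right, Real.norm_eq_abs, abs_div, not_lt, b]
      rw [abs_of_pos hδ, le_div_iff₀ hδ]; linarith
    simp [this]
  · rw [integral_const_mul, Measure.integral_comp_div r, b.integral_normed]
    simp [abs_of_pos hδ, hδ.ne']
  · have hd : ∀ z, deriv (fun z => δ⁻¹ * r (z / δ)) z = δ⁻¹ * (δ⁻¹ * deriv r (z / δ)) := by
      intro z
      have h1 : HasDerivAt r (deriv r (z / δ)) (z / δ) :=
        (hrs.differentiable (by simp)).differentiableAt.hasDerivAt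
      have h2 := (h1.comp z ((hasDerivAt_id z).div_const δ)).const_mul δ⁻¹
      rw [show (fun z => δ⁻¹ * r (z / δ)) = fun y => δ⁻¹ * (r ∘ fun x => id x / δ) y from rfl,
        h2.deriv]
      ring
    have : ∀ z, |z| * |deriv (fun z => δ⁻¹ * r (z / δ)) z|
        = δ⁻¹ * (fun w => |w| * |deriv r w|) (z / δ) := by
      intro z
      simp only [hd, abs_mul, abs_div, abs_inv, abs_of_pos hδ]
      field_simp
    simp_rw [this]
    rw [integral_const_mul, Measure.integral_comp_div (fun w => |w| * |deriv r w|)]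
    simp [abs_of_pos hδ, hδ.ne']

/-- A sequence of smooth cut-off functions exhausting the line. -/
theorem exists_cutoff : ∃ C : ℝ, 0 ≤ C ∧ ∃ η : ℕ → ℝ → ℝ, (∀ n, ContDiff ℝ ∞ (η n)) ∧
    (∀ n, HasCompactSupport (η n)) ∧ (∀ n x, 0 ≤ η n x) ∧ (∀ n x, η n x ≤ 1) ∧
    (∀ n x, |deriv (η n) x| ≤ C / (n + 1)) ∧ ∀ x, Tendsto (fun n => η n x) atTop (𝓝 1) := by
  let b : ContDiffBump (0 : ℝ) := ⟨1, 2, by norm_num, by norm_num⟩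
  have hbs : ContDiff ℝ ∞ b := b.contDiff
  obtain ⟨C, hC⟩ := (hbs.continuous_deriv (by simp)).bounded_above_of_compact_support
    b.hasCompactSupport.deriv
  refine ⟨C, (norm_nonneg _).trans (hC 0), fun n x => b (x / (n + 1)), ?_, ?_, ?_, ?_, ?_, ?_⟩
  · exact fun n => hbs.comp (contDiff_id.div_const _)
  · intro n
    refine hasCompactSupport_of_abs_le (δ := 2 * (n + 1)) fun z hz => b.zero_of_le_dist ?_
    have : (0 : ℝ) < n + 1 := by positivity
    simp only [dist_zero_right, Real.norm_eq_abs, abs_div, abs_of_pos this]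
    rwa [le_div_iff₀ this]
  · exact fun n x => b.nonneg
  · exact fun n x => b.le_one
  · intro n x
    have hp : (0 : ℝ) < n + 1 := by positivity
    have h1 : HasDerivAt b (deriv b (x / (n + 1))) (x / (n + 1)) :=
      (hbs.differentiable (by simp)).differentiableAt.hasDerivAt
    have h2 := h1.comp x ((hasDerivAt_id x).div_const ((n : ℝ) + 1))
    change |deriv (b ∘ fun x => id x / ((n : ℝ) + 1)) x| ≤ _
    rw [h2.deriv, abs_mul, abs_of_pos (by positivity : 0 < 1 / ((n : ℝ) + 1)), mul_one_div]
    gcongr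
    exact hC _
  · intro x
    refine tendsto_atTop_of_eventually_const (i₀ := ⌈|x|⌉₊) fun n hn => ?_
    refine b.one_of_mem_closedBall ?_
    have hp : (0 : ℝ) < n + 1 := by positivity
    simp only [Metric.mem_closedBall, dist_zero_right, Real.norm_eq_abs, abs_div, abs_of_pos hp]
    rw [div_le_iff₀ hp]
    have := Nat.ceil_le.1 hn
    show |x| ≤ 1 * _
    linarith

theorem IsMollifier.abs_integral_sub_le {C δ : ℝ} {ρ : ℝ → ℝ} (h : IsMollifier C δ ρ)
    {s : Set ℝ} {g : ℝ → ℝ} {a e : ℝ}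
    (hg : IntegrableOn (fun t => ρ (t - a) * g t) s)
    (hsub : ∀ t, |t - a| < δ → t ∈ s ∧ |g t - g a| ≤ e) :
    |(∫ t in s, ρ (t - a) * g t) - g a| ≤ e := by
  have hzero : ∀ t, t ∉ s → ρ (t - a) = 0 := fun t ht => h.eq_zero _ (by
    by_contra hc
    exact ht (hsub t (not_le.1 hc)).1)
  have hρ : Integrable (fun t => ρ (t - a)) := h.integrable.comp_sub_right a
  have h1 : ∫ t in s, ρ (t - a) * g a = g a := by
    rw [setIntegral_eq_integral_of_forall_compl_eq_zero (fun t ht => by simp [hzero t ht]),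
      integral_mul_const, integral_sub_right_eq_self ρ, h.integral_eq_one, one_mul]
  have h2 : (∫ t in s, ρ (t - a) * g t) - g a = ∫ t in s, ρ (t - a) * (g t - g a) := by
    nth_rewrite 1 [← h1]
    rw [← integral_sub hg (hρ.mul_const _).integrableOn]
    simp_rw [mul_sub]
  rw [h2]
  calc |∫ t in s, ρ (t - a) * (g t - g a)| ≤ ∫ t in s, |ρ (t - a) * (g t - g a)| :=
        abs_integral_le_integral_abs
    _ ≤ ∫ t in s, ρ (t - a) * e := by
        refine integral_mono_of_nonneg (Eventually.of_forall fun t => abs_nonneg _)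
          (hρ.mul_const _).integrableOn (Eventually.of_forall fun t => ?_)
        simp only [abs_mul, abs_of_nonneg (h.nonneg _)]
        by_cases ht : |t - a| < δ
        · exact mul_le_mul_of_nonneg_left (hsub t ht).2 (h.nonneg _)
        · simp [h.eq_zero _ (not_lt.1 ht)]
    _ = e := by
        rw [setIntegral_eq_integral_of_forall_compl_eq_zero (fun t ht => by simp [hzero t ht]),
          integral_mul_const, integral_sub_right_eq_self ρ, h.integral_eq_one, one_mul]

/-- The difference of two shifted primitives of a mollifier, a smooth version of the indicator
of `[a, b]`. -/
theorem IsMollifier.exists_smooth_indicator {C δ : ℝ} {ρ : ℝ → ℝ} (h : IsMollifier C δ ρ)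
    {a b : ℝ} (hab : a ≤ b) : ∃ χ : ℝ → ℝ, ContDiff ℝ ∞ χ ∧
      (∀ t, HasDerivAt χ (ρ (t - a) - ρ (t - b)) t) ∧ (∀ t, 0 ≤ χ t) ∧
      tsupport χ ⊆ Icc (a - δ) (b + δ) := by
  have hc := h.smooth.continuous
  set R : ℝ → ℝ := fun t => ∫ r in (-δ)..t, ρ r with hR
  have hRd : ∀ t, HasDerivAt R (ρ t) t := fun t =>
    intervalIntegral.integral_hasDerivAt_right (hc.intervalIntegrable _ _)
      (hc.stronglyMeasurableAtFilter _ _) hc.continuousAt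
  have hmono : Monotone R := monotone_of_hasDerivAt_nonneg hRd h.nonneg
  have hRs : ContDiff ℝ ∞ R := by
    rw [contDiff_infty_iff_deriv]
    refine ⟨fun t => (hRd t).differentiableAt, ?_⟩
    rw [show deriv R = ρ from funext fun t => (hRd t).deriv]
    exact h.smooth
  have hleft : ∀ t, t ≤ -δ → R t = 0 := by
    intro t ht
    simp only [hR]
    rw [intervalIntegral.integral_congr (g := fun _ => (0 : ℝ)), intervalIntegral.integral_zero]
    intro r hr
    rw [uIcc_of_ge ht] at hr
    exact h.eq_zero _ (le_abs.2 (Or.inr (by linarith [hr.2])))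
  have hright : ∀ t, δ ≤ t → R t = R δ := by
    intro t ht
    simp only [hR]
    rw [← intervalIntegral.integral_add_adjacent_intervals (hc.intervalIntegrable _ δ)
      (hc.intervalIntegrable _ _), intervalIntegral.integral_congr (a := δ) (g := fun _ => (0 : ℝ)),
      intervalIntegral.integral_zero, add_zero]
    intro r hr
    rw [uIcc_of_le ht] at hr
    exact h.eq_zero _ (le_abs.2 (Or.inl hr.1))
  refine ⟨fun t => R (t - a) - R (t - b), ?_, ?_, ?_, ?_⟩
  · exact (hRs.comp (contDiff_id.sub contDiff_const)).sub (hRs.comp (contDiff_id.sub contDiff_const))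
  · exact fun t => ((hRd _).comp_sub_const t a).sub ((hRd _).comp_sub_const t b)
  · exact fun t => sub_nonneg.2 (hmono (by linarith))
  · refine closure_minimal (fun t ht => ?_) isClosed_Icc
    by_contra hn
    apply ht
    simp only
    rw [mem_Icc, not_and_or, not_le, not_le] at hn
    rcases hn with hn | hn
    · rw [hleft _ (by linarith), hleft _ (by linarith), sub_zero]
    · rw [hright _ (by linarith), hright (t - b) (by linarith), sub_self]

/-! ### Differential inequalities tested in time -/

/-- Smooth non-negative functions with compact support in `(0, T)`. -/
structure IsTimeTest (T : ℝ) (χ : ℝ → ℝ) : Prop where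
  smooth : ContDiff ℝ ∞ χ
  hasCompactSupport : HasCompactSupport χ
  tsupport_subset : tsupport χ ⊆ Ioo 0 T
  nonneg : ∀ t, 0 ≤ χ t

theorem integrableOn_of_continuousOn_of_tsupport {T : ℝ} {χ g : ℝ → ℝ} (hχ : Continuous χ)
    (hg : ContinuousOn g (Icc 0 T)) : IntegrableOn (fun t => χ t * g t) (Ioo 0 T) :=
  ((hχ.continuousOn.mul hg).integrableOn_Icc).mono_set Ioo_subset_Icc_self

/-- A smooth indicator of `[a, b]` has derivative `ρ(t - a) - ρ(t - b)`, so testing with it compares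
averages of `g` near `a` and near `b`; continuity of `g` lets the width shrink. -/
theorem antitoneOn_of_forall_test {T : ℝ} {g : ℝ → ℝ} (hg : ContinuousOn g (Icc 0 T))
    (h : ∀ χ, IsTimeTest T χ → 0 ≤ ∫ t in Ioo 0 T, deriv χ t * g t) :
    AntitoneOn g (Ioo 0 T) := by
  obtain ⟨C, -, hC⟩ := exists_isMollifier
  have key : ∀ a ∈ Ioo 0 T, ∀ e > 0, ∃ δ > 0, ∀ t, |t - a| < δ → t ∈ Ioo 0 T ∧ |g t - g a| ≤ e := by
    intro a ha e he
    have h1 := (hg.continuousAt (Icc_mem_nhds ha.1 ha.2)).eventually (Metric.closedBall_mem_nhds _ he)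
    obtain ⟨δ, hδ, h2⟩ := Metric.eventually_nhds_iff.1 (h1.and (Ioo_mem_nhds ha.1 ha.2))
    exact ⟨δ, hδ, fun t ht => ⟨(h2 ht).2, (h2 ht).1⟩⟩
  intro a ha b hb hab
  refine le_of_forall_pos_le_add fun e he => ?_
  obtain ⟨δ₁, hδ₁, h₁⟩ := key a ha (e / 2) (by positivity)
  obtain ⟨δ₂, hδ₂, h₂⟩ := key b hb (e / 2) (by positivity)
  set δ := min δ₁ δ₂ / 2 with hδdef
  have hm : 0 < min δ₁ δ₂ := lt_min hδ₁ hδ₂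
  have hδ : 0 < δ := by positivity
  have hl1 : δ < δ₁ := by have := min_le_left δ₁ δ₂; simp only [hδdef]; linarith
  have hl2 : δ < δ₂ := by have := min_le_right δ₁ δ₂; simp only [hδdef]; linarith
  obtain ⟨ρ, hρ⟩ := hC δ hδ
  obtain ⟨χ, hs, hd, hn, hsupp⟩ := hρ.exists_smooth_indicator hab
  have ha' := (h₁ (a - δ) (by simpa [abs_of_pos hδ] using hl1)).1
  have hb' := (h₂ (b + δ) (by simpa [abs_of_pos hδ] using hl2)).1
  have hχ : IsTimeTest T χ := ⟨hs, isCompact_Icc.of_isClosed_subset isClosed_closure hsupp, hsupp.trans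
    fun t ht => ⟨by linarith [ha'.1, ht.1], by linarith [hb'.2, ht.2]⟩, hn⟩
  have hint : ∀ c, IntegrableOn (fun t => ρ (t - c) * g t) (Ioo 0 T) := fun c =>
    integrableOn_of_continuousOn_of_tsupport
      (hρ.smooth.continuous.comp (continuous_id.sub continuous_const)) hg
  have h0 := h χ hχ
  have e1 := hρ.abs_integral_sub_le (hint a)
    (fun t ht => h₁ t (ht.trans hl1))
  have e2 := hρ.abs_integral_sub_le (hint b)
    (fun t ht => h₂ t (ht.trans hl2))
  simp_rw [fun t => (hd t).deriv, sub_mul] at h0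
  rw [integral_sub (hint a) (hint b)] at h0
  rw [abs_le] at e1 e2
  linarith [e1.2, e2.1]

/-- Grönwall's lemma with an integrating factor: for `E = e^{-Kt}`, testing with `E χ` makes the
zeroth-order term cancel and leaves `∫ χ' E G ≥ 0`, so `E G` is non-increasing. Continuity carries
this from the open interval to both end points. -/
theorem le_exp_of_forall_test {T K : ℝ} (hT : 0 < T) {G : ℝ → ℝ} (hG : ContinuousOn G (Icc 0 T))
    (h : ∀ χ, IsTimeTest T χ →
      0 ≤ (∫ t in Ioo 0 T, deriv χ t * G t) + K * ∫ t in Ioo 0 T, χ t * G t) :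
    ∀ t ∈ Icc 0 T, G t ≤ G 0 * Real.exp (K * t) := by
  set E : ℝ → ℝ := fun t => Real.exp (-(K * t)) with hE
  have hEs : ContDiff ℝ ∞ E := Real.contDiff_exp.comp ((contDiff_const.mul contDiff_id).neg)
  have hEd : ∀ t, HasDerivAt E (-K * E t) t := by
    intro t
    have := (((hasDerivAt_id' t).const_mul K).neg).exp
    simp only [mul_one] at this
    rw [mul_comm]
    exact this
  have hcont : ContinuousOn (fun t => E t * G t) (Icc 0 T) := hEs.continuous.continuousOn.mul hG
  have hanti : ∀ t ∈ Icc 0 T, E t * G t ≤ E 0 * G 0 := by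
    have := antitoneOn_of_forall_test hcont (fun χ hχ => ?_)
    · have hcl : closure (Ioo 0 T) = Icc 0 T := closure_Ioo hT.ne
      have h1 : ∀ t ∈ Ioo 0 T, E t * G t ≤ E 0 * G 0 := by
        intro t ht
        have hlim : Tendsto (fun s => E s * G s) (𝓝[Ioo 0 T] 0) (𝓝 (E 0 * G 0)) :=
          (hcont 0 (left_mem_Icc.2 hT.le)).mono_left (nhdsWithin_mono _ Ioo_subset_Icc_self)
        have : (𝓝[Ioo 0 T] (0 : ℝ)).NeBot := left_nhdsWithin_Ioo_neBot hT
        refine ge_of_tendsto hlim ?_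
        filter_upwards [self_mem_nhdsWithin, mem_nhdsWithin_of_mem_nhds (Iio_mem_nhds ht.1)]
          with s hs hst
        exact ‹AntitoneOn _ _› hs ht hst.le
      intro t ht
      refine le_on_closure h1 ?_ continuousOn_const (hcl ▸ ht)
      rwa [hcl]
    · have hχ2 : IsTimeTest T (fun t => E t * χ t) := by
        refine ⟨hEs.mul hχ.smooth, hχ.hasCompactSupport.mul_left, ?_, ?_⟩
        · exact (tsupport_mul_subset_right (f := E) (g := χ)).trans hχ.tsupport_subset
        · exact fun t => mul_nonneg (Real.exp_pos _).le (hχ.nonneg t)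
      have h1 := h _ hχ2
      have hχd : ∀ t, HasDerivAt χ (deriv χ t) t := fun t =>
        (hχ.smooth.differentiable (by simp)).differentiableAt.hasDerivAt
      rw [← integral_const_mul, ← integral_add] at h1
      · refine h1.trans_eq (integral_congr_ae (Eventually.of_forall fun t => ?_))
        simp only
        rw [show deriv (fun t => E t * χ t) t = _ from ((hEd t).mul (hχd t)).deriv]
        ring
      · exact integrableOn_of_continuousOn_of_tsupport (hχ2.smooth.continuous_deriv (by simp)) hG
      · exact (integrableOn_of_continuousOn_of_tsupport hχ2.smooth.continuous hG).const_mul K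
  intro t ht
  have h1 := hanti t ht
  simp only [hE, mul_zero, Real.exp_zero, Real.exp_neg, inv_one, one_mul] at h1
  rwa [inv_mul_le_iff₀ (Real.exp_pos _), mul_comm] at h1

/-! ### The Kruzhkov flux -/

theorem measurable_real_sign : Measurable Real.sign := by
  unfold Real.sign
  exact Measurable.ite measurableSet_Iio measurable_const
    (Measurable.ite measurableSet_Ioi measurable_const measurable_const)

theorem abs_real_sign_le (x : ℝ) : |Real.sign x| ≤ 1 := by
  rcases Real.sign_apply_eq x with h | h | h <;> simp [h]

theorem real_sign_sub_comm (a b : ℝ) : Real.sign (b - a) = -Real.sign (a - b) := by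
  rw [← neg_sub a b, Real.sign_neg]

/-- The Kruzhkov entropy flux `sgn (a - b) (f a - f b)`. -/
noncomputable def kruzhkovFlux (f : ℝ → ℝ) (a b : ℝ) : ℝ := Real.sign (a - b) * (f a - f b)

theorem abs_sub_le_of_lipschitz {f : ℝ → ℝ} {L : ℝ≥0} (hf : LipschitzWith L f) (a b : ℝ) :
    |f a - f b| ≤ L * |a - b| := by
  simpa [Real.dist_eq] using hf.dist_le_mul a b

theorem abs_kruzhkovFlux_le {f : ℝ → ℝ} {L : ℝ≥0} (hf : LipschitzWith L f) (a b : ℝ) :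
    |kruzhkovFlux f a b| ≤ L * |a - b| := by
  rw [kruzhkovFlux, abs_mul]
  calc _ ≤ 1 * |f a - f b| := by gcongr; exact abs_real_sign_le _
    _ ≤ _ := by rw [one_mul]; exact abs_sub_le_of_lipschitz hf a b

theorem abs_kruzhkovFlux_le_add {f : ℝ → ℝ} {L : ℝ≥0} (hf : LipschitzWith L f) (a b : ℝ) :
    |kruzhkovFlux f a b| ≤ L * (|a| + |b|) :=
  (abs_kruzhkovFlux_le hf a b).trans (by gcongr; exact abs_sub _ _)

/-- The jump of the sign at `b = a` is harmless because `f a - f b` vanishes there. On one side of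
`a` this is the Lipschitz bound for `f`; on opposite sides the two values are bounded by the
distances to `a`, which add up to `|b - b'|`. -/
theorem abs_kruzhkovFlux_sub_le {f : ℝ → ℝ} {L : ℝ≥0} (hf : LipschitzWith L f) (a b b' : ℝ) :
    |kruzhkovFlux f a b - kruzhkovFlux f a b'| ≤ L * |b - b'| := by
  have hL : (0 : ℝ) ≤ L := L.2
  have opp : ∀ x y, x ≤ a → a ≤ y →
      |kruzhkovFlux f a x - kruzhkovFlux f a y| ≤ L * |x - y| := by
    intro x y hx hy
    have h1 := abs_kruzhkovFlux_le hf a x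
    have h2 := abs_kruzhkovFlux_le hf a y
    have h3 := abs_sub (kruzhkovFlux f a x) (kruzhkovFlux f a y)
    rw [abs_of_nonneg (sub_nonneg.2 hx)] at h1
    rw [abs_of_nonpos (sub_nonpos.2 hy)] at h2
    rw [abs_of_nonpos (sub_nonpos.2 (hx.trans hy))]
    linarith
  rcases le_or_gt b a with hb | hb <;> rcases le_or_gt b' a with hb' | hb'
  · rcases hb.eq_or_lt with rfl | hb
    · simpa [abs_sub_comm, kruzhkovFlux] using abs_kruzhkovFlux_le hf b b'
    rcases hb'.eq_or_lt with rfl | hb'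
    · simpa [abs_sub_comm, kruzhkovFlux] using abs_kruzhkovFlux_le hf b' b
    simp only [kruzhkovFlux, Real.sign_of_pos (sub_pos.2 hb), Real.sign_of_pos (sub_pos.2 hb')]
    have := abs_sub_le_of_lipschitz hf b' b
    rw [abs_sub_comm b b']
    convert this using 2
    ring
  · exact opp b b' hb hb'.le
  · rw [abs_sub_comm, abs_sub_comm b]
    exact opp b' b hb' hb.le
  · simp only [kruzhkovFlux, Real.sign_of_neg (sub_neg.2 hb), Real.sign_of_neg (sub_neg.2 hb')]
    have := abs_sub_le_of_lipschitz hf b b'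
    convert this using 2
    ring

theorem measurable_kruzhkovFlux {f : ℝ → ℝ} (hf : Continuous f) :
    Measurable fun z : ℝ × ℝ => kruzhkovFlux f z.1 z.2 :=
  (measurable_real_sign.comp (measurable_fst.sub measurable_snd)).mul
    ((hf.measurable.comp measurable_fst).sub (hf.measurable.comp measurable_snd))

/-! ### Double integrals against a kernel in `x - y` -/

theorem integrable_snd_mul_sub {g k : ℝ → ℝ} (hg : Integrable g) (hk : Integrable k) :
    Integrable fun z : ℝ × ℝ => g z.2 * k (z.1 - z.2) :=
  hg.convolution_integrand (ContinuousLinearMap.mul ℝ ℝ) hk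

theorem integrable_fst_mul_sub {g k : ℝ → ℝ} (hg : Integrable g) (hk : Integrable k) :
    Integrable fun z : ℝ × ℝ => g z.1 * k (z.1 - z.2) := by
  have := (integrable_snd_mul_sub hg hk.comp_neg).swap
  simp only [Function.comp_def, Prod.fst_swap, Prod.snd_swap, neg_sub] at this
  exact this

theorem integral_snd_mul_sub {g k : ℝ → ℝ} (hg : Integrable g) (hk : Integrable k) :
    ∫ z : ℝ × ℝ, g z.2 * k (z.1 - z.2) = (∫ x, g x) * ∫ x, k x := by
  rw [Measure.volume_eq_prod, integral_prod_symm _ (integrable_snd_mul_sub hg hk)]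
  simp_rw [integral_const_mul, integral_sub_right_eq_self k, integral_mul_const]

theorem integral_fst_mul_sub {g k : ℝ → ℝ} (hg : Integrable g) (hk : Integrable k) :
    ∫ z : ℝ × ℝ, g z.1 * k (z.1 - z.2) = (∫ x, g x) * ∫ x, k x := by
  rw [Measure.volume_eq_prod, integral_prod _ (integrable_fst_mul_sub hg hk)]
  simp_rw [integral_const_mul, integral_sub_left_eq_self k, integral_mul_const]

theorem integrable_abs_sub_mul_kernel {v κ : ℝ → ℝ} (hv : Integrable v) (hκ : Integrable κ) :
    Integrable fun z : ℝ × ℝ => |v z.1 - v z.2| * κ (z.1 - z.2) := by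
  have h := (integrable_fst_mul_sub hv hκ).sub (integrable_snd_mul_sub hv hκ)
  have hm : AEStronglyMeasurable (fun z : ℝ × ℝ => |v z.1 - v z.2|) := by
    have h1 : AEStronglyMeasurable (fun z : ℝ × ℝ => v z.1) :=
      hv.aestronglyMeasurable.comp_fst
    have h2 : AEStronglyMeasurable (fun z : ℝ × ℝ => v z.2) :=
      hv.aestronglyMeasurable.comp_snd
    exact (h1.sub h2).norm
  have hm2 : AEStronglyMeasurable (fun z : ℝ × ℝ => κ (z.1 - z.2)) :=
    hκ.aestronglyMeasurable.comp_quasiMeasurePreserving (quasiMeasurePreserving_sub _ _)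
  refine h.mono (hm.mul hm2) (Eventually.of_forall fun z => ?_)
  simp [← sub_mul]

/-- Substitute `x = y + w` and integrate first in `y`: the translation estimate contributes `c |w|`
for each `w`. This is how bounded variation enters the comparison. -/
theorem integral_abs_sub_mul_kernel_le {v κ : ℝ → ℝ} {c : ℝ} (hv : Integrable v)
    (htr : ∀ h, ∫ x, |v (x + h) - v x| ≤ c * |h|) (hκ : Continuous κ)
    (hκs : HasCompactSupport κ) (hκ0 : ∀ z, 0 ≤ κ z) :
    ∫ z : ℝ × ℝ, |v z.1 - v z.2| * κ (z.1 - z.2) ≤ c * ∫ w, |w| * κ w := by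
  have hκi : Integrable κ := hκ.integrable_of_hasCompactSupport hκs
  have hint := integrable_abs_sub_mul_kernel hv hκi
  have h2 : Integrable (fun p : ℝ × ℝ => |v (p.1 + p.2) - v p.1| * κ p.2) (volume.prod volume) := by
    have := (measurePreserving_prod_add (volume : Measure ℝ) volume).integrable_comp_of_integrable
      hint.swap
    simpa [Function.comp_def] using this
  rw [Measure.volume_eq_prod, integral_prod_symm _ hint]
  have h3 : ∀ y : ℝ, ∫ x, |v x - v y| * κ (x - y) = ∫ w, |v (y + w) - v y| * κ w := by
    intro y
    rw [← integral_add_left_eq_self _ y]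
    simp
  simp_rw [h3]
  rw [integral_integral_swap h2, ← integral_const_mul]
  have hw : Integrable (fun w => c * (|w| * κ w)) :=
    ((continuous_abs.mul hκ).integrable_of_hasCompactSupport hκs.mul_left).const_mul c
  refine integral_mono h2.integral_prod_right hw fun w => ?_
  simp only
  rw [integral_mul_const, ← mul_assoc]
  exact mul_le_mul_of_nonneg_right (htr w) (hκ0 w)

theorem IsMollifier.integral_abs_mul_le {C δ : ℝ} {ρ : ℝ → ℝ} (hρ : IsMollifier C δ ρ) :
    ∫ w, |w| * ρ w ≤ δ := by
  have hρc := hρ.smooth.continuous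
  calc ∫ w, |w| * ρ w ≤ ∫ w, δ * ρ w := by
        refine integral_mono (Continuous.integrable_of_hasCompactSupport (by fun_prop)
          hρ.hasCompactSupport.mul_left) (hρ.integrable.const_mul δ) fun w => ?_
        by_cases hw : |w| ≤ δ
        · exact mul_le_mul_of_nonneg_right hw (hρ.nonneg w)
        · simp [hρ.eq_zero w (not_le.1 hw).le]
    _ = δ := by rw [integral_const_mul, hρ.integral_eq_one, mul_one]

/-! ### Spatial estimates for doubled variables -/

/-- The spatial part of the integrand that arises from doubling the variables. -/
noncomputable def doubledFlux (f u v U U' V V' η ρ : ℝ → ℝ) (x y : ℝ) : ℝ :=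
  kruzhkovFlux f (u x) (v y) *
      (U x * deriv η x * ρ (x - y) + (U x - V y) * η x * deriv ρ (x - y))
    + Real.sign (u x - v y) * (f (u x) * V' y - f (v y) * U' x) * (η x * ρ (x - y))

/-- The dangerous terms carry `ρ'`. Write `f(u) V' - f(v) U' = (f(u) - f(v)) V' + f(v) (V' - U')`;
the first summand joins the flux terms, whose factor becomes `(U x - V y) ρ' + V' ρ`, an exact
`y`-derivative. Freezing the Kruzhkov flux at `v x` therefore costs nothing after integration in
`y`, and the error is at most `L |v y - v x|` times a kernel bounded by `a |ρ'| + B ρ`, which the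
translation estimate of `v` controls. Only `v` needs such an estimate. The leftover source gives `b
‖v‖₁`, and the cut-off gives the term with `e`. -/
theorem integral_doubledFlux_le {f : ℝ → ℝ} {L : ℝ≥0} (hf : LipschitzWith L f) (hf0 : f 0 = 0)
    {u v U U' V V' η ρ : ℝ → ℝ} {B c C δ e a b : ℝ}
    (hu : Integrable u) (hv : Integrable v)
    (htr : ∀ h, ∫ x, |v (x + h) - v x| ≤ c * |h|)
    (hU : Continuous U) (hV : ∀ x, HasDerivAt V (V' x) x) (hV' : Continuous V')
    (hUB : ∀ x, |U x| ≤ B) (hVB : ∀ x, |V x| ≤ B) (hVB' : ∀ x, |V' x| ≤ B)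
    (hη : ContDiff ℝ ∞ η) (hη0 : ∀ x, 0 ≤ η x) (hη1 : ∀ x, η x ≤ 1)
    (hηe : ∀ x, |deriv η x| ≤ e) (hρ : IsMollifier C δ ρ) (hδ : 0 ≤ δ) (hc : 0 ≤ c)
    (ha : ∀ x y, |x - y| ≤ δ → |U x - V y| ≤ a)
    (hb : ∀ x y, |x - y| ≤ δ → |U' x - V' y| ≤ b) :
    ∫ z : ℝ × ℝ, doubledFlux f u v U U' V V' η ρ z.1 z.2 ≤
      L * (B * e * ((∫ x, |u x|) + ∫ x, |v x|) + c * (a * C + B * δ) + b * ∫ x, |v x|) := by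
  have hB : 0 ≤ B := (abs_nonneg _).trans (hUB 0)
  have he : 0 ≤ e := (abs_nonneg _).trans (hηe 0)
  have ha0 : 0 ≤ a := (abs_nonneg _).trans (ha 0 0 (by simpa using hδ))
  have hb0 : 0 ≤ b := (abs_nonneg _).trans (hb 0 0 (by simpa using hδ))
  have hC : 0 ≤ C := (integral_nonneg fun z => by positivity).trans hρ.moment_deriv_le
  have hL : (0 : ℝ) ≤ L := L.2
  have hu1 : 0 ≤ ∫ x, |u x| := integral_nonneg fun x => abs_nonneg _
  have hv1 : 0 ≤ ∫ x, |v x| := integral_nonneg fun x => abs_nonneg _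
  -- Without integrability the integral is zero by convention, and the right-hand side is
  -- non-negative.
  by_cases hJ : Integrable (fun z : ℝ × ℝ => doubledFlux f u v U U' V V' η ρ z.1 z.2)
  swap
  · rw [integral_undef hJ]; positivity
  have hρi := hρ.integrable
  have hρc := hρ.smooth.continuous
  have hρ'c : Continuous (deriv ρ) := hρ.smooth.continuous_deriv (by simp)
  have hρ's : HasCompactSupport (deriv ρ) := hρ.hasCompactSupport.deriv
  have hρ'i : Integrable (deriv ρ) := hρ'c.integrable_of_hasCompactSupport hρ's
  have hρ'0 : ∀ z, δ < |z| → deriv ρ z = 0 := by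
    intro z hz
    have : ρ =ᶠ[𝓝 z] fun _ => 0 := by
      filter_upwards [(isOpen_lt continuous_const continuous_abs).mem_nhds hz] with w hw
      exact hρ.eq_zero w (le_of_lt hw)
    rw [this.deriv_eq]; simp
  have hVc : Continuous V := continuous_iff_continuousAt.2 fun x => (hV x).continuousAt
  -- the part frozen at `v x`, which integrates to zero
  set G : ℝ × ℝ → ℝ := fun z => kruzhkovFlux f (u z.1) (v z.1) * η z.1 *
    ((U z.1 - V z.2) * deriv ρ (z.1 - z.2) + V' z.2 * ρ (z.1 - z.2)) with hG
  have hGi : Integrable G := by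
    have hFm : AEStronglyMeasurable (fun x => kruzhkovFlux f (u x) (v x)) :=
      ((measurable_kruzhkovFlux hf.continuous).comp_aemeasurable
        (hu.aemeasurable.prodMk hv.aemeasurable)).aestronglyMeasurable
    have hFm2 : AEStronglyMeasurable (fun z : ℝ × ℝ => kruzhkovFlux f (u z.1) (v z.1)) :=
      hFm.comp_fst
    have hFi : Integrable (fun x => kruzhkovFlux f (u x) (v x)) := by
      refine ((hu.abs.add hv.abs).const_mul (L : ℝ)).mono' hFm (Eventually.of_forall fun x => ?_)
      exact abs_kruzhkovFlux_le_add hf _ _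
    have h1 := ((integrable_fst_mul_sub hFi hρ'i).norm.const_mul (2 * B)).add
      ((integrable_fst_mul_sub hFi hρi).norm.const_mul B)
    have hm : AEStronglyMeasurable G := by
      refine (hFm2.mul (hη.continuous.comp continuous_fst).aestronglyMeasurable).mul ?_
      exact Continuous.aestronglyMeasurable (by fun_prop)
    refine h1.mono' hm (Eventually.of_forall fun z => ?_)
    simp only [hG, norm_mul, Real.norm_eq_abs, Pi.add_apply, abs_of_nonneg (hη0 _)]
    have i1 : |U z.1 - V z.2| ≤ 2 * B := by
      linarith [abs_sub (U z.1) (V z.2), hUB z.1, hVB z.2]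
    have i2 := abs_add_le ((U z.1 - V z.2) * deriv ρ (z.1 - z.2)) (V' z.2 * ρ (z.1 - z.2))
    rw [abs_mul, abs_mul] at i2
    calc _ ≤ |kruzhkovFlux f (u z.1) (v z.1)| * 1 *
          (2 * B * |deriv ρ (z.1 - z.2)| + B * |ρ (z.1 - z.2)|) := by
          gcongr
          · exact hη1 _
          · refine i2.trans ?_
            gcongr
            exact hVB' _
      _ = _ := by ring
  have hG0 : ∫ z, G z = 0 := by
    rw [Measure.volume_eq_prod, integral_prod _ hGi]
    refine integral_eq_zero_of_ae (Eventually.of_forall fun x => ?_)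
    simp only [hG, integral_const_mul, Pi.zero_apply]
    refine mul_eq_zero_of_right _ ?_
    -- For fixed `x` the remaining integrand is the derivative of a compactly supported function of
    -- `y`.
    have hd : ∀ y, HasDerivAt (fun y => -((U x - V y) * ρ (x - y)))
        ((U x - V y) * deriv ρ (x - y) + V' y * ρ (x - y)) y := by
      intro y
      have hρd : HasDerivAt ρ (deriv ρ (x - y)) (x - y) :=
        (hρ.smooth.differentiable (by simp)).differentiableAt.hasDerivAt
      have h1 := (((hV y).const_sub (U x)).mul (hρd.comp_const_sub x y)).neg
      refine h1.congr_deriv ?_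
      ring
    have hs : HasCompactSupport fun y => ρ (x - y) :=
      hρ.hasCompactSupport.comp_homeomorph (Homeomorph.subLeft x)
    have hs' : HasCompactSupport fun y => deriv ρ (x - y) :=
      hρ's.comp_homeomorph (Homeomorph.subLeft x)
    refine integral_eq_zero_of_hasDerivAt_of_integrable hd ?_ ?_
    · refine Integrable.add ?_ ?_
      · exact Continuous.integrable_of_hasCompactSupport (by fun_prop) hs'.mul_left
      · exact Continuous.integrable_of_hasCompactSupport (by fun_prop) hs.mul_left
    · exact (Continuous.integrable_of_hasCompactSupport (by fun_prop) hs.mul_left).neg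
  -- the remainder
  set κ : ℝ → ℝ := fun w => a * |deriv ρ w| + B * ρ w with hκ
  have hκc : Continuous κ := by fun_prop
  have hκs : HasCompactSupport κ :=
    (hρ's.comp_left (g := fun x => |x|) abs_zero).mul_left.add hρ.hasCompactSupport.mul_left
  have hκ0 : ∀ z, 0 ≤ κ z := fun z =>
    add_nonneg (mul_nonneg ha0 (abs_nonneg _)) (mul_nonneg hB (hρ.nonneg _))
  have hκi : Integrable κ := hκc.integrable_of_hasCompactSupport hκs
  have r1 := (integrable_fst_mul_sub hu.abs hρi).const_mul (B * e)
  have r2 := (integrable_snd_mul_sub hv.abs hρi).const_mul (B * e)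
  have r3 := integrable_abs_sub_mul_kernel hv hκi
  have r4 := (integrable_snd_mul_sub hv.abs hρi).const_mul b
  have hbound : ∀ z : ℝ × ℝ, doubledFlux f u v U U' V V' η ρ z.1 z.2 - G z ≤
      L * (B * e * (|u z.1| * ρ (z.1 - z.2)) + B * e * (|v z.2| * ρ (z.1 - z.2))
        + |v z.1 - v z.2| * κ (z.1 - z.2) + b * (|v z.2| * ρ (z.1 - z.2))) := by
    rintro ⟨x, y⟩
    -- The three pieces are the cut-off error, the error of freezing the flux at `v x`, and the
    -- mismatch of the coefficient derivatives.
    have hsplit : doubledFlux f u v U U' V V' η ρ x y - G (x, y)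
        = kruzhkovFlux f (u x) (v y) * (U x * deriv η x * ρ (x - y))
          + (kruzhkovFlux f (u x) (v y) - kruzhkovFlux f (u x) (v x)) *
            (((U x - V y) * deriv ρ (x - y) + V' y * ρ (x - y)) * η x)
          + Real.sign (u x - v y) * (f (v y) * ((V' y - U' x) * (η x * ρ (x - y)))) := by
      simp only [doubledFlux, hG, kruzhkovFlux]
      ring
    have t1 : kruzhkovFlux f (u x) (v y) * (U x * deriv η x * ρ (x - y)) ≤
        L * (|u x| + |v y|) * (B * e * ρ (x - y)) := by
      refine (le_abs_self _).trans ?_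
      rw [abs_mul, abs_mul, abs_mul, abs_of_nonneg (hρ.nonneg _)]
      have := hρ.nonneg (x - y)
      gcongr
      · exact abs_kruzhkovFlux_le_add hf _ _
      · exact hUB _
      · exact hηe _
    have t2 : (kruzhkovFlux f (u x) (v y) - kruzhkovFlux f (u x) (v x)) *
        (((U x - V y) * deriv ρ (x - y) + V' y * ρ (x - y)) * η x) ≤
        L * |v x - v y| * κ (x - y) := by
      refine (le_abs_self _).trans ?_
      rw [abs_mul, abs_mul, abs_of_nonneg (hη0 x), abs_sub_comm (v x)]
      have i1 : |(U x - V y) * deriv ρ (x - y) + V' y * ρ (x - y)| ≤ κ (x - y) := by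
        refine (abs_add_le _ _).trans ?_
        rw [abs_mul, abs_mul, abs_of_nonneg (hρ.nonneg _)]
        refine add_le_add ?_ (mul_le_mul_of_nonneg_right (hVB' _) (hρ.nonneg _))
        by_cases hxy : |x - y| ≤ δ
        · exact mul_le_mul_of_nonneg_right (ha x y hxy) (abs_nonneg _)
        · simp [hρ'0 _ (not_le.1 hxy)]
      calc _ ≤ L * |v y - v x| * (κ (x - y) * 1) := by
            refine mul_le_mul (abs_kruzhkovFlux_sub_le hf _ _ _)
              (mul_le_mul i1 (hη1 x) (hη0 x) (hκ0 _)) (mul_nonneg (abs_nonneg _) (hη0 x))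
              (by positivity)
        _ = _ := by ring
    have t3 : Real.sign (u x - v y) * (f (v y) * ((V' y - U' x) * (η x * ρ (x - y)))) ≤
        1 * ((L * |v y|) * (b * (1 * ρ (x - y)))) := by
      refine (le_abs_self _).trans ?_
      simp only [abs_mul, abs_of_nonneg (hρ.nonneg _), abs_of_nonneg (hη0 x)]
      have i1 : |f (v y)| ≤ L * |v y| := by
        simpa [hf0] using abs_sub_le_of_lipschitz hf (v y) 0
      have i2 : |V' y - U' x| * (η x * ρ (x - y)) ≤ b * (1 * ρ (x - y)) := by
        have := hρ.nonneg (x - y)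
        by_cases hxy : |x - y| ≤ δ
        · have := hb x y hxy
          rw [abs_sub_comm] at this
          have := hη0 x
          have := hη1 x
          gcongr
        · simp [hρ.eq_zero _ (not_le.1 hxy).le]
      have i3 : 0 ≤ |V' y - U' x| * (η x * ρ (x - y)) :=
        mul_nonneg (abs_nonneg _) (mul_nonneg (hη0 _) (hρ.nonneg _))
      gcongr
      exact abs_real_sign_le _
    simp only
    rw [hsplit]
    calc _ ≤ _ := add_le_add (add_le_add t1 t2) t3
      _ = _ := by ring
  have hmain : ∫ z : ℝ × ℝ, doubledFlux f u v U U' V V' η ρ z.1 z.2 =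
      ∫ z : ℝ × ℝ, (doubledFlux f u v U U' V V' η ρ z.1 z.2 - G z) := by
    rw [integral_sub hJ hGi, hG0, sub_zero]
  rw [hmain]
  have r12 : Integrable fun z : ℝ × ℝ =>
      B * e * (|u z.1| * ρ (z.1 - z.2)) + B * e * (|v z.2| * ρ (z.1 - z.2)) := r1.add r2
  have r123 : Integrable fun z : ℝ × ℝ =>
      B * e * (|u z.1| * ρ (z.1 - z.2)) + B * e * (|v z.2| * ρ (z.1 - z.2))
        + |v z.1 - v z.2| * κ (z.1 - z.2) := r12.add r3
  refine (integral_mono (hJ.sub hGi) ((r123.add r4).const_mul (L : ℝ)) hbound).trans ?_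
  simp only [Pi.add_apply]
  rw [integral_const_mul, integral_add r123 r4, integral_add r12 r3,
    integral_add r1 r2, integral_const_mul, integral_const_mul, integral_const_mul,
    integral_fst_mul_sub hu.abs hρi, integral_snd_mul_sub hv.abs hρi, hρ.integral_eq_one]
  have hκle : ∫ w, |w| * κ w ≤ a * C + B * δ := by
    have j1 : Integrable fun w => a * (|w| * |deriv ρ w|) :=
      (Continuous.integrable_of_hasCompactSupport (by fun_prop)
        (hρ's.comp_left (g := fun x => |x|) abs_zero).mul_left).const_mul a
    have j2 : Integrable fun w => B * (|w| * ρ w) :=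
      (Continuous.integrable_of_hasCompactSupport (by fun_prop)
        hρ.hasCompactSupport.mul_left).const_mul B
    have : ∀ w, |w| * κ w = a * (|w| * |deriv ρ w|) + B * (|w| * ρ w) := fun w => by
      simp only [hκ]; ring
    simp_rw [this]
    rw [integral_add j1 j2, integral_const_mul, integral_const_mul]
    gcongr
    · exact hρ.moment_deriv_le
    · exact hρ.integral_abs_mul_le
  have h5 := (integral_abs_sub_mul_kernel_le hv htr hκc hκs hκ0).trans
    (mul_le_mul_of_nonneg_left hκle hc)
  refine mul_le_mul_of_nonneg_left ?_ hL
  linarith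

theorem integrable_doubled_abs_sub {u w η ρ : ℝ → ℝ} {C δ : ℝ}
    (hu : Integrable u) (hw : Integrable w) (hη : ContDiff ℝ ∞ η) (hη0 : ∀ x, 0 ≤ η x)
    (hη1 : ∀ x, η x ≤ 1) (hρ : IsMollifier C δ ρ) :
    Integrable fun z : ℝ × ℝ => |u z.1 - w z.2| * (η z.1 * ρ (z.1 - z.2)) := by
  have hρi := hρ.integrable
  have hρc := hρ.smooth.continuous
  have hηc := hη.continuous
  have hm1 : AEStronglyMeasurable (fun z : ℝ × ℝ => u z.1) := hu.aestronglyMeasurable.comp_fst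
  have hm2 : AEStronglyMeasurable (fun z : ℝ × ℝ => w z.2) := hw.aestronglyMeasurable.comp_snd
  refine ((integrable_fst_mul_sub hu.abs hρi).add (integrable_snd_mul_sub hw.abs hρi)).mono'
    ((hm1.sub hm2).norm.mul (Continuous.aestronglyMeasurable (by fun_prop)))
    (Eventually.of_forall fun z => ?_)
  simp only [norm_mul, Real.norm_eq_abs, abs_abs, Pi.add_apply, abs_of_nonneg (hη0 _),
    abs_of_nonneg (hρ.nonneg _)]
  rw [← add_mul]
  have h0 := hρ.nonneg (z.1 - z.2)
  refine mul_le_mul (abs_sub _ _) ?_ (mul_nonneg (hη0 _) h0) (by positivity)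
  exact mul_le_of_le_one_left h0 (hη1 _)

/-- Here `w` stands for `v` at the second time `s` and `v` for the same solution at time `t`.
Passing from `w y` to `w x` costs a translation error `c δ`, and passing from `w x` to `v x` costs
the `L¹` modulus of continuity in time. -/
theorem abs_integral_doubled_abs_sub_le {u v w η ρ : ℝ → ℝ} {c C δ : ℝ}
    (hu : Integrable u) (hv : Integrable v) (hw : Integrable w)
    (htr : ∀ h, ∫ x, |w (x + h) - w x| ≤ c * |h|) (hc : 0 ≤ c)
    (hη : ContDiff ℝ ∞ η) (hη0 : ∀ x, 0 ≤ η x) (hη1 : ∀ x, η x ≤ 1)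
    (hρ : IsMollifier C δ ρ) :
    |(∫ z : ℝ × ℝ, |u z.1 - w z.2| * (η z.1 * ρ (z.1 - z.2))) - ∫ x, |u x - v x| * η x| ≤
      (∫ x, |w x - v x|) + c * δ := by
  have hρi := hρ.integrable
  have hρc := hρ.smooth.continuous
  have hηc := hη.continuous
  have huvm : Integrable (fun x => |u x - v x| * η x) :=
    (hu.sub hv).abs.mul_bdd (c := 1) hηc.aestronglyMeasurable
      (Eventually.of_forall fun x => by simpa [abs_of_nonneg (hη0 x)] using hη1 x)
  have h1 := integral_fst_mul_sub huvm hρi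
  rw [hρ.integral_eq_one, mul_one] at h1
  have h1i := integrable_fst_mul_sub huvm hρi
  have hA := integrable_doubled_abs_sub hu hw hη hη0 hη1 hρ
  have e1 := integrable_abs_sub_mul_kernel hw hρi
  have e2 := integrable_fst_mul_sub (hw.sub hv).abs hρi
  rw [← h1, ← integral_sub hA h1i]
  refine abs_integral_le_integral_abs.trans ?_
  have hle : ∀ z : ℝ × ℝ, |(|u z.1 - w z.2| * (η z.1 * ρ (z.1 - z.2))
      - |u z.1 - v z.1| * η z.1 * ρ (z.1 - z.2))| ≤
      |w z.1 - w z.2| * ρ (z.1 - z.2) + |w z.1 - v z.1| * ρ (z.1 - z.2) := by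
    intro z
    have h0 := hρ.nonneg (z.1 - z.2)
    rw [mul_assoc, ← sub_mul, abs_mul, ← add_mul, abs_of_nonneg (mul_nonneg (hη0 _) h0)]
    refine mul_le_mul ?_ (mul_le_of_le_one_left h0 (hη1 _)) (mul_nonneg (hη0 _) h0)
      (by positivity)
    refine (abs_abs_sub_abs_le_abs_sub _ _).trans ?_
    rw [show u z.1 - w z.2 - (u z.1 - v z.1) = (w z.1 - w z.2) - (w z.1 - v z.1) by ring]
    exact abs_sub _ _
  refine (integral_mono (hA.sub h1i).abs (e1.add e2) hle).trans ?_
  simp only [Pi.add_apply]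
  rw [integral_add e1 e2, add_comm]
  refine add_le_add ?_ ?_
  · have := integral_fst_mul_sub (hw.sub hv).abs hρi
    rw [hρ.integral_eq_one, mul_one] at this
    exact this.le
  · refine (integral_abs_sub_mul_kernel_le hw htr hρc hρ.hasCompactSupport hρ.nonneg).trans ?_
    refine mul_le_mul_of_nonneg_left ?_ hc
    exact hρ.integral_abs_mul_le

/-! ### Product measures on the doubled strip -/

theorem measurePreserving_prod_prod_prod_comm {α β γ δ : Type*} [MeasurableSpace α]
    [MeasurableSpace β] [MeasurableSpace γ] [MeasurableSpace δ] (μa : Measure α) (μb : Measure β)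
    (μc : Measure γ) (μd : Measure δ) [SFinite μa] [SFinite μb] [SFinite μc] [SFinite μd] :
    MeasurePreserving (fun z : (α × β) × (γ × δ) => ((z.1.1, z.2.1), (z.1.2, z.2.2)))
      ((μa.prod μb).prod (μc.prod μd)) ((μa.prod μc).prod (μb.prod μd)) := by
  have h1 : MeasurePreserving (MeasurableEquiv.prodAssoc : (α × β) × (γ × δ) ≃ᵐ _)
      ((μa.prod μb).prod (μc.prod μd)) (μa.prod (μb.prod (μc.prod μd))) :=
    ⟨MeasurableEquiv.measurable _, Measure.prodAssoc_prod⟩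
  have h2 : MeasurePreserving (MeasurableEquiv.prodAssoc : (β × γ) × δ ≃ᵐ _)
      ((μb.prod μc).prod μd) (μb.prod (μc.prod μd)) :=
    ⟨MeasurableEquiv.measurable _, Measure.prodAssoc_prod⟩
  have h2' : MeasurePreserving (MeasurableEquiv.prodAssoc : (γ × β) × δ ≃ᵐ _)
      ((μc.prod μb).prod μd) (μc.prod (μb.prod μd)) :=
    ⟨MeasurableEquiv.measurable _, Measure.prodAssoc_prod⟩
  have h3 : MeasurePreserving (MeasurableEquiv.prodAssoc : (α × γ) × (β × δ) ≃ᵐ _)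
      ((μa.prod μc).prod (μb.prod μd)) (μa.prod (μc.prod (μb.prod μd))) :=
    ⟨MeasurableEquiv.measurable _, Measure.prodAssoc_prod⟩
  have hs : MeasurePreserving (Prod.map (Prod.swap : β × γ → γ × β) (id : δ → δ))
      ((μb.prod μc).prod μd) ((μc.prod μb).prod μd) :=
    Measure.measurePreserving_swap.prod (MeasurePreserving.id μd)
  have hmid := h2'.comp (hs.comp (h2.symm _))
  exact (h3.symm _).comp (((MeasurePreserving.id μa).prod hmid).comp h1)

/-- The measurable equivalence that exchanges the two middle components. -/
def prodProdProdComm (α β γ δ : Type*) [MeasurableSpace α]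
    [MeasurableSpace β] [MeasurableSpace γ] [MeasurableSpace δ] :
    (α × β) × (γ × δ) ≃ᵐ (α × γ) × (β × δ) where
  toEquiv := Equiv.prodProdProdComm α β γ δ
  measurable_toFun := by
    simp only [Equiv.prodProdProdComm, Equiv.coe_fn_mk]; fun_prop
  measurable_invFun := by
    simp only [Equiv.prodProdProdComm, Equiv.coe_fn_symm_mk]; fun_prop

theorem volume_restrict_strip (T : ℝ) :
    (volume : Measure (ℝ × ℝ)).restrict (strip T)
      = ((volume : Measure ℝ).restrict (Ioo 0 T)).prod volume := by
  rw [strip, Measure.volume_eq_prod, ← Measure.prod_restrict, Measure.restrict_univ]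

/-- Smooth non-negative functions with compact support on the line. -/
structure IsSpaceTest (b : ℝ → ℝ) : Prop where
  smooth : ContDiff ℝ ∞ b
  hasCompactSupport : HasCompactSupport b
  nonneg : ∀ x, 0 ≤ b x

/-! ### Entropy flows with a prescribed coefficient -/

/-- Entropy solutions of `∂ₜ u + ∂ₓ (U f(u)) = 0` on `(0,T) × ℝ` for a given coefficient `U` with
`∂ₓ U = U'`, uniformly of bounded variation in space (in the form of an `L¹` translation
estimate with constant `c`). -/
structure IsBVEntropyFlow (f : ℝ → ℝ) (T : ℝ) (U U' u : ℝ → ℝ → ℝ) (c : ℝ) : Prop where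
  integrable : ∀ t ∈ Icc 0 T, Integrable (u t)
  uniformContinuous : ∀ ε > 0, ∃ δ > 0, ∀ s ∈ Icc 0 T, ∀ t ∈ Icc 0 T, |s - t| ≤ δ →
    ∫ x, |u s x - u t x| ≤ ε
  aestronglyMeasurable :
    AEStronglyMeasurable (fun p : ℝ × ℝ => u p.1 p.2) (volume.restrict (strip T))
  translation_le : ∀ t ∈ Icc 0 T, ∀ h, ∫ x, |u t (x + h) - u t x| ≤ c * |h|
  hasDerivAt : ∀ t ∈ Icc 0 T, ∀ x, HasDerivAt (U t) (U' t x) x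
  coeff_bounded : ∃ B, ∀ t ∈ Icc 0 T, ∀ x, |U t x| ≤ B ∧ |U' t x| ≤ B
  coeff_uniformContinuous : ∀ ε > 0, ∃ δ > 0, ∀ s ∈ Icc 0 T, ∀ t ∈ Icc 0 T, ∀ x y,
    |s - t| ≤ δ → |x - y| ≤ δ → |U s x - U t y| ≤ ε ∧ |U' s x - U' t y| ≤ ε
  entropy : ∀ (k : ℝ) (a b : ℝ → ℝ), IsTimeTest T a → IsSpaceTest b →
    0 ≤ ∫ p in strip T, (|u p.1 p.2 - k| * (deriv a p.1 * b p.2)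
      + kruzhkovFlux f (u p.1 p.2) k * U p.1 p.2 * (a p.1 * deriv b p.2)
      - Real.sign (u p.1 p.2 - k) * f k * U' p.1 p.2 * (a p.1 * b p.2))

theorem aestronglyMeasurable_strip_of_uniform {T : ℝ} {W : ℝ → ℝ → ℝ}
    (h : ∀ ε > 0, ∃ δ > 0, ∀ s ∈ Icc 0 T, ∀ t ∈ Icc 0 T, ∀ x y,
      |s - t| ≤ δ → |x - y| ≤ δ → |W s x - W t y| ≤ ε) :
    AEStronglyMeasurable (fun p : ℝ × ℝ => W p.1 p.2) (volume.restrict (strip T)) := by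
  have hms : MeasurableSet (strip T) := measurableSet_Ioo.prod MeasurableSet.univ
  refine ContinuousOn.aestronglyMeasurable (fun p hp => ?_) hms
  rw [Metric.continuousWithinAt_iff]
  intro ε hε
  obtain ⟨δ, hδ, hd⟩ := h (ε / 2) (by positivity)
  refine ⟨δ, hδ, fun {q} hq hqp => ?_⟩
  rw [Prod.dist_eq, max_lt_iff, Real.dist_eq, Real.dist_eq] at hqp
  rw [Real.dist_eq]
  exact (hd _ (Ioo_subset_Icc_self hq.1) _ (Ioo_subset_Icc_self hp.1) _ _ hqp.1.le
    hqp.2.le).trans_lt (by linarith)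

namespace IsBVEntropyFlow

variable {f : ℝ → ℝ} {T c : ℝ} {U U' u : ℝ → ℝ → ℝ}

theorem aestronglyMeasurable_coeff (h : IsBVEntropyFlow f T U U' u c) :
    AEStronglyMeasurable (fun p : ℝ × ℝ => U p.1 p.2) (volume.restrict (strip T)) :=
  aestronglyMeasurable_strip_of_uniform fun ε hε =>
    (h.coeff_uniformContinuous ε hε).imp fun _ hd =>
      ⟨hd.1, fun s hs t ht x y h1 h2 => (hd.2 s hs t ht x y h1 h2).1⟩

theorem aestronglyMeasurable_coeff_deriv (h : IsBVEntropyFlow f T U U' u c) :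
    AEStronglyMeasurable (fun p : ℝ × ℝ => U' p.1 p.2) (volume.restrict (strip T)) :=
  aestronglyMeasurable_strip_of_uniform fun ε hε =>
    (h.coeff_uniformContinuous ε hε).imp fun _ hd =>
      ⟨hd.1, fun s hs t ht x y h1 h2 => (hd.2 s hs t ht x y h1 h2).2⟩

theorem continuous_coeff_deriv (h : IsBVEntropyFlow f T U U' u c) {t : ℝ} (ht : t ∈ Icc 0 T) :
    Continuous (U' t) := by
  rw [Metric.continuous_iff]
  intro y ε hε
  obtain ⟨δ, hδ, hd⟩ := h.coeff_uniformContinuous (ε / 2) (by positivity)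
  refine ⟨δ, hδ, fun x hx => ?_⟩
  rw [Real.dist_eq] at hx ⊢
  exact (hd t ht t ht x y (by simpa using hδ.le) hx.le).2.trans_lt (by linarith)

theorem continuous_coeff (h : IsBVEntropyFlow f T U U' u c) {t : ℝ} (ht : t ∈ Icc 0 T) :
    Continuous (U t) :=
  continuous_iff_continuousAt.2 fun x => (h.hasDerivAt t ht x).continuousAt

end IsBVEntropyFlow

/-- Continuity of the `L¹` distance of two `L¹`-continuous curves. -/
theorem continuousOn_integral_abs_sub {T : ℝ} {u v : ℝ → ℝ → ℝ}
    (hu : ∀ t ∈ Icc 0 T, Integrable (u t)) (hv : ∀ t ∈ Icc 0 T, Integrable (v t))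
    (hu' : ∀ ε > 0, ∃ δ > 0, ∀ s ∈ Icc 0 T, ∀ t ∈ Icc 0 T, |s - t| ≤ δ →
      ∫ x, |u s x - u t x| ≤ ε)
    (hv' : ∀ ε > 0, ∃ δ > 0, ∀ s ∈ Icc 0 T, ∀ t ∈ Icc 0 T, |s - t| ≤ δ →
      ∫ x, |v s x - v t x| ≤ ε) {g : ℝ → ℝ} (hg : Continuous g) (hg0 : ∀ x, 0 ≤ g x)
    (hg1 : ∀ x, g x ≤ 1) :
    ContinuousOn (fun t => ∫ x, |u t x - v t x| * g x) (Icc 0 T) := by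
  intro t ht
  rw [Metric.continuousWithinAt_iff]
  intro ε hε
  obtain ⟨δ₁, hδ₁, h₁⟩ := hu' (ε / 3) (by positivity)
  obtain ⟨δ₂, hδ₂, h₂⟩ := hv' (ε / 3) (by positivity)
  have hint : ∀ s ∈ Icc 0 T, Integrable fun x => |u s x - v s x| * g x := fun s hs =>
    ((hu s hs).sub (hv s hs)).abs.mul_bdd (c := 1) hg.aestronglyMeasurable
      (Eventually.of_forall fun x => by simpa [abs_of_nonneg (hg0 x)] using hg1 x)
  refine ⟨min δ₁ δ₂, lt_min hδ₁ hδ₂, fun {s} hs hst => ?_⟩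
  rw [Real.dist_eq, lt_min_iff] at hst
  have b1 := h₁ s hs t ht hst.1.le
  have b2 := h₂ s hs t ht hst.2.le
  have i1 := ((hu s hs).sub (hu t ht)).abs
  have i2 := ((hv s hs).sub (hv t ht)).abs
  rw [Real.dist_eq, ← integral_sub (hint s hs) (hint t ht)]
  refine abs_integral_le_integral_abs.trans_lt ?_
  have hle : ∀ x, |(|u s x - v s x| * g x - |u t x - v t x| * g x)| ≤
      |u s x - u t x| + |v s x - v t x| := by
    intro x
    rw [← sub_mul, abs_mul, abs_of_nonneg (hg0 x)]
    refine (mul_le_of_le_one_right (abs_nonneg _) (hg1 x)).trans ?_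
    refine (abs_abs_sub_abs_le_abs_sub _ _).trans ?_
    rw [show u s x - v s x - (u t x - v t x) = (u s x - u t x) - (v s x - v t x) by ring]
    exact abs_sub _ _
  have := integral_mono ((hint s hs).sub (hint t ht)).abs (i1.add i2) hle
  simp only [Pi.add_apply] at this
  rw [integral_add i1 i2] at this
  simp only [Pi.sub_apply] at this
  linarith

theorem integrable_strip_of_bound {T m : ℝ} {u : ℝ → ℝ → ℝ}
    (hu : ∀ t ∈ Icc 0 T, Integrable (u t)) (hm : ∀ t ∈ Icc 0 T, ∫ x, |u t x| ≤ m)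
    (hmeas : AEStronglyMeasurable (fun p : ℝ × ℝ => u p.1 p.2) (volume.restrict (strip T))) :
    Integrable (fun p : ℝ × ℝ => u p.1 p.2) (volume.restrict (strip T)) := by
  rw [volume_restrict_strip] at hmeas ⊢
  rw [integrable_prod_iff hmeas]
  have hae : ∀ᵐ t ∂(volume.restrict (Ioo 0 T)), t ∈ Icc 0 T :=
    (ae_restrict_mem measurableSet_Ioo).mono fun t ht => Ioo_subset_Icc_self ht
  refine ⟨hae.mono fun t ht => hu t ht, ?_⟩
  refine (integrable_const m).mono' hmeas.norm.integral_prod_right' (hae.mono fun t ht => ?_)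
  rw [Real.norm_eq_abs, abs_of_nonneg (integral_nonneg fun x => norm_nonneg _)]
  exact hm t ht

theorem IsBVEntropyFlow.exists_integral_abs_le {f : ℝ → ℝ} {T c : ℝ} {U U' u : ℝ → ℝ → ℝ}
    (h : IsBVEntropyFlow f T U U' u c) : ∃ m, 0 ≤ m ∧ ∀ t ∈ Icc 0 T, ∫ x, |u t x| ≤ m := by
  have hc := continuousOn_integral_abs_sub h.integrable (v := fun _ _ => 0)
    (fun _ _ => integrable_zero _ _ _) h.uniformContinuous
    (fun ε hε => ⟨1, one_pos, fun s _ t _ _ => by simpa using hε.le⟩)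
    (g := fun _ => 1) continuous_const (fun _ => zero_le_one) (fun _ => le_rfl)
  simp only [sub_zero, mul_one] at hc
  obtain ⟨m, hm⟩ := isCompact_Icc.exists_bound_of_continuousOn hc
  refine ⟨max m 0, le_max_right _ _, fun t ht => ?_⟩
  exact ((le_abs_self _).trans (hm t ht)).trans (le_max_left _ _)

theorem IsBVEntropyFlow.integrable_strip {f : ℝ → ℝ} {T c : ℝ} {U U' u : ℝ → ℝ → ℝ}
    (h : IsBVEntropyFlow f T U U' u c) :
    Integrable (fun p : ℝ × ℝ => u p.1 p.2) (volume.restrict (strip T)) := by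
  obtain ⟨m, -, hm⟩ := h.exists_integral_abs_le
  exact integrable_strip_of_bound h.integrable hm h.aestronglyMeasurable

/-! ### Doubling of variables -/

theorem exists_indicator_bound {k : ℝ × ℝ → ℝ} (hk : Continuous k) (hks : HasCompactSupport k) :
    ∃ M R : ℝ, 0 ≤ M ∧ ∀ x y, |k (x, y)| ≤
      M * ((Icc (-R) R).indicator (fun _ => (1 : ℝ)) x * (Icc (-R) R).indicator (fun _ => 1) y) := by
  obtain ⟨M, hM⟩ := hk.bounded_above_of_compact_support hks
  obtain ⟨R, hR⟩ := hks.isCompact.isBounded.subset_closedBall 0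
  refine ⟨M, R, (norm_nonneg _).trans (hM 0), fun x y => ?_⟩
  by_cases hz : (x, y) ∈ tsupport k
  · have := hR hz
    rw [Metric.mem_closedBall, dist_zero_right, Prod.norm_def, max_le_iff] at this
    rw [indicator_of_mem (mem_Icc.2 (abs_le.1 this.1)), indicator_of_mem (mem_Icc.2 (abs_le.1 this.2))]
    simpa using hM (x, y)
  · rw [image_eq_zero_of_notMem_tsupport hz, abs_zero]
    exact mul_nonneg ((norm_nonneg _).trans (hM 0)) (mul_nonneg
      (indicator_nonneg (fun _ _ => zero_le_one) _) (indicator_nonneg (fun _ _ => zero_le_one) _))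

theorem hasCompactSupport_mul_sub {a r : ℝ → ℝ} (ha : HasCompactSupport a)
    (hr : HasCompactSupport r) : HasCompactSupport fun z : ℝ × ℝ => a z.1 * r (z.1 - z.2) := by
  obtain ⟨R, hR⟩ := ha.isCompact.isBounded.subset_closedBall 0
  obtain ⟨S, hS⟩ := hr.isCompact.isBounded.subset_closedBall 0
  refine HasCompactSupport.intro (isCompact_closedBall (0 : ℝ × ℝ) (max R (R + S))) fun z hz => ?_
  by_contra hne
  obtain ⟨h1, h2⟩ := mul_ne_zero_iff.1 hne
  have h1' := hR (subset_tsupport _ (Function.mem_support.2 h1))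
  have h2' := hS (subset_tsupport _ (Function.mem_support.2 h2))
  apply hz
  rw [Metric.mem_closedBall, dist_zero_right] at h1' h2' ⊢
  rw [Prod.norm_def]
  refine max_le (h1'.trans (le_max_left _ _)) (le_trans ?_ (le_max_right _ _))
  have := norm_sub_le z.1 (z.1 - z.2)
  rw [sub_sub_cancel] at this
  linarith

/-- The growth bound is a sum in which each term involves only one of the two points, so it is not
integrable on the product by itself. Dominating `k` by a product of indicators supplies
integrability in the missing space variable; the time interval is bounded. -/
theorem integrable_doubled {T : ℝ} {g₁ g₂ : ℝ × ℝ → ℝ} {w : (ℝ × ℝ) × (ℝ × ℝ) → ℝ} {C : ℝ}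
    (h₁ : Integrable g₁ (volume.restrict (strip T)))
    (h₂ : Integrable g₂ (volume.restrict (strip T)))
    (hw : AEStronglyMeasurable w
      ((volume.restrict (strip T)).prod (volume.restrict (strip T))))
    (hwle : ∀ p ∈ strip T, ∀ q ∈ strip T, |w (p, q)| ≤ C * (|g₁ p| + |g₂ q|))
    {m k : ℝ × ℝ → ℝ} (hm : Continuous m) (hms : HasCompactSupport m)
    (hk : Continuous k) (hks : HasCompactSupport k) :
    Integrable (fun z => w z * (m (z.1.1, z.2.1) * k (z.1.2, z.2.2)))
      ((volume.restrict (strip T)).prod (volume.restrict (strip T))) := by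
  obtain ⟨N, hN⟩ := hm.bounded_above_of_compact_support hms
  obtain ⟨M, R, hM, hkle⟩ := exists_indicator_bound hk hks
  have hN0 : 0 ≤ N := (norm_nonneg _).trans (hN 0)
  have hms : MeasurableSet (strip T) := measurableSet_Ioo.prod MeasurableSet.univ
  set ι : ℝ → ℝ := (Icc (-R) R).indicator fun _ => (1 : ℝ) with hι
  have hι0 : ∀ x, 0 ≤ ι x := fun x => indicator_nonneg (fun _ _ => zero_le_one) x
  have hι1 : ∀ x, ι x ≤ 1 := fun x => indicator_le_self' (fun _ _ => zero_le_one) x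
  have hιi : Integrable (fun p : ℝ × ℝ => ι p.2) (volume.restrict (strip T)) := by
    rw [volume_restrict_strip]
    have : Integrable ι := (integrable_indicator_iff measurableSet_Icc).2
      (integrableOn_const (by simp))
    exact this.comp_snd _
  have hi := ((h₁.abs.mul_prod hιi).add (hιi.mul_prod h₂.abs)).const_mul (|C| * (N * M))
  refine hi.mono' (hw.mul (Continuous.aestronglyMeasurable (by fun_prop))) ?_
  have ae1 : ∀ᵐ z ∂((volume.restrict (strip T)).prod (volume.restrict (strip T))),
      z.1 ∈ strip T := Measure.quasiMeasurePreserving_fst.ae (ae_restrict_mem hms)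
  have ae2 : ∀ᵐ z ∂((volume.restrict (strip T)).prod (volume.restrict (strip T))),
      z.2 ∈ strip T := Measure.quasiMeasurePreserving_snd.ae (ae_restrict_mem hms)
  filter_upwards [ae1, ae2] with z hz1 hz2
  simp only [norm_mul, Real.norm_eq_abs, Pi.add_apply]
  have e1 : |w z| ≤ |C| * (|g₁ z.1| + |g₂ z.2|) :=
    (hwle z.1 hz1 z.2 hz2).trans (by gcongr; exact le_abs_self C)
  have e2 : |k (z.1.2, z.2.2)| ≤ M * (ι z.1.2 * ι z.2.2) := hkle _ _
  have e3 : |m (z.1.1, z.2.1)| ≤ N := hN _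
  calc |w z| * (|m (z.1.1, z.2.1)| * |k (z.1.2, z.2.2)|)
      ≤ |C| * (|g₁ z.1| + |g₂ z.2|) * (N * (M * (ι z.1.2 * ι z.2.2))) := by gcongr
    _ = |C| * (N * M) * (|g₁ z.1| * (ι z.1.2 * ι z.2.2) + ι z.1.2 * ι z.2.2 * |g₂ z.2|) := by
        ring
    _ ≤ |C| * (N * M) * (|g₁ z.1| * ι z.2.2 + ι z.1.2 * |g₂ z.2|) := by
        have := hι0 z.2.2
        have := hι0 z.1.2
        gcongr
        · exact mul_le_of_le_one_left (hι0 _) (hι1 _)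
        · exact mul_le_of_le_one_right (hι0 _) (hι1 _)

/-- The integrand obtained by doubling the variables, at times `t`, `s` and positions `x`, `y`. -/
noncomputable def doubledIntegrand (f : ℝ → ℝ) (u v U U' V V' : ℝ → ℝ → ℝ) (χ θ η ρ : ℝ → ℝ)
    (w z : ℝ × ℝ) : ℝ :=
  θ (w.1 - w.2) * (deriv χ w.1 * (|u w.1 z.1 - v w.2 z.2| * (η z.1 * ρ (z.1 - z.2)))
    + χ w.1 * doubledFlux f (u w.1) (v w.2) (U w.1) (U' w.1) (V w.2) (V' w.2) η ρ z.1 z.2)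

theorem IsTimeTest.mul_shift {T C ε : ℝ} {χ θ : ℝ → ℝ} (hχ : IsTimeTest T χ)
    (hθ : IsMollifier C ε θ)
    (s : ℝ) : IsTimeTest T (fun t => χ t * θ (t - s)) where
  smooth := hχ.smooth.mul (hθ.smooth.comp (contDiff_id.sub contDiff_const))
  hasCompactSupport := hχ.hasCompactSupport.mul_right
  tsupport_subset := (tsupport_mul_subset_left (f := χ)).trans hχ.tsupport_subset
  nonneg t := mul_nonneg (hχ.nonneg t) (hθ.nonneg _)

/-- As a function of the second time, the test function lives in a window of radius `ε` around `t`;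
`hε` keeps that window inside `(0, T)` whenever `χ t ≠ 0`. -/
theorem IsTimeTest.const_mul_shift {T C ε : ℝ} {χ θ : ℝ → ℝ} (hχ : IsTimeTest T χ)
    (hθ : IsMollifier C ε θ) (hε : ∀ t, χ t ≠ 0 → Icc (t - ε) (t + ε) ⊆ Ioo 0 T)
    (t : ℝ) : IsTimeTest T (fun s => χ t * θ (t - s)) where
  smooth := contDiff_const.mul (hθ.smooth.comp (contDiff_const.sub contDiff_id))
  hasCompactSupport := (hθ.hasCompactSupport.comp_homeomorph (Homeomorph.subLeft t)).mul_left
  tsupport_subset := by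
    by_cases h : χ t = 0
    · simp [h, tsupport]
    · refine (closure_minimal (fun s hs => ?_) isClosed_Icc).trans (hε t h)
      by_contra hn
      refine hs (mul_eq_zero_of_right _ (hθ.eq_zero _ ?_))
      by_contra hc
      have := abs_lt.1 (not_le.1 hc)
      exact hn ⟨by linarith, by linarith⟩
  nonneg s := mul_nonneg (hχ.nonneg t) (hθ.nonneg _)

theorem IsSpaceTest.mul_shift {C ε : ℝ} {η ρ : ℝ → ℝ} (hη : IsSpaceTest η)
    (hρ : IsMollifier C ε ρ) (y : ℝ) : IsSpaceTest (fun x => η x * ρ (x - y)) where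
  smooth := hη.smooth.mul (hρ.smooth.comp (contDiff_id.sub contDiff_const))
  hasCompactSupport := hη.hasCompactSupport.mul_right
  nonneg t := mul_nonneg (hη.nonneg t) (hρ.nonneg _)

theorem IsSpaceTest.const_mul_shift {C ε : ℝ} {η ρ : ℝ → ℝ} (hη : IsSpaceTest η)
    (hρ : IsMollifier C ε ρ) (x : ℝ) : IsSpaceTest (fun y => η x * ρ (x - y)) where
  smooth := contDiff_const.mul (hρ.smooth.comp (contDiff_const.sub contDiff_id))
  hasCompactSupport := (hρ.hasCompactSupport.comp_homeomorph (Homeomorph.subLeft x)).mul_left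
  nonneg _ := mul_nonneg (hη.nonneg x) (hρ.nonneg _)

theorem hasDerivAt_mul_shift {a r : ℝ → ℝ} (ha : ContDiff ℝ ∞ a) (hr : ContDiff ℝ ∞ r) (s t : ℝ) :
    HasDerivAt (fun t => a t * r (t - s)) (deriv a t * r (t - s) + a t * deriv r (t - s)) t := by
  have h1 : HasDerivAt a (deriv a t) t := (ha.differentiable (by simp)).differentiableAt.hasDerivAt
  have h2 : HasDerivAt r (deriv r (t - s)) (t - s) :=
    (hr.differentiable (by simp)).differentiableAt.hasDerivAt
  exact h1.mul (h2.comp_sub_const t s)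

theorem hasDerivAt_const_mul_shift {r : ℝ → ℝ} (hr : ContDiff ℝ ∞ r) (a t s : ℝ) :
    HasDerivAt (fun s => a * r (t - s)) (-(a * deriv r (t - s))) s := by
  have h2 : HasDerivAt r (deriv r (t - s)) (t - s) :=
    (hr.differentiable (by simp)).differentiableAt.hasDerivAt
  refine ((h2.comp_const_sub t s).const_mul a).congr_deriv ?_
  ring

/-- Doubling of variables. -/
theorem doubling {f : ℝ → ℝ} {L : ℝ≥0} (hf : LipschitzWith L f) (hf0 : f 0 = 0)
    {T c d Cθ ε Cρ δ : ℝ} {U U' u V V' v : ℝ → ℝ → ℝ}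
    (hu : IsBVEntropyFlow f T U U' u c) (hv : IsBVEntropyFlow f T V V' v d)
    {χ θ η ρ : ℝ → ℝ} (hχ : IsTimeTest T χ) (hθ : IsMollifier Cθ ε θ)
    (hε : ∀ t, χ t ≠ 0 → Icc (t - ε) (t + ε) ⊆ Ioo 0 T)
    (hη : IsSpaceTest η) (hρ : IsMollifier Cρ δ ρ) :
    Integrable (fun z : (ℝ × ℝ) × (ℝ × ℝ) => doubledIntegrand f u v U U' V V' χ θ η ρ z.1 z.2)
      (((volume.restrict (Ioo 0 T)).prod (volume.restrict (Ioo 0 T))).prod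
        (volume.prod volume)) ∧
    0 ≤ ∫ z : (ℝ × ℝ) × (ℝ × ℝ), doubledIntegrand f u v U U' V V' χ θ η ρ z.1 z.2
      ∂(((volume.restrict (Ioo 0 T)).prod (volume.restrict (Ioo 0 T))).prod
        (volume.prod volume)) := by
  set Q := (volume : Measure (ℝ × ℝ)).restrict (strip T) with hQ
  have hui := hu.integrable_strip
  have hvi := hv.integrable_strip
  have hum : AEStronglyMeasurable (fun z : (ℝ × ℝ) × (ℝ × ℝ) => u z.1.1 z.1.2) (Q.prod Q) :=
    hui.aestronglyMeasurable.comp_fst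
  have hvm : AEStronglyMeasurable (fun z : (ℝ × ℝ) × (ℝ × ℝ) => v z.2.1 z.2.2) (Q.prod Q) :=
    hvi.aestronglyMeasurable.comp_snd
  have hUm : AEStronglyMeasurable (fun z : (ℝ × ℝ) × (ℝ × ℝ) => U z.1.1 z.1.2) (Q.prod Q) :=
    hu.aestronglyMeasurable_coeff.comp_fst
  have hU'm : AEStronglyMeasurable (fun z : (ℝ × ℝ) × (ℝ × ℝ) => U' z.1.1 z.1.2) (Q.prod Q) :=
    hu.aestronglyMeasurable_coeff_deriv.comp_fst
  have hVm : AEStronglyMeasurable (fun z : (ℝ × ℝ) × (ℝ × ℝ) => V z.2.1 z.2.2) (Q.prod Q) :=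
    hv.aestronglyMeasurable_coeff.comp_snd
  have hV'm : AEStronglyMeasurable (fun z : (ℝ × ℝ) × (ℝ × ℝ) => V' z.2.1 z.2.2) (Q.prod Q) :=
    hv.aestronglyMeasurable_coeff_deriv.comp_snd
  have hsgm : AEStronglyMeasurable (fun z : (ℝ × ℝ) × (ℝ × ℝ) =>
      Real.sign (u z.1.1 z.1.2 - v z.2.1 z.2.2)) (Q.prod Q) :=
    (measurable_real_sign.comp_aemeasurable (hum.sub hvm).aemeasurable).aestronglyMeasurable
  have hkm : AEStronglyMeasurable (fun z : (ℝ × ℝ) × (ℝ × ℝ) =>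
      kruzhkovFlux f (u z.1.1 z.1.2) (v z.2.1 z.2.2)) (Q.prod Q) :=
    ((measurable_kruzhkovFlux hf.continuous).comp_aemeasurable
        (hum.aemeasurable.prodMk hvm.aemeasurable)).aestronglyMeasurable
  obtain ⟨Bu, hBu⟩ := hu.coeff_bounded
  obtain ⟨Bv, hBv⟩ := hv.coeff_bounded
  have hstrip : ∀ p ∈ strip T, p.1 ∈ Icc 0 T := fun p hp => Ioo_subset_Icc_self hp.1
  have hfle : ∀ a, |f a| ≤ L * |a| := fun a => by
    simpa [hf0] using abs_sub_le_of_lipschitz hf a 0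
  have hχc := hχ.smooth.continuous
  have hχ'c : Continuous (deriv χ) := hχ.smooth.continuous_deriv (by simp)
  have hθc := hθ.smooth.continuous
  have hθ'c : Continuous (deriv θ) := hθ.smooth.continuous_deriv (by simp)
  have hηc := hη.smooth.continuous
  have hη'c : Continuous (deriv η) := hη.smooth.continuous_deriv (by simp)
  have hρc := hρ.smooth.continuous
  have hρ'c : Continuous (deriv ρ) := hρ.smooth.continuous_deriv (by simp)
  have hχs := hχ.hasCompactSupport
  have hθs := hθ.hasCompactSupport
  have hηs := hη.hasCompactSupport
  have hρs := hρ.hasCompactSupport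
  -- integrands for the two entropy inequalities
  set Φ : (ℝ × ℝ) × (ℝ × ℝ) → ℝ := fun z =>
    |u z.1.1 z.1.2 - v z.2.1 z.2.2| *
        ((deriv χ z.1.1 * θ (z.1.1 - z.2.1) + χ z.1.1 * deriv θ (z.1.1 - z.2.1)) *
          (η z.1.2 * ρ (z.1.2 - z.2.2)))
      + kruzhkovFlux f (u z.1.1 z.1.2) (v z.2.1 z.2.2) * U z.1.1 z.1.2 *
        ((χ z.1.1 * θ (z.1.1 - z.2.1)) *
          (deriv η z.1.2 * ρ (z.1.2 - z.2.2) + η z.1.2 * deriv ρ (z.1.2 - z.2.2)))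
      - Real.sign (u z.1.1 z.1.2 - v z.2.1 z.2.2) * f (v z.2.1 z.2.2) * U' z.1.1 z.1.2 *
        ((χ z.1.1 * θ (z.1.1 - z.2.1)) * (η z.1.2 * ρ (z.1.2 - z.2.2))) with hΦ
  set Ψ : (ℝ × ℝ) × (ℝ × ℝ) → ℝ := fun z =>
    |u z.1.1 z.1.2 - v z.2.1 z.2.2| *
        ((χ z.1.1 * deriv θ (z.1.1 - z.2.1)) * (η z.1.2 * ρ (z.1.2 - z.2.2)))
      + kruzhkovFlux f (u z.1.1 z.1.2) (v z.2.1 z.2.2) * V z.2.1 z.2.2 *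
        ((χ z.1.1 * θ (z.1.1 - z.2.1)) * (η z.1.2 * deriv ρ (z.1.2 - z.2.2)))
      - Real.sign (u z.1.1 z.1.2 - v z.2.1 z.2.2) * f (u z.1.1 z.1.2) * V' z.2.1 z.2.2 *
        ((χ z.1.1 * θ (z.1.1 - z.2.1)) * (η z.1.2 * ρ (z.1.2 - z.2.2))) with hΨ
  have sub_le : ∀ p q : ℝ × ℝ, |(|u p.1 p.2 - v q.1 q.2|)| ≤ 1 * (|u p.1 p.2| + |v q.1 q.2|) :=
    fun p q => by rw [abs_abs, one_mul]; exact abs_sub _ _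
  have flux_le : ∀ p q : ℝ × ℝ, ∀ W B : ℝ, |W| ≤ B →
      |kruzhkovFlux f (u p.1 p.2) (v q.1 q.2) * W| ≤ (L * B) * (|u p.1 p.2| + |v q.1 q.2|) := by
    intro p q W B hW
    rw [abs_mul]
    calc _ ≤ (L * (|u p.1 p.2| + |v q.1 q.2|)) * B := by
          gcongr
          exact abs_kruzhkovFlux_le_add hf _ _
      _ = _ := by ring
  have source_le : ∀ p q : ℝ × ℝ, ∀ σ g W B : ℝ, |σ| ≤ 1 →
      |g| ≤ L * (|u p.1 p.2| + |v q.1 q.2|) → |W| ≤ B →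
      |σ * g * W| ≤ (L * B) * (|u p.1 p.2| + |v q.1 q.2|) := by
    intro p q σ g W B hσ hg hW
    rw [abs_mul, abs_mul]
    calc _ ≤ (1 * (L * (|u p.1 p.2| + |v q.1 q.2|))) * B := by gcongr
      _ = _ := by ring
  have fu_le : ∀ p q : ℝ × ℝ, |f (u p.1 p.2)| ≤ L * (|u p.1 p.2| + |v q.1 q.2|) := fun p q =>
    (hfle _).trans (by gcongr; linarith [abs_nonneg (v q.1 q.2)])
  have fv_le : ∀ p q : ℝ × ℝ, |f (v q.1 q.2)| ≤ L * (|u p.1 p.2| + |v q.1 q.2|) := fun p q =>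
    (hfle _).trans (by gcongr; linarith [abs_nonneg (u p.1 p.2)])
  have hfum : AEStronglyMeasurable (fun z : (ℝ × ℝ) × (ℝ × ℝ) => f (u z.1.1 z.1.2)) (Q.prod Q) :=
    hf.continuous.comp_aestronglyMeasurable hum
  have hfvm : AEStronglyMeasurable (fun z : (ℝ × ℝ) × (ℝ × ℝ) => f (v z.2.1 z.2.2)) (Q.prod Q) :=
    hf.continuous.comp_aestronglyMeasurable hvm
  have cm := hasCompactSupport_mul_sub hχs hθs
  have cm1 := hasCompactSupport_mul_sub hχs.deriv hθs
  have cm2 := hasCompactSupport_mul_sub hχs hθs.deriv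
  have ck := hasCompactSupport_mul_sub hηs hρs
  have ck1 := hasCompactSupport_mul_sub hηs.deriv hρs
  have ck2 := hasCompactSupport_mul_sub hηs hρs.deriv
  have hΦi : Integrable Φ (Q.prod Q) := by
    refine Integrable.sub (Integrable.add ?_ ?_) ?_
    · exact integrable_doubled hui hvi (C := 1) (hum.sub hvm).norm (fun p _ q _ => sub_le p q)
        (m := fun w => deriv χ w.1 * θ (w.1 - w.2) + χ w.1 * deriv θ (w.1 - w.2))
        (k := fun w => η w.1 * ρ (w.1 - w.2)) (by fun_prop) (cm1.add cm2) (by fun_prop) ck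
    · exact integrable_doubled hui hvi (hkm.mul hUm)
        (fun p hp q _ => flux_le p q _ _ (hBu p.1 (hstrip p hp) p.2).1)
        (m := fun w => χ w.1 * θ (w.1 - w.2))
        (k := fun w => deriv η w.1 * ρ (w.1 - w.2) + η w.1 * deriv ρ (w.1 - w.2))
        (by fun_prop) cm (by fun_prop) (ck1.add ck2)
    · exact integrable_doubled hui hvi ((hsgm.mul hfvm).mul hU'm)
        (fun p hp q _ => source_le p q _ _ _ _ (abs_real_sign_le _) (fv_le p q)
          (hBu p.1 (hstrip p hp) p.2).2)
        (m := fun w => χ w.1 * θ (w.1 - w.2)) (k := fun w => η w.1 * ρ (w.1 - w.2))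
        (by fun_prop) cm (by fun_prop) ck
  have hΨi : Integrable Ψ (Q.prod Q) := by
    refine Integrable.sub (Integrable.add ?_ ?_) ?_
    · exact integrable_doubled hui hvi (C := 1) (hum.sub hvm).norm (fun p _ q _ => sub_le p q)
        (m := fun w => χ w.1 * deriv θ (w.1 - w.2))
        (k := fun w => η w.1 * ρ (w.1 - w.2)) (by fun_prop) cm2 (by fun_prop) ck
    · exact integrable_doubled hui hvi (hkm.mul hVm)
        (fun p _ q hq => flux_le p q _ _ (hBv q.1 (hstrip q hq) q.2).1)
        (m := fun w => χ w.1 * θ (w.1 - w.2)) (k := fun w => η w.1 * deriv ρ (w.1 - w.2))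
        (by fun_prop) cm (by fun_prop) ck2
    · exact integrable_doubled hui hvi ((hsgm.mul hfum).mul hV'm)
        (fun p _ q hq => source_le p q _ _ _ _ (abs_real_sign_le _) (fu_le p q)
          (hBv q.1 (hstrip q hq) q.2).2)
        (m := fun w => χ w.1 * θ (w.1 - w.2)) (k := fun w => η w.1 * ρ (w.1 - w.2))
        (by fun_prop) cm (by fun_prop) ck
  -- For each fixed `q`, this is the entropy inequality for `u` with the constant `k = v(q)`, then
  -- integrated in `q`.
  have hΦ0 : 0 ≤ ∫ z, Φ z ∂(Q.prod Q) := by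
    rw [integral_prod_symm _ hΦi]
    refine integral_nonneg fun q => ?_
    refine (hu.entropy (v q.1 q.2) _ _ (hχ.mul_shift hθ q.1) (hη.mul_shift hρ q.2)).trans_eq ?_
    refine integral_congr_ae (Eventually.of_forall fun p => ?_)
    simp only [hΦ, (hasDerivAt_mul_shift hχ.smooth hθ.smooth _ _).deriv,
      (hasDerivAt_mul_shift hη.smooth hρ.smooth _ _).deriv]
  -- The roles are exchanged, with `k = u(p)`. Derivatives in the second variables fall on `θ(t -
  -- s)` and `ρ(x - y)` with a minus sign, and the sign function is odd, so the inequality for `v`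
  -- reads `0 ≤ -∫ Ψ`.
  have hΨ0 : 0 ≤ -∫ z, Ψ z ∂(Q.prod Q) := by
    rw [integral_prod _ hΨi, ← integral_neg]
    refine integral_nonneg fun p => ?_
    simp only [Pi.zero_apply]
    rw [← integral_neg]
    refine (hv.entropy (u p.1 p.2) _ _ (hχ.const_mul_shift hθ hε p.1)
      (hη.const_mul_shift hρ p.2)).trans_eq ?_
    refine integral_congr_ae (Eventually.of_forall fun q => ?_)
    simp only [hΨ, (hasDerivAt_const_mul_shift hθ.smooth _ _ _).deriv,
      (hasDerivAt_const_mul_shift hρ.smooth _ _ _).deriv, kruzhkovFlux,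
      real_sign_sub_comm (u p.1 p.2), abs_sub_comm (v q.1 q.2)]
    ring
  -- The inequality is obtained on pairs of space-time points, but it is estimated at fixed times
  -- `(t, s)` by integrating over `(x, y)`; this map regroups the variables.
  have hmp := measurePreserving_prod_prod_prod_comm ((volume : Measure ℝ).restrict (Ioo 0 T))
    (volume : Measure ℝ) ((volume : Measure ℝ).restrict (Ioo 0 T)) (volume : Measure ℝ)
  rw [← volume_restrict_strip] at hmp
  have hemb : MeasurableEmbedding
      (fun z : (ℝ × ℝ) × (ℝ × ℝ) => ((z.1.1, z.2.1), (z.1.2, z.2.2))) :=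
    (prodProdProdComm ℝ ℝ ℝ ℝ).measurableEmbedding
  -- The terms with `θ'` cancel in `Φ - Ψ`, while those with `ρ'` combine into the factor `U - V`.
  have hcomp : (fun z : (ℝ × ℝ) × (ℝ × ℝ) =>
      doubledIntegrand f u v U U' V V' χ θ η ρ (z.1.1, z.2.1) (z.1.2, z.2.2)) = Φ - Ψ := by
    funext z
    simp only [doubledIntegrand, doubledFlux, hΦ, hΨ, Pi.sub_apply]
    ring
  constructor
  · rw [← hmp.integrable_comp_emb hemb]
    have h := hΦi.sub hΨi
    rw [← hcomp] at h
    exact h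
  · rw [← hmp.integral_comp hemb]
    simp only [hcomp]
    rw [integral_sub' hΦi hΨi]
    linarith

/-! ### The `L¹` comparison principle -/

theorem nonneg_of_forall_pos_add_mul {P Q : ℝ} (h : ∀ e > 0, 0 ≤ P + e * Q) : 0 ≤ P := by
  have ht : Tendsto (fun e : ℝ => P + e * Q) (𝓝[>] 0) (𝓝 (P + 0 * Q)) :=
    ((tendsto_id.mul_const Q).const_add P).mono_left nhdsWithin_le_nhds
  have := ge_of_tendsto ht (eventually_mem_nhdsWithin.mono fun e he => h e he)
  simpa using this

/-- At fixed times, everything that vanishes with the mollifier width is collected with the factor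
`e`, and everything due to the spatial cut-off with the factor `e₁`. What survives is the time
derivative of the localised distance and the contribution of `U - V`. -/
theorem integral_doubledIntegrand_le {f : ℝ → ℝ} {L : ℝ≥0} (hf : LipschitzWith L f)
    (hf0 : f 0 = 0) {T c d Cθ ε Cρ a b m M B e e₁ : ℝ} {U U' u V V' v : ℝ → ℝ → ℝ}
    (hu : IsBVEntropyFlow f T U U' u c) (hv : IsBVEntropyFlow f T V V' v d)
    {χ θ η ρ : ℝ → ℝ} (hχ : IsTimeTest T χ) (hθ : IsMollifier Cθ ε θ)
    (hη : IsSpaceTest η) (hη1 : ∀ x, η x ≤ 1) (hηe : ∀ x, |deriv η x| ≤ e₁)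
    (hρ : IsMollifier Cρ ε ρ) (hε : 0 ≤ ε) (hd : 0 ≤ d) (hεe : ε ≤ e) (hdε : d * ε ≤ e / 2)
    (hvε : ∀ s ∈ Icc 0 T, ∀ t ∈ Icc 0 T, |s - t| ≤ ε → ∫ x, |v s x - v t x| ≤ e / 2)
    (hVε : ∀ s ∈ Icc 0 T, ∀ t ∈ Icc 0 T, ∀ x y, |s - t| ≤ ε → |x - y| ≤ ε →
      |V s x - V t y| ≤ e ∧ |V' s x - V' t y| ≤ e)
    (hUB : ∀ t ∈ Icc 0 T, ∀ x, |U t x| ≤ B)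
    (hVB : ∀ t ∈ Icc 0 T, ∀ x, |V t x| ≤ B ∧ |V' t x| ≤ B)
    (hm : ∀ t ∈ Icc 0 T, ∫ x, |v t x| ≤ m) (hM : ∀ t ∈ Icc 0 T, ∫ x, |u t x| ≤ M)
    {g : ℝ → ℝ} (hUV : ∀ t ∈ Icc 0 T, ∀ x, |U t x - V t x| ≤ a * g t)
    (hUV' : ∀ t ∈ Icc 0 T, ∀ x, |U' t x - V' t x| ≤ b * g t)
    {w : ℝ × ℝ} (hw1 : w.1 ∈ Icc 0 T) (hw2 : w.2 ∈ Icc 0 T)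
    (hint : Integrable fun z => doubledIntegrand f u v U U' V V' χ θ η ρ w z) :
    ∫ z, doubledIntegrand f u v U U' V V' χ θ η ρ w z ≤
      θ (w.1 - w.2) * (deriv χ w.1 * (∫ x, |u w.1 x - v w.1 x| * η x) + e * |deriv χ w.1|
        + χ w.1 * (L * (Cρ * d * a + m * b) * g w.1
          + (L * B * e₁ * (M + m) + e * (L * (d * (Cρ + B) + m))))) := by
  obtain ⟨t, s⟩ := w
  simp only at hw1 hw2 ⊢
  by_cases hts : ε ≤ |t - s|
  · simp [doubledIntegrand, hθ.eq_zero _ hts]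
  have hts' : |s - t| ≤ ε := by rw [abs_sub_comm]; exact (not_le.1 hts).le
  have hL : (0 : ℝ) ≤ L := L.2
  have hB : 0 ≤ B := (abs_nonneg _).trans (hUB t hw1 0)
  have he1 : 0 ≤ e₁ := (abs_nonneg _).trans (hηe 0)
  have he : 0 ≤ e := hε.trans hεe
  have hm0 : 0 ≤ m := (integral_nonneg fun x => abs_nonneg _).trans (hm t hw1)
  have hga : 0 ≤ a * g t := (abs_nonneg _).trans (hUV t hw1 0)
  have hgb : 0 ≤ b * g t := (abs_nonneg _).trans (hUV' t hw1 0)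
  have hA := integrable_doubled_abs_sub (hu.integrable t hw1) (hv.integrable s hw2) hη.smooth
    hη.nonneg hη1 hρ
  have j1 := abs_integral_doubled_abs_sub_le (hu.integrable t hw1) (hv.integrable t hw1)
    (hv.integrable s hw2) (hv.translation_le s hw2) hd hη.smooth hη.nonneg hη1 hρ
  have j1' : |(∫ z : ℝ × ℝ, |u t z.1 - v s z.2| * (η z.1 * ρ (z.1 - z.2)))
      - ∫ x, |u t x - v t x| * η x| ≤ e := by
    linarith [hvε s hw2 t hw1 hts']
  have j2 := integral_doubledFlux_le hf hf0 (U' := U' t) (a := a * g t + e) (b := b * g t + e)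
    (hu.integrable t hw1) (hv.integrable s hw2)
    (hv.translation_le s hw2) (hu.continuous_coeff hw1) (hv.hasDerivAt s hw2)
    (hv.continuous_coeff_deriv hw2) (hUB t hw1) (fun x => (hVB s hw2 x).1)
    (fun x => (hVB s hw2 x).2) hη.smooth hη.nonneg hη1 hηe hρ hε hd
    (fun x y hxy => by
      have h1 := (hVε s hw2 t hw1 y x hts' (by rwa [abs_sub_comm])).1
      have h2 := hUV t hw1 x
      rw [abs_sub_comm] at h1
      linarith [abs_sub_le (U t x) (V t x) (V s y)])
    (fun x y hxy => by
      have h1 := (hVε s hw2 t hw1 y x hts' (by rwa [abs_sub_comm])).2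
      have h2 := hUV' t hw1 x
      rw [abs_sub_comm] at h1
      linarith [abs_sub_le (U' t x) (V' t x) (V' s y)])
  have j2' : ∫ z : ℝ × ℝ, doubledFlux f (u t) (v s) (U t) (U' t) (V s) (V' s) η ρ z.1 z.2 ≤
      L * (Cρ * d * a + m * b) * g t
          + (L * B * e₁ * (M + m) + e * (L * (d * (Cρ + B) + m))) := by
    refine j2.trans ?_
    have h1 := hm s hw2
    have h2 := hM t hw1
    calc _ ≤ L * (B * e₁ * (M + m) + d * ((a * g t + e) * Cρ + B * e) + (b * g t + e) * m) := by
          gcongr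
      _ = _ := by ring
  have hθ0 := hθ.nonneg (t - s)
  have hχ0 := hχ.nonneg t
  have i1 : deriv χ t * (∫ z : ℝ × ℝ, |u t z.1 - v s z.2| * (η z.1 * ρ (z.1 - z.2))) ≤
      deriv χ t * (∫ x, |u t x - v t x| * η x) + e * |deriv χ t| := by
    rw [← sub_le_iff_le_add', ← mul_sub]
    refine (le_abs_self _).trans ?_
    rw [abs_mul, mul_comm]
    exact mul_le_mul_of_nonneg_right j1' (abs_nonneg _)
  -- Only integrability of the full integrand is given. When the weight is nonzero, that of the flux
  -- part follows by subtraction and division; when it is zero, the flux part is absent.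
  by_cases h0 : θ (t - s) * χ t = 0
  · have : ∀ z : ℝ × ℝ, doubledIntegrand f u v U U' V V' χ θ η ρ (t, s) z =
        θ (t - s) * deriv χ t * (|u t z.1 - v s z.2| * (η z.1 * ρ (z.1 - z.2))) := by
      intro z
      simp only [doubledIntegrand, mul_add]
      rw [← mul_assoc (θ (t - s)) (χ t), h0]
      ring
    simp_rw [this]
    rw [integral_const_mul, mul_assoc, mul_add, ← mul_assoc (θ (t - s)) (χ t), h0, zero_mul,
      add_zero]
    exact mul_le_mul_of_nonneg_left i1 hθ0
  · have hF : Integrable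
        (fun z : ℝ × ℝ => doubledFlux f (u t) (v s) (U t) (U' t) (V s) (V' s) η ρ z.1 z.2) := by
      refine ((hint.sub (hA.const_mul (θ (t - s) * deriv χ t))).const_mul
        (θ (t - s) * χ t)⁻¹).congr (Eventually.of_forall fun z => ?_)
      simp only [doubledIntegrand, Pi.sub_apply]
      rw [inv_mul_eq_iff_eq_mul₀ h0]
      ring
    simp only [doubledIntegrand]
    rw [integral_const_mul, integral_add (hA.const_mul _) (hF.const_mul _), integral_const_mul,
      integral_const_mul]
    refine mul_le_mul_of_nonneg_left (add_le_add i1 ?_) hθ0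
    exact mul_le_mul_of_nonneg_left j2' hχ0

/-- Integrating out the second time yields the full mass `1` of `θ`, because the window around each
point where `h` is nonzero stays inside `(0, T)`. -/
theorem integral_mul_mollifier {T C ε : ℝ} {θ h : ℝ → ℝ} (hθ : IsMollifier C ε θ)
    (hh : IntegrableOn h (Ioo 0 T)) (hsupp : ∀ t, h t ≠ 0 → Icc (t - ε) (t + ε) ⊆ Ioo 0 T) :
    Integrable (fun w : ℝ × ℝ => θ (w.1 - w.2) * h w.1)
      ((volume.restrict (Ioo 0 T)).prod (volume.restrict (Ioo 0 T))) ∧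
    ∫ w : ℝ × ℝ, θ (w.1 - w.2) * h w.1
      ∂((volume.restrict (Ioo 0 T)).prod (volume.restrict (Ioo 0 T))) = ∫ t in Ioo 0 T, h t := by
  have hθc := hθ.smooth.continuous
  obtain ⟨N, hN⟩ := hθc.bounded_above_of_compact_support hθ.hasCompactSupport
  have hi : Integrable (fun w : ℝ × ℝ => θ (w.1 - w.2) * h w.1)
      ((volume.restrict (Ioo 0 T)).prod (volume.restrict (Ioo 0 T))) := by
    refine Integrable.bdd_mul (c := N) ?_ (Continuous.aestronglyMeasurable (by fun_prop))
      (Eventually.of_forall fun w => hN _)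
    exact hh.comp_fst _
  refine ⟨hi, ?_⟩
  rw [integral_prod _ hi]
  refine integral_congr_ae (Eventually.of_forall fun t => ?_)
  simp only
  rw [integral_mul_const]
  by_cases ht : h t = 0
  · simp [ht]
  · rw [setIntegral_eq_integral_of_forall_compl_eq_zero, integral_sub_left_eq_self θ,
      hθ.integral_eq_one, one_mul]
    intro s hs
    refine hθ.eq_zero _ ?_
    by_contra hc
    have := abs_lt.1 (not_le.1 hc)
    exact hs (hsupp t ht ⟨by linarith, by linarith⟩)

theorem IsTimeTest.integral_deriv {T : ℝ} {χ : ℝ → ℝ} (hχ : IsTimeTest T χ) :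
    ∫ t in Ioo 0 T, deriv χ t = 0 := by
  rw [setIntegral_eq_integral_of_forall_compl_eq_zero]
  · exact integral_eq_zero_of_hasDerivAt_of_integrable
      (fun t => (hχ.smooth.differentiable (by simp)).differentiableAt.hasDerivAt)
      ((hχ.smooth.continuous_deriv (by simp)).integrable_of_hasCompactSupport
        hχ.hasCompactSupport.deriv)
      (hχ.smooth.continuous.integrable_of_hasCompactSupport hχ.hasCompactSupport)
  · intro t ht
    exact image_eq_zero_of_notMem_tsupport fun h => ht (hχ.tsupport_subset
      (tsupport_deriv_subset h))

theorem tendsto_integral_mul_cutoff {h : ℝ → ℝ} (hh : Integrable h) {η : ℕ → ℝ → ℝ}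
    (hηc : ∀ n, Continuous (η n)) (hη0 : ∀ n x, 0 ≤ η n x) (hη1 : ∀ n x, η n x ≤ 1)
    (hlim : ∀ x, Tendsto (fun n => η n x) atTop (𝓝 1)) :
    Tendsto (fun n => ∫ x, h x * η n x) atTop (𝓝 (∫ x, h x)) := by
  refine tendsto_integral_of_dominated_convergence (fun x => |h x|)
    (fun n => hh.aestronglyMeasurable.mul (hηc n).aestronglyMeasurable) hh.abs
    (fun n => Eventually.of_forall fun x => ?_) (Eventually.of_forall fun x => ?_)
  · rw [norm_mul, Real.norm_eq_abs, Real.norm_eq_abs, abs_of_nonneg (hη0 n x)]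
    exact mul_le_of_le_one_right (abs_nonneg _) (hη1 n x)
  · simpa using (hlim x).const_mul (h x)

/-- The differential inequality for the `L¹` distance of two entropy solutions, tested in time. -/
theorem comparison_test {f : ℝ → ℝ} {L : ℝ≥0} (hf : LipschitzWith L f)
    (hf0 : f 0 = 0) {T c d C a b m : ℝ} {U U' u V V' v : ℝ → ℝ → ℝ}
    (hC : ∀ δ : ℝ, 0 < δ → ∃ ρ, IsMollifier C δ ρ)
    (hu : IsBVEntropyFlow f T U U' u c) (hv : IsBVEntropyFlow f T V V' v d) (hd : 0 ≤ d)
    (hm : ∀ t ∈ Icc 0 T, ∫ x, |v t x| ≤ m)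
    {g : ℝ → ℝ} (hg : ContinuousOn g (Icc 0 T))
    (hUV : ∀ t ∈ Icc 0 T, ∀ x, |U t x - V t x| ≤ a * g t)
    (hUV' : ∀ t ∈ Icc 0 T, ∀ x, |U' t x - V' t x| ≤ b * g t)
    {χ : ℝ → ℝ} (hχ : IsTimeTest T χ) :
    0 ≤ (∫ t in Ioo 0 T, deriv χ t * ∫ x, |u t x - v t x|)
      + L * (C * d * a + m * b) * ∫ t in Ioo 0 T, χ t * g t := by
  obtain ⟨Bu, hBu⟩ := hu.coeff_bounded
  obtain ⟨Bv, hBv⟩ := hv.coeff_bounded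
  set B := max Bu Bv with hBdef
  have hUB : ∀ t ∈ Icc 0 T, ∀ x, |U t x| ≤ B := fun t ht x =>
    (hBu t ht x).1.trans (le_max_left _ _)
  have hVB : ∀ t ∈ Icc 0 T, ∀ x, |V t x| ≤ B ∧ |V' t x| ≤ B := fun t ht x =>
    ⟨(hBv t ht x).1.trans (le_max_right _ _), (hBv t ht x).2.trans (le_max_right _ _)⟩
  obtain ⟨M, -, hM⟩ := hu.exists_integral_abs_le
  obtain ⟨e₁, -, η, hηs, hηcs, hη0, hη1, hηe, hηlim⟩ := exists_cutoff
  obtain ⟨ε₀, hε₀, hthick⟩ :=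
    hχ.hasCompactSupport.isCompact.exists_cthickening_subset_open isOpen_Ioo hχ.tsupport_subset
  have hχc := hχ.smooth.continuous
  have hχ'c : Continuous (deriv χ) := hχ.smooth.continuous_deriv (by simp)
  have hDη : ∀ n, ContinuousOn (fun t => ∫ x, |u t x - v t x| * η n x) (Icc 0 T) := fun n =>
    continuousOn_integral_abs_sub hu.integrable hv.integrable hu.uniformContinuous
      hv.uniformContinuous (hηs n).continuous (hη0 n) (hη1 n)
  have hD : ContinuousOn (fun t => ∫ x, |u t x - v t x|) (Icc 0 T) := by
    simpa using continuousOn_integral_abs_sub hu.integrable hv.integrable hu.uniformContinuous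
      hv.uniformContinuous (g := fun _ => 1) continuous_const (fun _ => zero_le_one)
      (fun _ => le_rfl)
  have hi1 : ∀ n, IntegrableOn (fun t => deriv χ t * ∫ x, |u t x - v t x| * η n x) (Ioo 0 T) :=
    fun n => integrableOn_of_continuousOn_of_tsupport hχ'c (hDη n)
  have hi2 : IntegrableOn (fun t => |deriv χ t|) (Ioo 0 T) :=
    (hχ'c.abs.integrableOn_Icc).mono_set Ioo_subset_Icc_self
  have hi3 : IntegrableOn (fun t => χ t * g t) (Ioo 0 T) :=
    integrableOn_of_continuousOn_of_tsupport hχc hg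
  have hi4 : IntegrableOn χ (Ioo 0 T) := (hχc.integrableOn_Icc).mono_set Ioo_subset_Icc_self
  set K := L * (C * d * a + m * b) with hK
  -- the estimate with a fixed cut-off in space
  have step : ∀ n : ℕ, 0 ≤ (∫ t in Ioo 0 T, deriv χ t * ∫ x, |u t x - v t x| * η n x)
      + K * (∫ t in Ioo 0 T, χ t * g t)
      + (L * B * (e₁ / (n + 1)) * (M + m)) * ∫ t in Ioo 0 T, χ t := by
    intro n
    -- The number `Q` gathers the coefficients of all errors of size `e`, so letting `e` tend to
    -- zero removes the mollification.
    refine nonneg_of_forall_pos_add_mul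
      (Q := (∫ t in Ioo 0 T, |deriv χ t|) + (L * (d * (C + B) + m)) * ∫ t in Ioo 0 T, χ t)
      fun e he => ?_
    obtain ⟨δ₁, hδ₁, hv₁⟩ := hv.uniformContinuous (e / 2) (by positivity)
    obtain ⟨δ₂, hδ₂, hv₂⟩ := hv.coeff_uniformContinuous e he
    -- The width must respect the time modulus of `v`, the modulus of its coefficient, the distance
    -- from the support of `χ` to the ends of `(0, T)`, and the translation error `d δ`; `d + 1`
    -- avoids dividing by zero.
    obtain ⟨δ, hδ, hl⟩ : ∃ δ > 0, δ ≤ δ₁ ∧ δ ≤ δ₂ ∧ δ ≤ ε₀ ∧ δ ≤ e ∧ d * δ ≤ e / 2 := by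
      refine ⟨min (min δ₁ δ₂) (min ε₀ (min e (e / 2 / (d + 1)))), by positivity, ?_, ?_, ?_, ?_, ?_⟩
      · exact (min_le_left _ _).trans (min_le_left _ _)
      · exact (min_le_left _ _).trans (min_le_right _ _)
      · exact (min_le_right _ _).trans (min_le_left _ _)
      · exact (min_le_right _ _).trans ((min_le_right _ _).trans (min_le_left _ _))
      · have : min (min δ₁ δ₂) (min ε₀ (min e (e / 2 / (d + 1)))) ≤ e / 2 / (d + 1) :=
          (min_le_right _ _).trans ((min_le_right _ _).trans (min_le_right _ _))
        calc _ ≤ (d + 1) * (e / 2 / (d + 1)) := by gcongr; linarith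
          _ = e / 2 := by field_simp
    obtain ⟨hl1, hl2, hl3, hl4, hl5⟩ := hl
    obtain ⟨ρ, hρ⟩ := hC δ hδ
    have hsub : ∀ t ∈ tsupport χ, Icc (t - δ) (t + δ) ⊆ Ioo 0 T := by
      intro t ht s hs
      refine hthick (Metric.closedBall_subset_cthickening ht ε₀ ?_)
      rw [Metric.mem_closedBall, Real.dist_eq]
      exact (abs_le.2 ⟨by linarith [hs.1], by linarith [hs.2]⟩ : |s - t| ≤ δ).trans hl3
    have hηt : IsSpaceTest (η n) := ⟨hηs n, hηcs n, hη0 n⟩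
    -- The same mollifier serves in time and in space.
    obtain ⟨hint, hpos⟩ := doubling hf hf0 hu hv hχ hρ
      (fun t ht => hsub t (subset_tsupport _ ht)) hηt hρ
    rw [integral_prod _ hint] at hpos
    set h : ℝ → ℝ := fun t => deriv χ t * (∫ x, |u t x - v t x| * η n x) + e * |deriv χ t|
        + χ t * (K * g t
          + (L * B * (e₁ / (n + 1)) * (M + m) + e * (L * (d * (C + B) + m)))) with hh
    have hsum : h = fun t => (deriv χ t * (∫ x, |u t x - v t x| * η n x) + e * |deriv χ t|)
        + (K * (χ t * g t)
          + (L * B * (e₁ / (n + 1)) * (M + m) + e * (L * (d * (C + B) + m))) * χ t) := by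
      funext t
      simp only [hh]
      ring
    have k1 : IntegrableOn (fun t => deriv χ t * (∫ x, |u t x - v t x| * η n x)
        + e * |deriv χ t|) (Ioo 0 T) := (hi1 n).add (hi2.const_mul e)
    have k2 : IntegrableOn (fun t => K * (χ t * g t)
        + (L * B * (e₁ / (n + 1)) * (M + m) + e * (L * (d * (C + B) + m))) * χ t) (Ioo 0 T) :=
      (hi3.const_mul K).add (hi4.const_mul
      (L * B * (e₁ / (n + 1)) * (M + m) + e * (L * (d * (C + B) + m))))
    have hhi : IntegrableOn h (Ioo 0 T) := by rw [hsum]; exact k1.add k2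
    obtain ⟨hi, heq⟩ := integral_mul_mollifier hρ hhi (fun t ht => hsub t (by
      by_contra hn
      refine ht ?_
      simp [hh, image_eq_zero_of_notMem_tsupport hn,
        image_eq_zero_of_notMem_tsupport fun h => hn (tsupport_deriv_subset h)]))
    have hle := integral_mono_ae hint.integral_prod_left hi (by
      have ae1 : ∀ᵐ w ∂((volume.restrict (Ioo 0 T)).prod (volume.restrict (Ioo 0 T))),
          w.1 ∈ Ioo 0 T :=
        Measure.quasiMeasurePreserving_fst.ae (ae_restrict_mem measurableSet_Ioo)
      have ae2 : ∀ᵐ w ∂((volume.restrict (Ioo 0 T)).prod (volume.restrict (Ioo 0 T))),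
          w.2 ∈ Ioo 0 T :=
        Measure.quasiMeasurePreserving_snd.ae (ae_restrict_mem measurableSet_Ioo)
      filter_upwards [ae1, ae2, hint.prod_right_ae] with w hw1 hw2 hwi
      exact integral_doubledIntegrand_le hf hf0 hu hv hχ hρ hηt (hη1 n) (hηe n) hρ hδ.le hd hl4 hl5
        (fun s hs t ht hst => hv₁ s hs t ht (hst.trans hl1))
        (fun s hs t ht x y hst hxy => hv₂ s hs t ht x y (hst.trans hl2) (hxy.trans hl2))
        hUB hVB hm hM hUV hUV' (Ioo_subset_Icc_self hw1) (Ioo_subset_Icc_self hw2) hwi)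
    have hfin := hpos.trans (hle.trans_eq heq)
    rw [hsum] at hfin
    rw [integral_add k1 k2, integral_add (hi1 n) (hi2.const_mul e),
      integral_add (hi3.const_mul K) (hi4.const_mul _), integral_const_mul, integral_const_mul,
      integral_const_mul] at hfin
    refine hfin.trans_eq ?_
    ring
  -- removal of the cut-off
  have hDi : ∀ t ∈ Icc 0 T, Integrable fun x => |u t x - v t x| := fun t ht =>
    ((hu.integrable t ht).sub (hv.integrable t ht)).abs
  have hlim1 : Tendsto (fun n => ∫ t in Ioo 0 T, deriv χ t * ∫ x, |u t x - v t x| * η n x) atTop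
      (𝓝 (∫ t in Ioo 0 T, deriv χ t * ∫ x, |u t x - v t x|)) := by
    refine tendsto_integral_of_dominated_convergence
      (fun t => |deriv χ t| * ∫ x, |u t x - v t x|) (fun n => (hi1 n).aestronglyMeasurable)
      (integrableOn_of_continuousOn_of_tsupport hχ'c.abs hD) (fun n => ?_) ?_
    · filter_upwards [ae_restrict_mem measurableSet_Ioo] with t ht
      rw [norm_mul, Real.norm_eq_abs, Real.norm_eq_abs,
        abs_of_nonneg (integral_nonneg fun x => mul_nonneg (abs_nonneg _) (hη0 n x))]
      refine mul_le_mul_of_nonneg_left ?_ (abs_nonneg _)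
      refine integral_mono_of_nonneg (Eventually.of_forall fun x =>
        mul_nonneg (abs_nonneg _) (hη0 n x)) (hDi t (Ioo_subset_Icc_self ht))
        (Eventually.of_forall fun x => ?_)
      exact mul_le_of_le_one_right (abs_nonneg _) (hη1 n x)
    · filter_upwards [ae_restrict_mem measurableSet_Ioo] with t ht
      exact (tendsto_integral_mul_cutoff (hDi t (Ioo_subset_Icc_self ht))
        (fun n => (hηs n).continuous) hη0 hη1 hηlim).const_mul _
  -- The cut-off has slope at most `e₁ / (n + 1)`, so the flux error it causes disappears in the
  -- limit.
  have hlim2 : Tendsto (fun n : ℕ => (L * B * (e₁ / ((n : ℝ) + 1)) * (M + m)) *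
      ∫ t in Ioo 0 T, χ t) atTop (𝓝 ((L * B * 0 * (M + m)) * ∫ t in Ioo 0 T, χ t)) := by
    refine Tendsto.mul_const _ (Tendsto.mul_const _ (Tendsto.const_mul _ ?_))
    exact tendsto_const_nhds.div_atTop
      (tendsto_natCast_atTop_atTop.atTop_add tendsto_const_nhds)
  have := ge_of_tendsto' ((hlim1.add_const (K * ∫ t in Ioo 0 T, χ t * g t)).add hlim2) step
  simpa using this

/-- `L¹` stability of entropy solutions with respect to the coefficient. -/
theorem comparison {f : ℝ → ℝ} {L : ℝ≥0} (hf : LipschitzWith L f)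
    (hf0 : f 0 = 0) {T c d C a b m l : ℝ} (hT : 0 < T) {U U' u V V' v : ℝ → ℝ → ℝ}
    (hC : ∀ δ : ℝ, 0 < δ → ∃ ρ, IsMollifier C δ ρ)
    (hu : IsBVEntropyFlow f T U U' u c) (hv : IsBVEntropyFlow f T V V' v d) (hd : 0 ≤ d)
    (hm : ∀ t ∈ Icc 0 T, ∫ x, |v t x| ≤ m)
    (hUV : ∀ t ∈ Icc 0 T, ∀ x, |U t x - V t x| ≤ a * ((∫ y, |u t y - v t y|) + l))
    (hUV' : ∀ t ∈ Icc 0 T, ∀ x, |U' t x - V' t x| ≤ b * ((∫ y, |u t y - v t y|) + l)) :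
    ∀ t ∈ Icc 0 T, (∫ x, |u t x - v t x|) + l ≤
      ((∫ x, |u 0 x - v 0 x|) + l) * Real.exp (L * (C * d * a + m * b) * t) := by
  have hD : ContinuousOn (fun t => ∫ x, |u t x - v t x|) (Icc 0 T) := by
    simpa using continuousOn_integral_abs_sub hu.integrable hv.integrable hu.uniformContinuous
      hv.uniformContinuous (g := fun _ => 1) continuous_const (fun _ => zero_le_one)
      (fun _ => le_rfl)
  refine le_exp_of_forall_test (G := fun t => (∫ x, |u t x - v t x|) + l) hT
    (hD.add continuousOn_const) fun χ hχ => ?_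
  have hχ'c : Continuous (deriv χ) := hχ.smooth.continuous_deriv (by simp)
  refine (comparison_test hf hf0 hC hu hv hd hm (hD.add continuousOn_const) hUV hUV'
    hχ).trans_eq ?_
  -- The constant `l` has no time derivative. It lets the coefficient difference have a part that
  -- does not vanish with the distance, as the comparison with a stationary profile requires.
  simp only [mul_add (deriv χ _)]
  rw [integral_add (integrableOn_of_continuousOn_of_tsupport hχ'c hD)
    (integrableOn_of_continuousOn_of_tsupport hχ'c continuousOn_const), integral_mul_const,
    hχ.integral_deriv, zero_mul, add_zero]
  rfl

/-! ### Bounded variation and `L¹` translation estimates -/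

theorem integral_abs_translate_le_of_eVariationOn {g : ℝ → ℝ} (hg : Integrable g)
    (hv : eVariationOn g univ ≠ ⊤) {h : ℝ} (hh : 0 ≤ h) :
    ∫ x, |g (x + h) - g x| ≤ (eVariationOn g univ).toReal * h := by
  -- The variation up to `x` is monotone and its increments dominate those of `g`. Integrals of `W
  -- (x + h) - W x` telescope to two windows of length `h`, on which `W` lies between `0` and the
  -- total variation.
  set W : ℝ → ℝ := fun x => (eVariationOn g (Iic x)).toReal with hW
  have hfin : ∀ x, eVariationOn g (Iic x) ≠ ⊤ := fun x =>
    ne_top_of_le_ne_top hv (eVariationOn.mono g (subset_univ _))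
  have hW0 : ∀ x, 0 ≤ W x := fun x => ENNReal.toReal_nonneg
  have hW1 : ∀ x, W x ≤ (eVariationOn g univ).toReal := fun x =>
    ENNReal.toReal_mono hv (eVariationOn.mono g (subset_univ _))
  have hWm : Monotone W := fun x y hxy =>
    ENNReal.toReal_mono (hfin y) (eVariationOn.mono g (Iic_subset_Iic.2 hxy))
  have hinc : ∀ x y, x ≤ y → |g y - g x| ≤ W y - W x := by
    intro x y hxy
    have h1 := (eVariationOn.add_le_union g (s := Iic x) (t := Icc x y)
      (fun a ha b hb => le_trans ha hb.1)).trans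
      (eVariationOn.mono g (union_subset (Iic_subset_Iic.2 hxy) (fun b hb => hb.2)))
    have h2 := eVariationOn.edist_le g (s := Icc x y) (right_mem_Icc.2 hxy) (left_mem_Icc.2 hxy)
    have h3 : eVariationOn g (Iic x) + edist (g y) (g x) ≤ eVariationOn g (Iic y) :=
      le_trans (by gcongr) h1
    have h4 := ENNReal.toReal_mono (hfin y) h3
    rw [ENNReal.toReal_add (hfin x) (edist_ne_top _ _), ← dist_edist, Real.dist_eq] at h4
    simp only [hW]
    linarith
  have hWi : ∀ a b, IntervalIntegrable W volume a b := fun a b => hWm.intervalIntegrable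
  have hgi : Integrable fun x => |g (x + h) - g x| := ((hg.comp_add_right h).sub hg).abs
  have hbound : ∀ a b : ℝ, a ≤ b → ∫ x in a..b, |g (x + h) - g x| ≤
      (eVariationOn g univ).toReal * h := by
    intro a b hab
    have hWh : IntervalIntegrable (fun x => W (x + h)) volume a b :=
      (hWm.comp (fun x y hxy => by linarith : Monotone fun x => x + h)).intervalIntegrable
    calc ∫ x in a..b, |g (x + h) - g x| ≤ ∫ x in a..b, (W (x + h) - W x) :=
          intervalIntegral.integral_mono_on hab hgi.intervalIntegrable (hWh.sub (hWi a b))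
            fun x _ => hinc x (x + h) (by linarith)
      _ = (∫ x in b..(b + h), W x) - ∫ x in a..(a + h), W x := by
          rw [intervalIntegral.integral_sub hWh (hWi a b),
            intervalIntegral.integral_comp_add_right W h]
          have e1 := intervalIntegral.integral_add_adjacent_intervals (hWi a (a + h))
            (hWi (a + h) (b + h))
          have e2 := intervalIntegral.integral_add_adjacent_intervals (hWi a b) (hWi b (b + h))
          linarith
      _ ≤ (∫ _ in b..(b + h), (eVariationOn g univ).toReal) - 0 := by
          refine sub_le_sub ?_ ?_
          · exact intervalIntegral.integral_mono_on (by linarith) (hWi _ _)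
              intervalIntegrable_const fun x _ => hW1 x
          · exact intervalIntegral.integral_nonneg (by linarith) fun x _ => hW0 x
      _ = (eVariationOn g univ).toReal * h := by
          rw [intervalIntegral.integral_const, sub_zero, smul_eq_mul]; ring
  have hlim := intervalIntegral_tendsto_integral hgi tendsto_neg_atTop_atBot tendsto_id
  refine le_of_tendsto hlim ?_
  filter_upwards [eventually_ge_atTop 0] with n hn
  exact hbound _ _ (by simp only [id]; linarith)

/-- A representative is chosen whose variation exceeds the bound by less than `e`, since attainment
of the infimum is not needed. Negative shifts reduce to positive ones by translation invariance of
the integral. -/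
theorem integral_abs_translate_le {u : ℝ → ℝ} (hu : Integrable u) {c : ℝ≥0∞} (hc : c ≠ ⊤)
    (hv : totalVariation u ≤ c) (h : ℝ) : ∫ x, |u (x + h) - u x| ≤ c.toReal * |h| := by
  have key : ∀ h : ℝ, 0 ≤ h → ∫ x, |u (x + h) - u x| ≤ c.toReal * h := by
    intro h hh
    rw [← sub_nonneg]
    refine nonneg_of_forall_pos_add_mul (Q := h) fun e he => ?_
    have hlt : totalVariation u < c + ENNReal.ofReal e :=
      hv.trans_lt (ENNReal.lt_add_right hc (by simpa using he))
    rw [totalVariation] at hlt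
    obtain ⟨g, hg⟩ := iInf_lt_iff.1 hlt
    obtain ⟨hgu, hg⟩ := iInf_lt_iff.1 hg
    have hce : c + ENNReal.ofReal e ≠ ⊤ := ENNReal.add_ne_top.2 ⟨hc, ENNReal.ofReal_ne_top⟩
    have h1 := integral_abs_translate_le_of_eVariationOn (hu.congr hgu.symm)
      (ne_top_of_lt hg) hh
    have h2 : (eVariationOn g univ).toReal ≤ c.toReal + e := by
      have := ENNReal.toReal_mono hce hg.le
      rwa [ENNReal.toReal_add hc ENNReal.ofReal_ne_top, ENNReal.toReal_ofReal he.le] at this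
    have h3 : ∫ x, |u (x + h) - u x| = ∫ x, |g (x + h) - g x| := by
      refine integral_congr_ae ?_
      have hsh : ∀ᵐ x, g (x + h) = u (x + h) :=
        (measurePreserving_add_right volume h).quasiMeasurePreserving.ae hgu
      filter_upwards [hgu, hsh] with x hx1 hx2
      rw [hx1, hx2]
    rw [h3]
    nlinarith
  rcases le_total 0 h with hh | hh
  · rw [abs_of_nonneg hh]; exact key h hh
  · rw [abs_of_nonpos hh]
    refine le_of_eq_of_le ?_ (key (-h) (by linarith))
    rw [← integral_add_right_eq_self (fun x => |u (x + -h) - u x|) h]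
    refine integral_congr_ae (Eventually.of_forall fun x => ?_)
    simp [abs_sub_comm]

/-! ### Estimates for the nonlocal coefficient -/

/-- Quantitative bounds for the nonlinearities and the kernel. -/
structure CoeffBounds (ν β μ : ℝ → ℝ) (N₀ N₁ N₂ Lβ M₀ M₁ : ℝ) : Prop where
  Lβ_nonneg : 0 ≤ Lβ
  ν_diff : ∀ x, HasDerivAt ν (deriv ν x) x
  ν_le : ∀ x, |ν x| ≤ N₀
  ν'_le : ∀ x, |deriv ν x| ≤ N₁
  ν_lip : ∀ x y, |ν x - ν y| ≤ N₁ * |x - y|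
  ν'_lip : ∀ x y, |deriv ν x - deriv ν y| ≤ N₂ * |x - y|
  N₂_nonneg : 0 ≤ N₂
  β_lip : ∀ x y, |β x - β y| ≤ Lβ * |x - y|
  β_cont : Continuous β
  β_zero : β 0 = 0
  μ_diff : ∀ x, HasDerivAt μ (deriv μ x) x
  μ_cont : Continuous μ
  μ'_cont : Continuous (deriv μ)
  μ_le : ∀ x, |μ x| ≤ M₀
  μ'_le : ∀ x, |deriv μ x| ≤ M₁

theorem abs_sub_le_of_deriv_le {g : ℝ → ℝ} {C : ℝ} (hg : Differentiable ℝ g)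
    (hC : ∀ x, |deriv g x| ≤ C) (x y : ℝ) : |g x - g y| ≤ C * |x - y| :=
  Convex.norm_image_sub_le_of_norm_deriv_le (fun z _ => hg z) (fun z _ => hC z) convex_univ
    (mem_univ y) (mem_univ x)

theorem Assumptions.exists_coeffBounds {f ν β μ : ℝ → ℝ} (h : Assumptions f ν β μ) :
    ∃ N₀ N₁ N₂ Lβ M₀ M₁, CoeffBounds ν β μ N₀ N₁ N₂ Lβ M₀ M₁ := by
  obtain ⟨N₀, hN₀⟩ := h.ν_regular.bounded
  obtain ⟨N₁, hN₁⟩ := h.ν_regular.bounded_deriv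
  obtain ⟨N₂, hN₂⟩ := h.ν_regular.bounded_deriv_two
  obtain ⟨Lβ, hLβ⟩ := h.β_regular.bounded_deriv
  obtain ⟨M₀, hM₀⟩ := h.μ_regular.bounded
  obtain ⟨M₁, hM₁⟩ := h.μ_regular.bounded_deriv
  have hν := h.ν_regular.contDiff
  have hβ := h.β_regular.contDiff
  have hμ := h.μ_regular.contDiff
  have hν' : ContDiff ℝ 1 (deriv ν) := by
    have : ContDiff ℝ (1 + 1) ν := by rwa [one_add_one_eq_two]
    exact (contDiff_succ_iff_deriv.1 this).2.2
  have hνd := hν.differentiable (by simp)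
  have hμd := hμ.differentiable (by simp)
  have hβd := hβ.differentiable (by simp)
  refine ⟨N₀, N₁, N₂, Lβ, M₀, M₁, (abs_nonneg _).trans (hLβ 0), fun x => (hνd x).hasDerivAt, hN₀,
    hN₁, abs_sub_le_of_deriv_le hνd hN₁,
    abs_sub_le_of_deriv_le (hν'.differentiable (by simp)) fun x => ?_,
    (abs_nonneg _).trans (hN₂ 0), abs_sub_le_of_deriv_le hβd hLβ, hβ.continuous, h.β_zero,
    fun x => (hμd x).hasDerivAt, hμ.continuous, hμ.continuous_deriv (by simp), hM₀, hM₁⟩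
  have := hN₂ x
  rwa [iteratedDeriv_succ, iteratedDeriv_one] at this

/-- The convolution `κ * β(w)`. -/
noncomputable def convNonlin (β κ w : ℝ → ℝ) (x : ℝ) : ℝ := ∫ ξ, κ (x - ξ) * β (w ξ)

/-- The spatial derivative of the nonlocal coefficient. -/
noncomputable def nonlocalCoeffDeriv (ν β μ : ℝ → ℝ) (u : ℝ → ℝ → ℝ) (t x : ℝ) : ℝ :=
  deriv ν (convNonlin β μ (u t) x) * convNonlin β (deriv μ) (u t) x

section

variable {ν β μ κ w w' : ℝ → ℝ} {N₀ N₁ N₂ Lβ M₀ M₁ C c : ℝ}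

theorem integrable_comp_of_lipschitz (hβ : Continuous β) (hβ0 : β 0 = 0)
    (hL : ∀ x y, |β x - β y| ≤ Lβ * |x - y|) (hw : Integrable w) :
    Integrable fun ξ => β (w ξ) :=
  (hw.abs.const_mul Lβ).mono' (hβ.comp_aestronglyMeasurable hw.aestronglyMeasurable)
    (Eventually.of_forall fun ξ => by simpa [hβ0] using hL (w ξ) 0)

theorem integrable_kernel_mul (hκ : Continuous κ) (hC : ∀ x, |κ x| ≤ C) (hβw : Integrable w)
    (x : ℝ) : Integrable fun ξ => κ (x - ξ) * w ξ :=
  hβw.bdd_mul (c := C) (Continuous.aestronglyMeasurable (by fun_prop))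
    (Eventually.of_forall fun _ => hC _)

/-- A bounded kernel turns an `L¹` difference into a uniform one; this is what makes the comparison
of nonlocal coefficients close up. -/
theorem abs_convNonlin_sub_le (hβ : Continuous β) (hβ0 : β 0 = 0)
    (hL : ∀ x y, |β x - β y| ≤ Lβ * |x - y|) (hκ : Continuous κ) (hC : ∀ x, |κ x| ≤ C)
    (hw : Integrable w) (hw' : Integrable w') (x : ℝ) :
    |convNonlin β κ w x - convNonlin β κ w' x| ≤ C * Lβ * ∫ ξ, |w ξ - w' ξ| := by
  have hC0 : 0 ≤ C := (abs_nonneg _).trans (hC 0)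
  have i1 := integrable_kernel_mul hκ hC (integrable_comp_of_lipschitz hβ hβ0 hL hw) x
  have i2 := integrable_kernel_mul hκ hC (integrable_comp_of_lipschitz hβ hβ0 hL hw') x
  rw [convNonlin, convNonlin, ← integral_sub i1 i2, ← integral_const_mul]
  refine abs_integral_le_integral_abs.trans
    (integral_mono (i1.sub i2).abs ((hw.sub hw').abs.const_mul _) fun ξ => ?_)
  simp only
  rw [← mul_sub, abs_mul, mul_assoc]
  exact mul_le_mul (hC _) (hL _ _) (abs_nonneg _) hC0

/-- A shift of `x` is moved onto `w` by a change of variables, where the translation estimate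
applies. -/
theorem abs_convNonlin_translate_le (hβ : Continuous β) (hβ0 : β 0 = 0) (hL0 : 0 ≤ Lβ)
    (hL : ∀ x y, |β x - β y| ≤ Lβ * |x - y|) (hκ : Continuous κ) (hC : ∀ x, |κ x| ≤ C)
    (hw : Integrable w) (htr : ∀ h, ∫ x, |w (x + h) - w x| ≤ c * |h|) (x y : ℝ) :
    |convNonlin β κ w x - convNonlin β κ w y| ≤ C * Lβ * c * |x - y| := by
  have hC0 : 0 ≤ C := (abs_nonneg _).trans (hC 0)
  have h1 : convNonlin β κ w x = convNonlin β κ (fun ξ => w (ξ + (x - y))) y := by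
    rw [convNonlin, convNonlin, ← integral_add_right_eq_self _ (x - y)]
    refine integral_congr_ae (Eventually.of_forall fun ξ => ?_)
    simp only
    rw [show x - (ξ + (x - y)) = y - ξ by ring]
  rw [h1]
  refine (abs_convNonlin_sub_le hβ hβ0 hL hκ hC (hw.comp_add_right _) hw y).trans ?_
  rw [mul_assoc (C * Lβ)]
  exact mul_le_mul_of_nonneg_left (htr _) (by positivity)

namespace CoeffBounds

theorem hasDerivAt_conv (h : CoeffBounds ν β μ N₀ N₁ N₂ Lβ M₀ M₁) (hw : Integrable w) (x : ℝ) :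
    HasDerivAt (convNonlin β μ w) (convNonlin β (deriv μ) w x) x := by
  have hβw := integrable_comp_of_lipschitz h.β_cont h.β_zero h.β_lip hw
  refine (hasDerivAt_integral_of_dominated_loc_of_deriv_le (s := univ) univ_mem
    (F := fun x ξ => μ (x - ξ) * β (w ξ)) (F' := fun x ξ => deriv μ (x - ξ) * β (w ξ))
    (bound := fun ξ => M₁ * |β (w ξ)|)
    (Eventually.of_forall fun y =>
      (integrable_kernel_mul h.μ_cont h.μ_le hβw y).aestronglyMeasurable)
    (integrable_kernel_mul h.μ_cont h.μ_le hβw x)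
    (integrable_kernel_mul h.μ'_cont h.μ'_le hβw x).aestronglyMeasurable
    (Eventually.of_forall fun ξ y _ => ?_) (hβw.abs.const_mul M₁)
    (Eventually.of_forall fun ξ y _ => ?_)).2
  · rw [norm_mul]
    exact mul_le_mul_of_nonneg_right (h.μ'_le _) (norm_nonneg _)
  · exact ((h.μ_diff (y - ξ)).comp_sub_const y ξ).mul_const _

/-- The bound is the Lipschitz constant from `abs_convNonlin_translate_le`. Estimating with `deriv
μ` directly would bring in `‖w‖₁`; here only the translation constant appears, which keeps the later
bound on `‖u(t)‖₁` from being circular. -/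
theorem abs_conv_deriv_le (h : CoeffBounds ν β μ N₀ N₁ N₂ Lβ M₀ M₁) (hc : 0 ≤ c)
    (hw : Integrable w) (htr : ∀ h, ∫ x, |w (x + h) - w x| ≤ c * |h|) (x : ℝ) :
    |convNonlin β (deriv μ) w x| ≤ M₀ * Lβ * c := by
  have hM : 0 ≤ M₀ := (abs_nonneg _).trans (h.μ_le 0)
  have hL := h.Lβ_nonneg
  exact (h.hasDerivAt_conv hw x).le_of_lip' (by positivity) (Eventually.of_forall fun y =>
    abs_convNonlin_translate_le h.β_cont h.β_zero h.Lβ_nonneg h.β_lip h.μ_cont h.μ_le hw htr y x)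

variable {u v : ℝ → ℝ → ℝ} {s t : ℝ}

theorem hasDerivAt_nonlocalCoeff (h : CoeffBounds ν β μ N₀ N₁ N₂ Lβ M₀ M₁)
    (hw : Integrable (u t)) (x : ℝ) :
    HasDerivAt (nonlocalCoeff ν β μ u t) (nonlocalCoeffDeriv ν β μ u t x) x :=
  (h.ν_diff _).comp x (h.hasDerivAt_conv hw x)

theorem abs_nonlocalCoeffDeriv_le (h : CoeffBounds ν β μ N₀ N₁ N₂ Lβ M₀ M₁) (hc : 0 ≤ c)
    (hw : Integrable (u t)) (htr : ∀ h, ∫ x, |u t (x + h) - u t x| ≤ c * |h|) (x : ℝ) :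
    |nonlocalCoeffDeriv ν β μ u t x| ≤ N₁ * (M₀ * Lβ * c) := by
  rw [nonlocalCoeffDeriv, abs_mul]
  exact mul_le_mul (h.ν'_le _) (h.abs_conv_deriv_le hc hw htr x) (abs_nonneg _)
    ((abs_nonneg _).trans (h.ν'_le 0))

theorem abs_nonlocalCoeff_sub_le (h : CoeffBounds ν β μ N₀ N₁ N₂ Lβ M₀ M₁)
    (hu : Integrable (u s)) (hv : Integrable (v t)) (x : ℝ) :
    |nonlocalCoeff ν β μ u s x - nonlocalCoeff ν β μ v t x| ≤
      N₁ * (M₀ * Lβ) * ∫ ξ, |u s ξ - v t ξ| := by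
  refine (h.ν_lip _ _).trans ?_
  rw [mul_assoc]
  exact mul_le_mul_of_nonneg_left (abs_convNonlin_sub_le h.β_cont h.β_zero h.β_lip
    h.μ_cont h.μ_le hu hv x) ((abs_nonneg _).trans (h.ν'_le 0))

/-- A product difference `ν'(A) A' - ν'(B) B'`. -/
theorem abs_deriv_mul_sub_le (h : CoeffBounds ν β μ N₀ N₁ N₂ Lβ M₀ M₁) {A A' B B' D P P' : ℝ}
    (hA' : |A'| ≤ D) (hAB : |A - B| ≤ P) (hAB' : |A' - B'| ≤ P') :
    |deriv ν A * A' - deriv ν B * B'| ≤ N₂ * P * D + N₁ * P' := by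
  have hN := h.N₂_nonneg
  have hN1 := (abs_nonneg _).trans (h.ν'_le 0)
  have hP := (abs_nonneg _).trans hAB
  rw [show deriv ν A * A' - deriv ν B * B'
    = (deriv ν A - deriv ν B) * A' + deriv ν B * (A' - B') by ring]
  refine (abs_add_le _ _).trans ?_
  rw [abs_mul, abs_mul]
  have h1 : |deriv ν A - deriv ν B| ≤ N₂ * P :=
    (h.ν'_lip A B).trans (mul_le_mul_of_nonneg_left hAB hN)
  gcongr
  exact h.ν'_le _

theorem abs_nonlocalCoeffDeriv_sub_le (h : CoeffBounds ν β μ N₀ N₁ N₂ Lβ M₀ M₁) (hc : 0 ≤ c)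
    (hu : Integrable (u s)) (hv : Integrable (v t))
    (htr : ∀ h, ∫ x, |u s (x + h) - u s x| ≤ c * |h|) (x : ℝ) :
    |nonlocalCoeffDeriv ν β μ u s x - nonlocalCoeffDeriv ν β μ v t x| ≤
      (N₂ * (M₀ * Lβ) * (M₀ * Lβ * c) + N₁ * (M₁ * Lβ)) * ∫ ξ, |u s ξ - v t ξ| := by
  refine (h.abs_deriv_mul_sub_le (h.abs_conv_deriv_le hc hu htr x)
    (abs_convNonlin_sub_le h.β_cont h.β_zero h.β_lip h.μ_cont h.μ_le hu hv x)
    (abs_convNonlin_sub_le h.β_cont h.β_zero h.β_lip h.μ'_cont h.μ'_le hu hv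
      x)).trans_eq ?_
  ring

theorem abs_nonlocalCoeff_translate_le (h : CoeffBounds ν β μ N₀ N₁ N₂ Lβ M₀ M₁)
    (hu : Integrable (u t)) (htr : ∀ h, ∫ x, |u t (x + h) - u t x| ≤ c * |h|) (x y : ℝ) :
    |nonlocalCoeff ν β μ u t x - nonlocalCoeff ν β μ u t y| ≤ N₁ * (M₀ * Lβ * c) * |x - y| := by
  refine (h.ν_lip _ _).trans ?_
  rw [mul_assoc]
  exact mul_le_mul_of_nonneg_left (abs_convNonlin_translate_le h.β_cont h.β_zero h.Lβ_nonneg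
    h.β_lip h.μ_cont h.μ_le hu htr x y) ((abs_nonneg _).trans (h.ν'_le 0))

theorem abs_nonlocalCoeffDeriv_translate_le (h : CoeffBounds ν β μ N₀ N₁ N₂ Lβ M₀ M₁)
    (hc : 0 ≤ c) (hu : Integrable (u t))
    (htr : ∀ h, ∫ x, |u t (x + h) - u t x| ≤ c * |h|) (x y : ℝ) :
    |nonlocalCoeffDeriv ν β μ u t x - nonlocalCoeffDeriv ν β μ u t y| ≤
      (N₂ * (M₀ * Lβ * c) * (M₀ * Lβ * c) + N₁ * (M₁ * Lβ * c)) * |x - y| := by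
  refine (h.abs_deriv_mul_sub_le (h.abs_conv_deriv_le hc hu htr x)
    (abs_convNonlin_translate_le h.β_cont h.β_zero h.Lβ_nonneg h.β_lip h.μ_cont h.μ_le hu htr x y)
    (abs_convNonlin_translate_le h.β_cont h.β_zero h.Lβ_nonneg h.β_lip h.μ'_cont h.μ'_le hu htr
      x y)).trans_eq ?_
  ring

end CoeffBounds

end

/-! ### Entropy solutions as entropy flows -/

theorem IsContL1.uniformContinuous {T : ℝ} {u : ℝ → ℝ → ℝ} (h : IsContL1 T u) :
    ∀ ε > 0, ∃ δ > 0, ∀ s ∈ Icc 0 T, ∀ t ∈ Icc 0 T, |s - t| ≤ δ → ∫ x, |u s x - u t x| ≤ ε := by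
  intro ε hε
  have key : ∀ r : Icc (0 : ℝ) T, ∃ δ > 0, ∀ s ∈ Icc 0 T, s ∈ Metric.ball (r : ℝ) δ →
      ∫ x, |u s x - u r x| ≤ ε / 2 := by
    rintro ⟨r, hr⟩
    have h1 := (h.continuous r hr).eventually (Metric.closedBall_mem_nhds 0 (half_pos hε))
    obtain ⟨δ, hδ, h2⟩ := Metric.mem_nhdsWithin_iff.1 h1
    refine ⟨δ, hδ, fun s hs hsr => ?_⟩
    have := h2 ⟨hsr, hs⟩
    simp only [dist_zero_right, mem_ofPred_eq, Real.norm_eq_abs] at this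
    exact (le_abs_self _).trans this
  choose δ hδ hball using key
  obtain ⟨d, hd, hleb⟩ := lebesgue_number_lemma_of_metric (isCompact_Icc (a := (0 : ℝ)) (b := T))
    (c := fun r : Icc (0 : ℝ) T => Metric.ball (r : ℝ) (δ r)) (fun _ => Metric.isOpen_ball)
    (fun r hr => mem_iUnion.2 ⟨⟨r, hr⟩, Metric.mem_ball_self (hδ _)⟩)
  refine ⟨d / 2, half_pos hd, fun s hs t ht hst => ?_⟩
  obtain ⟨r, hr⟩ := hleb t ht
  have i1 := hball r s hs (hr (by rw [Metric.mem_ball, Real.dist_eq]; linarith))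
  have i2 := hball r t ht (hr (Metric.mem_ball_self hd))
  have j1 := ((h.integrable s hs).sub (h.integrable r r.2)).abs
  have j2 := ((h.integrable t ht).sub (h.integrable r r.2)).abs
  have := integral_mono ((h.integrable s hs).sub (h.integrable t ht)).abs (j1.add j2) (fun x => by
    simp only [Pi.sub_apply, Pi.add_apply]
    have := abs_sub_le (u s x) (u r x) (u t x)
    rwa [abs_sub_comm (u r x)] at this)
  simp only [Pi.add_apply] at this
  rw [integral_add j1 j2] at this
  simp only [Pi.sub_apply] at this
  linarith

section

theorem integrable_strip_mul {T C K N : ℝ} {g w : ℝ × ℝ → ℝ}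
    (hg : Integrable g (volume.restrict (strip T)))
    (hw : AEStronglyMeasurable w (volume.restrict (strip T)))
    (hwle : ∀ p ∈ strip T, |w p| ≤ C * (|g p| + K)) (hC : 0 ≤ C) (hK : 0 ≤ K)
    {m k : ℝ → ℝ} (hm : Continuous m) (hmN : ∀ t, |m t| ≤ N) (hk : Continuous k)
    (hks : HasCompactSupport k) :
    Integrable (fun p => w p * (m p.1 * k p.2)) (volume.restrict (strip T)) := by
  obtain ⟨M, hM⟩ := hk.bounded_above_of_compact_support hks
  have hN : 0 ≤ N := (abs_nonneg _).trans (hmN 0)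
  have hki : Integrable (fun p : ℝ × ℝ => |k p.2|) (volume.restrict (strip T)) := by
    rw [volume_restrict_strip]
    exact (hk.integrable_of_hasCompactSupport hks).abs.comp_snd _
  refine (((hg.abs.mul_const M).add (hki.const_mul K)).const_mul (C * N)).mono'
    (hw.mul (Continuous.aestronglyMeasurable (by fun_prop))) ?_
  filter_upwards [ae_restrict_mem (measurableSet_Ioo.prod MeasurableSet.univ)] with p hp
  have h1 := hwle p hp
  have h2 : |k p.2| ≤ M := hM p.2
  simp only [norm_mul, Real.norm_eq_abs, Pi.add_apply]
  calc |w p| * (|m p.1| * |k p.2|) ≤ C * (|g p| + K) * (N * |k p.2|) := by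
        gcongr
        exact hmN _
    _ = C * N * (|g p| * |k p.2| + K * |k p.2|) := by ring
    _ ≤ C * N * (|g p| * M + K * |k p.2|) := by gcongr

variable {f ν β μ : ℝ → ℝ} {L : ℝ≥0} {T c N₀ N₁ N₂ Lβ M₀ M₁ : ℝ} {u₀ : ℝ → ℝ} {u : ℝ → ℝ → ℝ}

theorem CoeffBounds.uniformContinuous (hb : CoeffBounds ν β μ N₀ N₁ N₂ Lβ M₀ M₁) (hc : 0 ≤ c)
    (hu : IsContL1 T u) (htr : ∀ t ∈ Icc 0 T, ∀ h, ∫ x, |u t (x + h) - u t x| ≤ c * |h|) :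
    ∀ ε > 0, ∃ δ > 0, ∀ s ∈ Icc 0 T, ∀ t ∈ Icc 0 T, ∀ x y, |s - t| ≤ δ → |x - y| ≤ δ →
      |nonlocalCoeff ν β μ u s x - nonlocalCoeff ν β μ u t y| ≤ ε ∧
      |nonlocalCoeffDeriv ν β μ u s x - nonlocalCoeffDeriv ν β μ u t y| ≤ ε := by
  intro ε hε
  have hM₀ : 0 ≤ M₀ := (abs_nonneg _).trans (hb.μ_le 0)
  have hM₁ : 0 ≤ M₁ := (abs_nonneg _).trans (hb.μ'_le 0)
  have hN₁ : 0 ≤ N₁ := (abs_nonneg _).trans (hb.ν'_le 0)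
  have hN₂ := hb.N₂_nonneg
  have hLβ := hb.Lβ_nonneg
  -- `P` dominates the Lipschitz constants of the coefficient and its derivative with respect to `u`
  -- in `L¹`, and `R` those in space. Each increment is split as `(s, x)`, `(t, x)`, `(t, y)`.
  set P := N₁ * (M₀ * Lβ) + (N₂ * (M₀ * Lβ) * (M₀ * Lβ * c) + N₁ * (M₁ * Lβ)) with hP
  set R := N₁ * (M₀ * Lβ * c) +
    (N₂ * (M₀ * Lβ * c) * (M₀ * Lβ * c) + N₁ * (M₁ * Lβ * c)) with hR
  have hP0 : 0 ≤ P := by positivity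
  have hR0 : 0 ≤ R := by positivity
  obtain ⟨δ, hδ, hd⟩ := hu.uniformContinuous (ε / 2 / (P + 1)) (by positivity)
  refine ⟨min δ (ε / 2 / (R + 1)), by positivity, fun s hs t ht x y hst hxy => ?_⟩
  have h1 := hd s hs t ht (hst.trans (min_le_left _ _))
  have h2 := hxy.trans (min_le_right _ _)
  have hI : 0 ≤ ∫ z, |u s z - u t z| := integral_nonneg fun z => abs_nonneg _
  have e1 : P * ∫ z, |u s z - u t z| ≤ ε / 2 := by
    calc P * ∫ z, |u s z - u t z| ≤ (P + 1) * (ε / 2 / (P + 1)) := by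
          gcongr
          linarith
      _ = ε / 2 := by field_simp
  have e2 : R * |x - y| ≤ ε / 2 := by
    calc R * |x - y| ≤ (R + 1) * (ε / 2 / (R + 1)) := by gcongr; linarith
      _ = ε / 2 := by field_simp
  have hX := abs_nonneg (x - y)
  have p1 : N₁ * (M₀ * Lβ) ≤ P := by rw [hP]; linarith [show 0 ≤
    N₂ * (M₀ * Lβ) * (M₀ * Lβ * c) + N₁ * (M₁ * Lβ) by positivity]
  have p2 : N₂ * (M₀ * Lβ) * (M₀ * Lβ * c) + N₁ * (M₁ * Lβ) ≤ P := by
    rw [hP]; linarith [show 0 ≤ N₁ * (M₀ * Lβ) by positivity]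
  have r1 : N₁ * (M₀ * Lβ * c) ≤ R := by rw [hR]; linarith [show 0 ≤
    N₂ * (M₀ * Lβ * c) * (M₀ * Lβ * c) + N₁ * (M₁ * Lβ * c) by positivity]
  have r2 : N₂ * (M₀ * Lβ * c) * (M₀ * Lβ * c) + N₁ * (M₁ * Lβ * c) ≤ R := by
    rw [hR]; linarith [show 0 ≤ N₁ * (M₀ * Lβ * c) by positivity]
  constructor
  · have a1 := hb.abs_nonlocalCoeff_sub_le (hu.integrable s hs) (hu.integrable t ht) x
    have a2 := hb.abs_nonlocalCoeff_translate_le (hu.integrable t ht) (htr t ht) x y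
    have := abs_sub_le (nonlocalCoeff ν β μ u s x) (nonlocalCoeff ν β μ u t x)
      (nonlocalCoeff ν β μ u t y)
    linarith [mul_le_mul_of_nonneg_right p1 hI, mul_le_mul_of_nonneg_right r1 hX]
  · have a1 := hb.abs_nonlocalCoeffDeriv_sub_le hc (hu.integrable s hs) (hu.integrable t ht)
      (htr s hs) x
    have a2 := hb.abs_nonlocalCoeffDeriv_translate_le hc (hu.integrable t ht) (htr t ht) x y
    have := abs_sub_le (nonlocalCoeffDeriv ν β μ u s x) (nonlocalCoeffDeriv ν β μ u t x)
      (nonlocalCoeffDeriv ν β μ u t y)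
    linarith [mul_le_mul_of_nonneg_right p2 hI, mul_le_mul_of_nonneg_right r2 hX]

theorem IsContL1.exists_integral_abs_le (hu : IsContL1 T u) :
    ∃ m, ∀ t ∈ Icc 0 T, ∫ x, |u t x| ≤ m := by
  have hc := continuousOn_integral_abs_sub hu.integrable (v := fun _ _ => 0)
    (fun _ _ => integrable_zero _ _ _) hu.uniformContinuous
    (fun ε hε => ⟨1, one_pos, fun s _ t _ _ => by simpa using hε.le⟩)
    (g := fun _ => 1) continuous_const (fun _ => zero_le_one) (fun _ => le_rfl)
  simp only [sub_zero, mul_one] at hc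
  obtain ⟨m, hm⟩ := isCompact_Icc.exists_bound_of_continuousOn hc
  exact ⟨m, fun t ht => (le_abs_self _).trans (hm t ht)⟩

theorem IsEntropySolution.integrable_strip (hu : IsEntropySolution f ν β μ T u₀ u) :
    Integrable (fun p : ℝ × ℝ => u p.1 p.2) (volume.restrict (strip T)) := by
  obtain ⟨m, hm⟩ := hu.contL1.exists_integral_abs_le
  exact integrable_strip_of_bound hu.contL1.integrable hm hu.essBounded.aestronglyMeasurable

theorem isTestFunction_mul {a b : ℝ → ℝ} (ha : ContDiff ℝ ∞ a) (has : HasCompactSupport a)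
    (haT : tsupport a ⊆ Iio T) (ha0 : ∀ t, 0 ≤ a t) (hb : IsSpaceTest b) :
    IsTestFunction T (fun p => a p.1 * b p.2) where
  smooth := (ha.comp contDiff_fst).mul (hb.smooth.comp contDiff_snd)
  hasCompactSupport := by
    refine HasCompactSupport.intro (has.isCompact.prod hb.hasCompactSupport.isCompact) fun p hp => ?_
    rw [mem_prod, not_and_or] at hp
    rcases hp with hp | hp <;> simp [image_eq_zero_of_notMem_tsupport hp]
  tsupport_subset := by
    intro p hp
    have h1 : tsupport (fun p : ℝ × ℝ => a p.1 * b p.2) ⊆ Prod.fst ⁻¹' tsupport a :=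
      closure_minimal (fun q hq => subset_tsupport _ fun h => hq (by simp [h]))
        ((isClosed_tsupport a).preimage continuous_fst)
    exact ⟨haT (h1 hp), mem_univ _⟩
  nonneg t x _ := mul_nonneg (ha0 t) (hb.nonneg x)

/-- The flux and source part of the entropy inequality, for a test function `b` in space. -/
noncomputable def fluxSource (f : ℝ → ℝ) (u U U' : ℝ → ℝ → ℝ) (k : ℝ) (b : ℝ → ℝ)
    (p : ℝ × ℝ) : ℝ :=
  kruzhkovFlux f (u p.1 p.2) k * U p.1 p.2 * deriv b p.2
    - Real.sign (u p.1 p.2 - k) * f k * U' p.1 p.2 * b p.2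

theorem integrable_abs_sub_mul {a b : ℝ → ℝ} {N : ℝ}
    (hui : Integrable (fun p : ℝ × ℝ => u p.1 p.2) (volume.restrict (strip T)))
    (ha : Continuous a) (haN : ∀ t, |a t| ≤ N) (hb : IsSpaceTest b) (k : ℝ) :
    Integrable (fun p : ℝ × ℝ => |u p.1 p.2 - k| * (a p.1 * b p.2))
      (volume.restrict (strip T)) :=
  integrable_strip_mul (C := 1) hui (hui.aestronglyMeasurable.sub aestronglyMeasurable_const).norm
    (fun p _ => by rw [Pi.sub_apply, Real.norm_eq_abs, abs_abs, one_mul]; exact abs_sub _ _)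
    zero_le_one (abs_nonneg k) ha haN hb.smooth.continuous hb.hasCompactSupport

theorem integrable_flux_mul_and_source_mul (hf : LipschitzWith L f)
    (hb : CoeffBounds ν β μ N₀ N₁ N₂ Lβ M₀ M₁) (hc : 0 ≤ c)
    (htr : ∀ t ∈ Icc 0 T, ∀ h, ∫ x, |u t (x + h) - u t x| ≤ c * |h|)
    (hu : IsEntropySolution f ν β μ T u₀ u) {m b : ℝ → ℝ} {N : ℝ}
    (hm : Continuous m) (hmN : ∀ t, |m t| ≤ N) (hbt : IsSpaceTest b) (k : ℝ) :
    Integrable (fun p : ℝ × ℝ => kruzhkovFlux f (u p.1 p.2) k * nonlocalCoeff ν β μ u p.1 p.2 *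
      (m p.1 * deriv b p.2)) (volume.restrict (strip T)) ∧
    Integrable (fun p : ℝ × ℝ => Real.sign (u p.1 p.2 - k) * f k *
      nonlocalCoeffDeriv ν β μ u p.1 p.2 * (m p.1 * b p.2)) (volume.restrict (strip T)) := by
  have hui := hu.integrable_strip
  have hum := hui.aestronglyMeasurable
  have hunif := hb.uniformContinuous hc hu.contL1 htr
  have hUm : AEStronglyMeasurable (fun p : ℝ × ℝ => nonlocalCoeff ν β μ u p.1 p.2)
      (volume.restrict (strip T)) :=
    aestronglyMeasurable_strip_of_uniform fun ε hε =>
      (hunif ε hε).imp fun _ hd => ⟨hd.1, fun s hs t ht x y h1 h2 => (hd.2 s hs t ht x y h1 h2).1⟩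
  have hU'm : AEStronglyMeasurable (fun p : ℝ × ℝ => nonlocalCoeffDeriv ν β μ u p.1 p.2)
      (volume.restrict (strip T)) :=
    aestronglyMeasurable_strip_of_uniform fun ε hε =>
      (hunif ε hε).imp fun _ hd => ⟨hd.1, fun s hs t ht x y h1 h2 => (hd.2 s hs t ht x y h1 h2).2⟩
  have hkm : AEStronglyMeasurable (fun p : ℝ × ℝ => kruzhkovFlux f (u p.1 p.2) k)
      (volume.restrict (strip T)) :=
    ((measurable_kruzhkovFlux hf.continuous).comp_aemeasurable
        (hum.aemeasurable.prodMk aemeasurable_const)).aestronglyMeasurable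
  have hsm : AEStronglyMeasurable (fun p : ℝ × ℝ => Real.sign (u p.1 p.2 - k))
      (volume.restrict (strip T)) :=
    (measurable_real_sign.comp_aemeasurable
      (hum.aemeasurable.sub aemeasurable_const)).aestronglyMeasurable
  have hN₀ : 0 ≤ N₀ := (abs_nonneg _).trans (hb.ν_le 0)
  have hstrip : ∀ p ∈ strip T, p.1 ∈ Icc 0 T := fun p hp => Ioo_subset_Icc_self hp.1
  constructor
  · refine integrable_strip_mul (C := L * N₀) (K := |k|) hui (hkm.mul hUm) (fun p _ => ?_)
      (mul_nonneg L.2 hN₀) (abs_nonneg _) hm hmN (hbt.smooth.continuous_deriv (by simp))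
      hbt.hasCompactSupport.deriv
    simp only [Pi.mul_apply, abs_mul]
    calc _ ≤ (L * (|u p.1 p.2| + |k|)) * N₀ :=
          mul_le_mul (abs_kruzhkovFlux_le_add hf _ _) (hb.ν_le _) (abs_nonneg _)
            (mul_nonneg L.2 (by positivity))
      _ = _ := by ring
  · refine integrable_strip_mul (C := 1) (K := |f k| * (N₁ * (M₀ * Lβ * c))) hui
      ((hsm.mul aestronglyMeasurable_const).mul hU'm) (fun p hp => ?_) zero_le_one ?_ hm hmN
      hbt.smooth.continuous hbt.hasCompactSupport
    · simp only [Pi.mul_apply, abs_mul, one_mul]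
      have h1 := hb.abs_nonlocalCoeffDeriv_le hc (hu.contL1.integrable _ (hstrip p hp))
        (htr _ (hstrip p hp)) p.2
      calc _ ≤ 1 * |f k| * (N₁ * (M₀ * Lβ * c)) := by
            gcongr
            exact abs_real_sign_le _
        _ ≤ _ := by rw [one_mul]; linarith [abs_nonneg (u p.1 p.2)]
    · have := (abs_nonneg _).trans (hb.μ_le 0)
      have := (abs_nonneg _).trans (hb.ν'_le 0)
      have := hb.Lβ_nonneg
      positivity

/-- The factor `a` need not vanish at time zero, so this form serves both interior test functions
and those that recover the initial datum. -/
theorem IsEntropySolution.entropy_mul (hf : LipschitzWith L f)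
    (hb : CoeffBounds ν β μ N₀ N₁ N₂ Lβ M₀ M₁) (hc : 0 ≤ c)
    (htr : ∀ t ∈ Icc 0 T, ∀ h, ∫ x, |u t (x + h) - u t x| ≤ c * |h|)
    (hu : IsEntropySolution f ν β μ T u₀ u) (k : ℝ) {a b : ℝ → ℝ} (ha : ContDiff ℝ ∞ a)
    (has : HasCompactSupport a) (haT : tsupport a ⊆ Iio T) (ha0 : ∀ t, 0 ≤ a t)
    (hbt : IsSpaceTest b) :
    0 ≤ (∫ p in strip T, |u p.1 p.2 - k| * (deriv a p.1 * b p.2))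
      + (∫ p in strip T, a p.1 *
          fluxSource f u (nonlocalCoeff ν β μ u) (nonlocalCoeffDeriv ν β μ u) k b p)
      + a 0 * ∫ x, |u₀ x - k| * b x := by
  have h := hu.entropy k _ (isTestFunction_mul ha has haT ha0 hbt)
  obtain ⟨N, hN⟩ := ha.continuous.bounded_above_of_compact_support has
  obtain ⟨i1, i2⟩ := integrable_flux_mul_and_source_mul hf hb hc htr hu ha.continuous hN hbt k
  have e1 : ∀ p : ℝ × ℝ, deriv (fun s => a s * b p.2) p.1 = deriv a p.1 * b p.2 := fun p =>
    deriv_mul_const ((ha.differentiable (by simp)) _) _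
  have e2 : ∀ p : ℝ × ℝ, deriv (fun y => a p.1 * b y) p.2 = a p.1 * deriv b p.2 := fun p =>
    deriv_const_mul _ ((hbt.smooth.differentiable (by simp)) _)
  simp only [e1, e2] at h
  have h2 : ∫ p in strip T, Real.sign (u p.1 p.2 - k) * nonlocalCoeff ν β μ u p.1 p.2
            * (f (u p.1 p.2) - f k) * (a p.1 * deriv b p.2) =
      ∫ p in strip T, kruzhkovFlux f (u p.1 p.2) k * nonlocalCoeff ν β μ u p.1 p.2 *
      (a p.1 * deriv b p.2) := by
    refine integral_congr_ae (Eventually.of_forall fun p => ?_)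
    simp only [kruzhkovFlux]; ring
  have h3 : ∫ p in strip T, f k * Real.sign (u p.1 p.2 - k)
            * deriv (fun y => nonlocalCoeff ν β μ u p.1 y) p.2 * (a p.1 * b p.2) =
      ∫ p in strip T, Real.sign (u p.1 p.2 - k) * f k *
      nonlocalCoeffDeriv ν β μ u p.1 p.2 * (a p.1 * b p.2) := by
    refine setIntegral_congr_fun (measurableSet_Ioo.prod MeasurableSet.univ) fun p hp => ?_
    have := (hb.hasDerivAt_nonlocalCoeff (hu.contL1.integrable _
      (Ioo_subset_Icc_self hp.1)) p.2).deriv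
    rw [show (fun y => nonlocalCoeff ν β μ u p.1 y) = nonlocalCoeff ν β μ u p.1 from rfl, this]
    ring
  have h4 : ∫ x, |u₀ x - k| * (a 0 * b x) = a 0 * ∫ x, |u₀ x - k| * b x := by
    rw [← integral_const_mul]
    refine integral_congr_ae (Eventually.of_forall fun x => ?_)
    simp only; ring
  rw [h2, h3, h4, add_sub_assoc, ← integral_sub i1 i2] at h
  refine h.trans_eq ?_
  congr 2
  refine integral_congr_ae (Eventually.of_forall fun p => ?_)
  simp only [fluxSource]; ring

theorem IsEntropySolution.isBVEntropyFlow (hf : LipschitzWith L f)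
    (hb : CoeffBounds ν β μ N₀ N₁ N₂ Lβ M₀ M₁) (hc : 0 ≤ c)
    (htr : ∀ t ∈ Icc 0 T, ∀ h, ∫ x, |u t (x + h) - u t x| ≤ c * |h|)
    (hu : IsEntropySolution f ν β μ T u₀ u) :
    IsBVEntropyFlow f T (nonlocalCoeff ν β μ u) (nonlocalCoeffDeriv ν β μ u) u c where
  integrable := hu.contL1.integrable
  uniformContinuous := hu.contL1.uniformContinuous
  aestronglyMeasurable := hu.essBounded.aestronglyMeasurable
  translation_le := htr
  hasDerivAt t ht x := hb.hasDerivAt_nonlocalCoeff (hu.contL1.integrable t ht) x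
  coeff_bounded := ⟨max N₀ (N₁ * (M₀ * Lβ * c)), fun t ht x =>
    ⟨(hb.ν_le _).trans (le_max_left _ _), (hb.abs_nonlocalCoeffDeriv_le hc
      (hu.contL1.integrable t ht) (htr t ht) x).trans (le_max_right _ _)⟩⟩
  coeff_uniformContinuous := hb.uniformContinuous hc hu.contL1 htr
  entropy k a b ha hbt := by
    have h := hu.entropy_mul hf hb hc htr k ha.smooth ha.hasCompactSupport
      (ha.tsupport_subset.trans fun t ht => ht.2) ha.nonneg hbt
    -- Interior test functions vanish at time zero, so the initial term drops out.
    have h0 : a 0 = 0 := image_eq_zero_of_notMem_tsupport fun h =>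
      lt_irrefl _ (ha.tsupport_subset h).1
    obtain ⟨N, hN⟩ := ha.smooth.continuous.bounded_above_of_compact_support ha.hasCompactSupport
    obtain ⟨N', hN'⟩ := (ha.smooth.continuous_deriv
      (by simp)).bounded_above_of_compact_support ha.hasCompactSupport.deriv
    obtain ⟨i1, i2⟩ :=
      integrable_flux_mul_and_source_mul hf hb hc htr hu ha.smooth.continuous hN hbt k
    have i0 := integrable_abs_sub_mul hu.integrable_strip
      (ha.smooth.continuous_deriv (by simp)) hN' hbt k
    have i3 : Integrable (fun p => a p.1 *
          fluxSource f u (nonlocalCoeff ν β μ u) (nonlocalCoeffDeriv ν β μ u) k b p)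
          (volume.restrict (strip T)) := by
      refine (i1.sub i2).congr (Eventually.of_forall fun p => ?_)
      simp only [fluxSource, Pi.sub_apply]; ring
    rw [h0, zero_mul, add_zero, ← integral_add i0 i3] at h
    refine h.trans_eq (integral_congr_ae (Eventually.of_forall fun p => ?_))
    simp only [fluxSource]; ring

/-- A time-independent profile solves the equation with vanishing coefficient. -/
theorem isBVEntropyFlow_stationary {w : ℝ → ℝ} (hw : Integrable w)
    (htr : ∀ h, ∫ x, |w (x + h) - w x| ≤ c * |h|) :
    IsBVEntropyFlow f T (fun _ _ => 0) (fun _ _ => 0) (fun _ => w) c where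
  integrable _ _ := hw
  uniformContinuous ε hε := ⟨1, one_pos, fun _ _ _ _ _ => by simpa using hε.le⟩
  aestronglyMeasurable := by
    rw [volume_restrict_strip]
    exact hw.aestronglyMeasurable.comp_snd
  translation_le _ _ := htr
  hasDerivAt _ _ _ := hasDerivAt_const _ _
  coeff_bounded := ⟨0, fun _ _ _ => by simp⟩
  coeff_uniformContinuous ε hε := ⟨1, one_pos, fun _ _ _ _ _ _ _ _ => by simpa using hε.le⟩
  entropy k a b ha _ := by
    rw [volume_restrict_strip]
    have : ∀ p : ℝ × ℝ, |w p.2 - k| * (deriv a p.1 * b p.2)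
        + kruzhkovFlux f (w p.2) k * 0 * (a p.1 * deriv b p.2)
        - Real.sign (w p.2 - k) * f k * 0 * (a p.1 * b p.2)
        = deriv a p.1 * (|w p.2 - k| * b p.2) := fun p => by ring
    simp_rw [this]
    rw [integral_prod_mul (deriv a) (fun x => |w x - k| * b x), ha.integral_deriv, zero_mul]

end

/-! ### Attainment of the initial datum -/

section

/-- The total mass of `|a'|` is scale invariant, hence bounded as the support shrinks to `{0}`. -/
theorem exists_time_cutoff : ∃ C : ℝ, 0 ≤ C ∧ ∀ δ : ℝ, 0 < δ → ∃ a : ℝ → ℝ, ContDiff ℝ ∞ a ∧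
    (∀ t, 0 ≤ a t) ∧ (∀ t, a t ≤ 1) ∧ a 0 = 1 ∧ (∀ t, δ ≤ |t| → a t = 0) ∧
    ∫ t, |deriv a t| ≤ C := by
  let b : ContDiffBump (0 : ℝ) := ⟨1 / 2, 1, by norm_num, by norm_num⟩
  have hbs : ContDiff ℝ ∞ b := b.contDiff
  refine ⟨∫ t, |deriv b t|, integral_nonneg fun _ => abs_nonneg _, fun δ hδ =>
    ⟨fun t => b (t / δ), hbs.comp (contDiff_id.div_const δ), fun _ => b.nonneg,
      fun _ => b.le_one, ?_, fun t ht => b.zero_of_le_dist ?_, ?_⟩⟩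
  · exact b.one_of_mem_closedBall (by simpa using b.rIn_pos.le)
  · simp only [dist_zero_right, Real.norm_eq_abs, abs_div, abs_of_pos hδ]
    rw [le_div_iff₀ hδ]
    simpa [b] using ht
  · have hd : ∀ t, |deriv (fun t => b (t / δ)) t| = δ⁻¹ * (fun s => |deriv b s|) (t / δ) := by
      intro t
      have h1 : HasDerivAt b (deriv b (t / δ)) (t / δ) :=
        (hbs.differentiable (by simp)).differentiableAt.hasDerivAt
      have h2 := h1.comp t ((hasDerivAt_id t).div_const δ)
      rw [show (fun t => b (t / δ)) = b ∘ fun x => id x / δ from rfl, h2.deriv, abs_mul,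
        abs_of_pos (by positivity : 0 < 1 / δ)]
      ring
    simp_rw [hd]
    rw [integral_const_mul, Measure.integral_comp_div (fun s => |deriv b s|)]
    simp [abs_of_pos hδ, hδ.ne']

/-- Bump kernels centred at `x` are admissible test functions, and the corresponding averages
converge almost everywhere. -/
theorem ae_le_of_forall_test {g h : ℝ → ℝ} (hg : LocallyIntegrable g) (hh : LocallyIntegrable h)
    (hle : ∀ b, IsSpaceTest b → ∫ x, g x * b x ≤ ∫ x, h x * b x) : g ≤ᵐ[volume] h := by
  let φ : ℕ → ContDiffBump (0 : ℝ) := fun n =>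
    ⟨1 / (n + 1), 2 / (n + 1), by positivity, by gcongr; norm_num⟩
  have hφ : Tendsto (fun n => (φ n).rOut) atTop (𝓝 0) :=
    tendsto_const_nhds.div_atTop (tendsto_natCast_atTop_atTop.atTop_add tendsto_const_nhds)
  have hφ' : ∀ᶠ n in atTop, (φ n).rOut ≤ 2 * (φ n).rIn :=
    Eventually.of_forall fun n => by simp only [φ]; rw [mul_one_div]
  filter_upwards [ContDiffBump.ae_convolution_tendsto_right_of_locallyIntegrable hφ hφ' hg,
    ContDiffBump.ae_convolution_tendsto_right_of_locallyIntegrable hφ hφ' hh] with x hx1 hx2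
  refine le_of_tendsto_of_tendsto' hx1 hx2 fun n => ?_
  have key : ∀ g : ℝ → ℝ, convolution ((φ n).normed volume) g (ContinuousLinearMap.lsmul ℝ ℝ) volume x =
      ∫ y, g y * (φ n).normed volume (x - y) := by
    intro g
    rw [convolution_def, ← integral_sub_left_eq_self _ volume x]
    refine integral_congr_ae (Eventually.of_forall fun y => ?_)
    simp [mul_comm]
  rw [key, key]
  refine hle _ ⟨?_, ?_, fun y => (φ n).nonneg_normed _⟩
  · exact ((φ n).contDiff_normed (n := ⊤)).comp (contDiff_const.sub contDiff_id)
  · exact (φ n).hasCompactSupport_normed.comp_homeomorph (Homeomorph.subLeft x)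

/-- Taking `k = w x` would finish at once, but the exceptional null set depends on `k`. Rational `k`
share one null set, and continuity in `k` extends the inequality to all reals. -/
theorem ae_eq_of_forall_abs_sub_le {v w : ℝ → ℝ} (hv : LocallyIntegrable v)
    (hw : LocallyIntegrable w)
    (hle : ∀ k b, IsSpaceTest b → ∫ x, |v x - k| * b x ≤ ∫ x, |w x - k| * b x) :
    v =ᵐ[volume] w := by
  have hli : ∀ {z : ℝ → ℝ} (k : ℝ), LocallyIntegrable z →
      LocallyIntegrable fun x => |z x - k| := fun k hz =>
    fun x => (hz.sub (locallyIntegrable_const k) x).norm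
  have h1 : ∀ᵐ x, ∀ q : ℚ, |v x - q| ≤ |w x - q| :=
    ae_all_iff.2 fun q => ae_le_of_forall_test (hli _ hv) (hli _ hw) (hle q)
  filter_upwards [h1] with x hx
  have h2 : ∀ k : ℝ, |v x - k| ≤ |w x - k| := by
    have hcl : IsClosed {k : ℝ | |v x - k| ≤ |w x - k|} :=
      isClosed_le (by fun_prop) (by fun_prop)
    intro k
    have := hcl.closure_subset_iff.2 (range_subset_iff.2 hx)
    exact this (Rat.denseRange_cast k)
  have := h2 (w x)
  rw [sub_self, abs_zero] at this
  exact sub_eq_zero.1 (abs_nonpos_iff.1 this)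

variable {f ν β μ : ℝ → ℝ} {L : ℝ≥0} {T c N₀ N₁ N₂ Lβ M₀ M₁ : ℝ} {u₀ : ℝ → ℝ} {u : ℝ → ℝ → ℝ}

/-- Test with `aₙ(t) b(x)`, where `aₙ 0 = 1` and the support shrinks to `t = 0`. The flux and source
term tends to zero, and since `aₙ'` has integral `-1` on `(0, T)` the time term tends to `-∫ |u(0) -
k| b`. -/
theorem IsEntropySolution.integral_abs_initial_le (hT : 0 < T) (hf : LipschitzWith L f)
    (hb : CoeffBounds ν β μ N₀ N₁ N₂ Lβ M₀ M₁) (hc : 0 ≤ c)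
    (htr : ∀ t ∈ Icc 0 T, ∀ h, ∫ x, |u t (x + h) - u t x| ≤ c * |h|)
    (hu : IsEntropySolution f ν β μ T u₀ u) (k : ℝ) {b : ℝ → ℝ} (hbt : IsSpaceTest b) :
    ∫ x, |u 0 x - k| * b x ≤ ∫ x, |u₀ x - k| * b x := by
  obtain ⟨C, hC0, hC⟩ := exists_time_cutoff
  obtain ⟨M, hM⟩ := hbt.smooth.continuous.bounded_above_of_compact_support hbt.hasCompactSupport
  have hM0 : 0 ≤ M := (norm_nonneg _).trans (hM 0)
  have hms : MeasurableSet (strip T) := measurableSet_Ioo.prod MeasurableSet.univ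
  have h0T : (0 : ℝ) ∈ Icc 0 T := left_mem_Icc.2 hT.le
  set H := fluxSource f u (nonlocalCoeff ν β μ u) (nonlocalCoeffDeriv ν β μ u) k b with hH
  have hHi : Integrable H (volume.restrict (strip T)) := by
    obtain ⟨i1, i2⟩ := integrable_flux_mul_and_source_mul hf hb hc htr hu
      (m := fun _ => 1) continuous_const (N := 1) (fun _ => by simp) hbt k
    refine (i1.sub i2).congr (Eventually.of_forall fun p => ?_)
    simp only [hH, fluxSource, Pi.sub_apply]; ring
  set G : ℝ → ℝ := fun t => ∫ x, |u t x - k| * b x with hG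
  have hGi : ∀ t ∈ Icc 0 T, Integrable fun x => |u t x - k| * b x := by
    intro t ht
    have hbi := hbt.smooth.continuous.integrable_of_hasCompactSupport (μ := volume)
      hbt.hasCompactSupport
    have hm : AEStronglyMeasurable fun x => |u t x - k| :=
      ((hu.contL1.integrable t ht).aestronglyMeasurable.sub aestronglyMeasurable_const).norm
    refine (((hu.contL1.integrable t ht).abs.mul_const M).add (hbi.abs.const_mul |k|)).mono'
      (hm.mul hbi.aestronglyMeasurable) (Eventually.of_forall fun x => ?_)
    simp only [norm_mul, Real.norm_eq_abs, abs_abs, Pi.add_apply]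
    have h1 : |b x| ≤ M := hM x
    calc |u t x - k| * |b x| ≤ (|u t x| + |k|) * |b x| := by gcongr; exact abs_sub _ _
      _ = |u t x| * |b x| + |k| * |b x| := by ring
      _ ≤ _ := by gcongr
  have hGsub : ∀ t ∈ Icc 0 T, |G t - G 0| ≤ M * ∫ x, |u t x - u 0 x| := by
    intro t ht
    have hi := ((hu.contL1.integrable t ht).sub (hu.contL1.integrable 0 h0T)).abs
    simp only [hG]
    rw [← integral_sub (hGi t ht) (hGi 0 h0T), ← integral_const_mul]
    refine abs_integral_le_integral_abs.trans (integral_mono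
      ((hGi t ht).sub (hGi 0 h0T)).abs (hi.const_mul M) fun x => ?_)
    simp only
    rw [← sub_mul, abs_mul, mul_comm]
    refine mul_le_mul (hM x) ?_ (abs_nonneg _) hM0
    refine (abs_abs_sub_abs_le_abs_sub _ _).trans_eq ?_
    congr 1; ring
  -- The shift by `2` makes every width strictly smaller than `T`, so the cut-offs are supported
  -- before the final time.
  set δ : ℕ → ℝ := fun n => T / (n + 2) with hδ
  have hδ0 : ∀ n, 0 < δ n := fun n => by positivity
  have hδT : ∀ n, δ n < T := fun n => div_lt_self hT (by linarith [n.cast_nonneg (α := ℝ)])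
  have hδlim : Tendsto δ atTop (𝓝 0) :=
    tendsto_const_nhds.div_atTop (tendsto_natCast_atTop_atTop.atTop_add tendsto_const_nhds)
  choose a has ha0 ha1 ha00 haz haC using fun n => hC (δ n) (hδ0 n)
  have haCS : ∀ n, HasCompactSupport (a n) := fun n => hasCompactSupport_of_abs_le (haz n)
  have hR : Tendsto (fun n => ∫ p in strip T, a n p.1 * H p) atTop (𝓝 0) := by
    have := tendsto_integral_of_dominated_convergence (μ := volume.restrict (strip T))
      (F := fun n p => a n p.1 * H p) (f := fun _ => (0 : ℝ)) (fun p => |H p|)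
      (fun n => (Continuous.aestronglyMeasurable
        (by have := (has n).continuous; fun_prop)).mul hHi.aestronglyMeasurable) hHi.abs
      (fun n => Eventually.of_forall fun p => ?_) ?_
    · simpa using this
    · rw [norm_mul, Real.norm_eq_abs, Real.norm_eq_abs, abs_of_nonneg (ha0 n _)]
      exact mul_le_of_le_one_left (abs_nonneg _) (ha1 n _)
    · filter_upwards [ae_restrict_mem hms] with p hp
      refine tendsto_const_nhds.congr' ?_
      filter_upwards [hδlim.eventually (Iio_mem_nhds hp.1.1)] with n hn
      rw [haz n p.1 (le_of_lt (lt_of_lt_of_le hn (le_abs_self _))), zero_mul]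
  rw [← sub_nonneg]
  refine nonneg_of_forall_pos_add_mul (Q := C * M + 1) fun e he => ?_
  obtain ⟨d, hd, hdu⟩ := hu.contL1.uniformContinuous e he
  obtain ⟨n, hn1, hn2⟩ := ((hδlim.eventually (Iio_mem_nhds hd)).and
    (hR.eventually (Iio_mem_nhds he))).exists
  have ha'c : Continuous (deriv (a n)) := (has n).continuous_deriv (by simp)
  obtain ⟨N', hN'⟩ := ha'c.bounded_above_of_compact_support (haCS n).deriv
  have hent := hu.entropy_mul hf hb hc htr k (has n) (haCS n) (by
    have : tsupport (a n) ⊆ Icc (-δ n) (δ n) := closure_minimal (fun t ht => by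
      by_contra hn
      refine ht (haz n t ?_)
      by_contra hlt
      exact hn (abs_le.1 (not_le.1 hlt).le)) isClosed_Icc
    exact this.trans fun t ht => ht.2.trans_lt (hδT n)) (ha0 n) hbt
  rw [ha00, one_mul] at hent
  have i0 := integrable_abs_sub_mul hu.integrable_strip ha'c hN' hbt k
  rw [volume_restrict_strip] at i0
  have hfub : ∫ p in strip T, |u p.1 p.2 - k| * (deriv (a n) p.1 * b p.2) =
      ∫ t in Ioo 0 T, deriv (a n) t * G t := by
    rw [volume_restrict_strip, integral_prod _ i0]
    refine integral_congr_ae (Eventually.of_forall fun t => ?_)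
    simp only [hG]
    rw [← integral_const_mul]
    refine integral_congr_ae (Eventually.of_forall fun x => ?_)
    simp only; ring
  have hGint : IntegrableOn (fun t => deriv (a n) t * G t) (Ioo 0 T) := by
    refine i0.integral_prod_left.congr (Eventually.of_forall fun t => ?_)
    simp only [hG]
    rw [← integral_const_mul]
    refine integral_congr_ae (Eventually.of_forall fun x => ?_)
    simp only; ring
  have ha'i : Integrable (deriv (a n)) := ha'c.integrable_of_hasCompactSupport (haCS n).deriv
  have hone : ∫ t in Ioo 0 T, deriv (a n) t = -1 := by
    rw [← integral_Ioc_eq_integral_Ioo, ← intervalIntegral.integral_of_le hT.le,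
      intervalIntegral.integral_deriv_eq_sub (fun t _ => (has n).differentiable (by simp) t)
      (ha'c.intervalIntegrable _ _), ha00, haz n T (by rw [abs_of_pos hT]; exact (hδT n).le)]
    norm_num
  -- Up to time `δ n` the `L¹` continuity of `u` makes `G t - G 0` small; after it, `aₙ'` vanishes.
  have hbnd : ∫ t in Ioo 0 T, deriv (a n) t * (G t - G 0) ≤ C * (M * e) := by
    calc ∫ t in Ioo 0 T, deriv (a n) t * (G t - G 0)
        ≤ ∫ t in Ioo 0 T, |deriv (a n) t| * (M * e) := by
          refine setIntegral_mono_on ?_ (ha'i.abs.mul_const _).integrableOn measurableSet_Ioo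
            fun t ht => ?_
          · simp_rw [mul_sub]
            exact hGint.sub (ha'i.mul_const _).integrableOn
          · refine (le_abs_self _).trans ?_
            rw [abs_mul]
            by_cases htn : t ≤ δ n
            · refine mul_le_mul_of_nonneg_left ((hGsub t (Ioo_subset_Icc_self ht)).trans ?_)
                (abs_nonneg _)
              refine mul_le_mul_of_nonneg_left (hdu t (Ioo_subset_Icc_self ht) 0 h0T ?_) hM0
              rw [sub_zero, abs_of_pos ht.1]
              exact htn.trans (le_of_lt hn1)
            · have : a n =ᶠ[𝓝 t] fun _ => 0 := by
                filter_upwards [Ioi_mem_nhds (not_le.1 htn)] with s hs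
                exact haz n s (le_of_lt (lt_of_lt_of_le hs (le_abs_self _)))
              rw [this.deriv_eq]
              simp
      _ ≤ ∫ t, |deriv (a n) t| * (M * e) :=
          setIntegral_le_integral (ha'i.abs.mul_const _)
            (Eventually.of_forall fun t => by positivity)
      _ ≤ C * (M * e) := by
          rw [integral_mul_const]
          exact mul_le_mul_of_nonneg_right (haC n) (by positivity)
  simp_rw [mul_sub] at hbnd
  rw [integral_sub hGint (ha'i.mul_const _).integrableOn, integral_mul_const, hone] at hbnd
  rw [hfub] at hent
  have hn2' : ∫ p in strip T, a n p.1 * H p < e := hn2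
  linarith

theorem IsEntropySolution.initial_ae_eq (hT : 0 < T) (hf : LipschitzWith L f)
    (hb : CoeffBounds ν β μ N₀ N₁ N₂ Lβ M₀ M₁) (hc : 0 ≤ c)
    (htr : ∀ t ∈ Icc 0 T, ∀ h, ∫ x, |u t (x + h) - u t x| ≤ c * |h|)
    (hu₀ : Integrable u₀) (hu : IsEntropySolution f ν β μ T u₀ u) : u 0 =ᵐ[volume] u₀ :=
  ae_eq_of_forall_abs_sub_le (hu.contL1.integrable 0 (left_mem_Icc.2 hT.le)).locallyIntegrable
    hu₀.locallyIntegrable fun k _ hbt => hu.integral_abs_initial_le hT hf hb hc htr k hbt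

/-! ### Bounding spatial norms by the space-time norm -/

/-- Distance to the initial profile, obtained by comparison with a stationary solution. -/
theorem IsEntropySolution.integral_abs_sub_initial_le {C : ℝ} (hT : 0 < T)
    (hf : LipschitzWith L f) (hf0 : f 0 = 0)
    (hC0 : 0 ≤ C) (hC : ∀ δ : ℝ, 0 < δ → ∃ ρ, IsMollifier C δ ρ)
    (hb : CoeffBounds ν β μ N₀ N₁ N₂ Lβ M₀ M₁) (hc : 0 ≤ c)
    (htr : ∀ t ∈ Icc 0 T, ∀ h, ∫ x, |u t (x + h) - u t x| ≤ c * |h|)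
    (hu : IsEntropySolution f ν β μ T u₀ u) {t : ℝ} (ht : t ∈ Icc 0 T) :
    (∫ x, |u t x - u 0 x|) + ((∫ x, |u 0 x|) + 1) ≤ ((∫ x, |u 0 x|) + 1) *
      Real.exp (L * (C * c * N₀ + N₁ * (M₀ * Lβ * c)) * t) := by
  have h0T : (0 : ℝ) ∈ Icc 0 T := left_mem_Icc.2 hT.le
  have hm0 : 0 ≤ ∫ x, |u 0 x| := integral_nonneg fun _ => abs_nonneg _
  set m := ∫ x, |u 0 x| with hm
  set l := m + 1 with hl
  have hl0 : 0 < l := by positivity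
  have hN₀ : 0 ≤ N₀ := (abs_nonneg _).trans (hb.ν_le 0)
  have hN₁ : 0 ≤ N₁ := (abs_nonneg _).trans (hb.ν'_le 0)
  have hM₀ : 0 ≤ M₀ := (abs_nonneg _).trans (hb.μ_le 0)
  have hLβ := hb.Lβ_nonneg
  have hL : (0 : ℝ) ≤ L := L.2
  -- The stationary profile has coefficient zero, so the coefficient difference is only bounded by a
  -- constant `B`; it is rewritten as a multiple of `D + l`.
  have key : ∀ B : ℝ, 0 ≤ B → ∀ s, B ≤ B / l * ((∫ x, |u s x - u 0 x|) + l) := by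
    intro B hB s
    have hI : 0 ≤ ∫ x, |u s x - u 0 x| := integral_nonneg fun _ => abs_nonneg _
    rw [div_mul_eq_mul_div, le_div_iff₀ hl0]
    exact mul_le_mul_of_nonneg_left (by linarith) hB
  have h := comparison hf hf0 hT hC (hu.isBVEntropyFlow hf hb hc htr)
    (isBVEntropyFlow_stationary (T := T) (f := f) (hu.contL1.integrable 0 h0T) (htr 0 h0T)) hc
    (m := m) (a := N₀ / l) (b := N₁ * (M₀ * Lβ * c) / l) (l := l) (fun _ _ => le_rfl)
    (fun s _ x => by
      rw [sub_zero]
      exact (hb.ν_le _).trans (key _ hN₀ s))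
    (fun s hs x => by
      rw [sub_zero]
      exact (hb.abs_nonlocalCoeffDeriv_le hc (hu.contL1.integrable s hs) (htr s hs) x).trans
        (key _ (by positivity) s)) t ht
  simp only [sub_self, abs_zero, integral_zero, zero_add] at h
  refine h.trans (mul_le_mul_of_nonneg_left (Real.exp_le_exp.2 ?_) hl0.le)
  -- With `l = m + 1`, both `1 / l ≤ 1` and `m / l ≤ 1`, so the exponent no longer depends on the
  -- unknown norm `m`.
  refine mul_le_mul_of_nonneg_right (mul_le_mul_of_nonneg_left (add_le_add ?_ ?_) hL) ht.1
  · exact mul_le_mul_of_nonneg_left (div_le_self hN₀ (by linarith)) (by positivity)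
  · rw [mul_div_assoc', div_le_iff₀ hl0, mul_comm]
    exact mul_le_mul_of_nonneg_left (by linarith) (by positivity)

theorem exp_le_three_halves {x : ℝ} (hx : x ≤ 1 / 4) : Real.exp x ≤ 3 / 2 := by
  have h1 : 1 - x ≤ Real.exp (-x) := by linarith [Real.add_one_le_exp (-x)]
  have h2 : Real.exp x * Real.exp (-x) = 1 := by rw [← Real.exp_add]; simp
  nlinarith [Real.exp_pos x]

/-- The spatial `L¹` norms are controlled by the space-time `L¹` norm. -/
theorem IsEntropySolution.integral_abs_le {C : ℝ} (hT : 0 < T)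
    (hf : LipschitzWith L f) (hf0 : f 0 = 0)
    (hC0 : 0 ≤ C) (hC : ∀ δ : ℝ, 0 < δ → ∃ ρ, IsMollifier C δ ρ)
    (hb : CoeffBounds ν β μ N₀ N₁ N₂ Lβ M₀ M₁) (hc : 0 ≤ c)
    (htr : ∀ t ∈ Icc 0 T, ∀ h, ∫ x, |u t (x + h) - u t x| ≤ c * |h|)
    (hu : IsEntropySolution f ν β μ T u₀ u) {K : ℝ}
    (hK : K = L * (C * c * N₀ + N₁ * (M₀ * Lβ * c))) {t : ℝ} (ht : t ∈ Icc 0 T) :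
    ∫ x, |u t x| ≤
      (2 * normL1Strip T u / min T (1 / (4 * (K + 1))) + 2) * Real.exp (K * T) := by
  have h0T : (0 : ℝ) ∈ Icc 0 T := left_mem_Icc.2 hT.le
  have hm0 : 0 ≤ ∫ x, |u 0 x| := integral_nonneg fun _ => abs_nonneg _
  have hK0 : 0 ≤ K := by
    have hN₀ : 0 ≤ N₀ := (abs_nonneg _).trans (hb.ν_le 0)
    have hN₁ : 0 ≤ N₁ := (abs_nonneg _).trans (hb.ν'_le 0)
    have hM₀ : 0 ≤ M₀ := (abs_nonneg _).trans (hb.μ_le 0)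
    have hLβ := hb.Lβ_nonneg
    rw [hK]; positivity
  have hD : ∀ s ∈ Icc 0 T, (∫ x, |u s x - u 0 x|) + ((∫ x, |u 0 x|) + 1) ≤
      ((∫ x, |u 0 x|) + 1) * Real.exp (K * s) := fun s hs =>
    hK ▸ hu.integral_abs_sub_initial_le hT hf hf0 hC0 hC hb hc htr hs
  have tri : ∀ s ∈ Icc 0 T, ∀ r ∈ Icc 0 T,
      ∫ x, |u s x| ≤ (∫ x, |u s x - u r x|) + ∫ x, |u r x| := by
    intro s hs r hr
    have j1 := ((hu.contL1.integrable s hs).sub (hu.contL1.integrable r hr)).abs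
    have j2 := (hu.contL1.integrable r hr).abs
    have := integral_mono (hu.contL1.integrable s hs).abs (j1.add j2) (fun x => by
      simp only [Pi.sub_apply, Pi.add_apply]
      linarith [abs_sub_abs_le_abs_sub (u s x) (u r x)])
    simp only [Pi.add_apply] at this
    rw [integral_add j1 j2] at this
    simpa only [Pi.sub_apply] using this
  set m := ∫ x, |u 0 x| with hm
  -- For times below `τ` one has `K s ≤ 1/4`, so the exponential is at most `3/2`; `K + 1` keeps the
  -- quotient defined when `K = 0`.
  set τ := min T (1 / (4 * (K + 1))) with hτ
  have hτ0 : 0 < τ := lt_min hT (by positivity)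
  -- Here the distance to the initial profile is at most `(m + 1)/2`, which the triangle inequality
  -- absorbs. Integrating over `(0, τ)` then bounds `m` by the space-time norm.
  have hsmall : ∀ s ∈ Ioo 0 τ, m + 1 ≤ 2 * (∫ x, |u s x|) + 2 := by
    intro s hs
    have hsT : s ∈ Icc 0 T := ⟨hs.1.le, hs.2.le.trans (min_le_left _ _)⟩
    have hKs : K * s ≤ 1 / 4 := by
      calc K * s ≤ (K + 1) * (1 / (4 * (K + 1))) := by
            have := hs.2.le.trans (min_le_right _ _)
            have := hs.1.le
            gcongr
            linarith
        _ = 1 / 4 := by field_simp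
    have h1 := hD s hsT
    have h2 := tri 0 h0T s hsT
    simp_rw [abs_sub_comm (u 0 _)] at h2
    have h3 : (m + 1) * Real.exp (K * s) ≤ (m + 1) * (3 / 2) :=
      mul_le_mul_of_nonneg_left (exp_le_three_halves hKs) (by positivity)
    linarith
  have hui := hu.integrable_strip.abs
  rw [volume_restrict_strip] at hui
  have hnorm : normL1Strip T u = ∫ s in Ioo 0 T, ∫ x, |u s x| := by
    rw [normL1Strip, volume_restrict_strip, integral_prod _ hui]
  have hni : IntegrableOn (fun s => ∫ x, |u s x|) (Ioo 0 T) := hui.integral_prod_left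
  have hsub : Ioo 0 τ ⊆ Ioo 0 T := Ioo_subset_Ioo_right (min_le_left _ _)
  have hint : τ * (m + 1) ≤ 2 * normL1Strip T u + 2 * τ := by
    have h1 : ∫ s in Ioo 0 τ, (m + 1) ≤ ∫ s in Ioo 0 τ, (2 * (∫ x, |u s x|) + 2) :=
      setIntegral_mono_on (integrableOn_const (by simp))
        (((hni.mono_set hsub).const_mul 2).add (integrableOn_const (by simp))) measurableSet_Ioo
        hsmall
    rw [integral_add ((hni.mono_set hsub).const_mul 2) (integrableOn_const (by simp)),
      integral_const_mul] at h1
    simp only [setIntegral_const, Real.volume_real_Ioo, sub_zero, max_eq_left hτ0.le,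
      smul_eq_mul] at h1
    have h2 : ∫ s in Ioo 0 τ, ∫ x, |u s x| ≤ normL1Strip T u := by
      rw [hnorm]
      exact setIntegral_mono_set hni
        (Eventually.of_forall fun s => integral_nonneg fun _ => abs_nonneg _)
        (LE.le.eventuallyLE hsub)
    linarith
  have hml : m + 1 ≤ 2 * normL1Strip T u / τ + 2 := by
    rw [← sub_le_iff_le_add, le_div_iff₀ hτ0]
    linarith
  have hexp : Real.exp (K * t) ≤ Real.exp (K * T) :=
    Real.exp_le_exp.2 (mul_le_mul_of_nonneg_left ht.2 hK0)
  calc ∫ x, |u t x| ≤ (m + 1) * Real.exp (K * t) := by linarith [hD t ht, tri t ht 0 h0T]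
    _ ≤ _ := mul_le_mul hml hexp (Real.exp_pos _).le (by linarith)

/-! ### Conclusion -/

theorem translation_le_of_supTV {u : ℝ → ℝ → ℝ} (hu : IsContL1 T u) (h : supTV T u < ⊤) :
    ∀ t ∈ Icc 0 T, ∀ h, ∫ x, |u t (x + h) - u t x| ≤ (supTV T u).toReal * |h| :=
  fun t ht => integral_abs_translate_le (hu.integrable t ht) h.ne
    (le_iSup₂ (f := fun s (_ : s ∈ Icc 0 T) => totalVariation (u s)) t ht)

theorem ae_eq_of_forall_integral_abs_sub_eq_zero {u v : ℝ → ℝ → ℝ}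
    (hu : Integrable (fun p : ℝ × ℝ => u p.1 p.2) (volume.restrict (strip T)))
    (hv : Integrable (fun p : ℝ × ℝ => v p.1 p.2) (volume.restrict (strip T)))
    (h : ∀ t ∈ Icc 0 T, ∫ x, |u t x - v t x| = 0) :
    ∀ᵐ p : ℝ × ℝ ∂(volume.restrict (Icc 0 T ×ˢ univ)), u p.1 p.2 = v p.1 p.2 := by
  have hset : (volume : Measure (ℝ × ℝ)).restrict (Icc 0 T ×ˢ univ) =
      volume.restrict (strip T) := by
    rw [volume_restrict_strip, Measure.volume_eq_prod, ← Measure.prod_restrict,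
      Measure.restrict_univ, Measure.restrict_congr_set Ioo_ae_eq_Icc]
  have hi : Integrable (fun p : ℝ × ℝ => |u p.1 p.2 - v p.1 p.2|) (volume.restrict (strip T)) :=
    (hu.sub hv).abs
  have h0 : ∫ p in strip T, |u p.1 p.2 - v p.1 p.2| = 0 := by
    rw [volume_restrict_strip] at hi ⊢
    rw [integral_prod (fun p : ℝ × ℝ => |u p.1 p.2 - v p.1 p.2|) hi]
    refine integral_eq_zero_of_ae ?_
    filter_upwards [ae_restrict_mem measurableSet_Ioo] with t ht
    exact h t (Ioo_subset_Icc_self ht)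
  rw [hset]
  filter_upwards [(integral_eq_zero_iff_of_nonneg (fun p => abs_nonneg _) hi).1 h0] with p hp
  exact sub_eq_zero.1 (abs_eq_zero.1 hp)

end

end NonlocalCL

theorem theorem2p1 (f ν β μ : ℝ → ℝ) (hA : NonlocalCL.Assumptions f ν β μ)
    (T : ℝ) (hT : 0 < T) :
    ∃ M : ℝ → ℝ → ℝ → ℝ → ℝ, (∀ a b c d : ℝ, 0 < M a b c d) ∧
      ∀ (u₀ v₀ : ℝ → ℝ) (u v : ℝ → ℝ → ℝ),
        Integrable u₀ → Integrable v₀ →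
        NonlocalCL.IsEntropySolution f ν β μ T u₀ u →
        NonlocalCL.IsEntropySolution f ν β μ T v₀ v →
        NonlocalCL.supTV T u < ⊤ → NonlocalCL.supTV T v < ⊤ →
        (∀ t ∈ Icc 0 T,
          (∫ x, |u t x - v t x|) ≤
            (∫ x, |u₀ x - v₀ x|) *
              (1 + M (NonlocalCL.normL1Strip T u) (NonlocalCL.normL1Strip T v)
                    (NonlocalCL.supTV T u).toReal (NonlocalCL.supTV T v).toReal * t *
                  Real.exp (M (NonlocalCL.normL1Strip T u) (NonlocalCL.normL1Strip T v)
                    (NonlocalCL.supTV T u).toReal (NonlocalCL.supTV T v).toReal * t))) ∧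
        (u₀ =ᵐ[volume] v₀ →
          ∀ᵐ p : ℝ × ℝ ∂(volume.restrict (Icc 0 T ×ˢ univ)), u p.1 p.2 = v p.1 p.2) := by
  obtain ⟨L, hf⟩ := hA.f_lipschitz
  have hf0 := hA.f_zero
  obtain ⟨C, hC0, hC⟩ := NonlocalCL.exists_isMollifier
  obtain ⟨N₀, N₁, N₂, Lβ, M₀, M₁, hb⟩ := hA.exists_coeffBounds
  -- `κ` is the growth rate of `v` away from its initial profile, as a function of its total
  -- variation. `K` is the Grönwall rate of `comparison`, with the resulting bound on `‖v(t)‖₁`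
  -- inserted.
  set κ : ℝ → ℝ := fun d => L * (C * d * N₀ + N₁ * (M₀ * Lβ * d)) with hκ
  set K : ℝ → ℝ → ℝ → ℝ := fun b c d => L * (C * d * (N₁ * (M₀ * Lβ)) +
    (2 * b / min T (1 / (4 * (κ d + 1))) + 2) * Real.exp (κ d * T) *
      (N₂ * (M₀ * Lβ) * (M₀ * Lβ * c) + N₁ * (M₁ * Lβ))) with hK
  -- The absolute value and the added `1` make the constant positive for all real arguments,
  -- including those that are not norms.
  refine ⟨fun _ b c d => 1 + |K b c d|, fun a b c d => by positivity,
    fun u₀ v₀ u v hu₀ hv₀ hu hv hTVu hTVv => ?_⟩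
  have htru := NonlocalCL.translation_le_of_supTV hu.contL1 hTVu
  have htrv := NonlocalCL.translation_le_of_supTV hv.contL1 hTVv
  set c := (NonlocalCL.supTV T u).toReal with hc
  set d := (NonlocalCL.supTV T v).toReal with hd
  have hc0 : 0 ≤ c := ENNReal.toReal_nonneg
  have hd0 : 0 ≤ d := ENNReal.toReal_nonneg
  have hinit : ∫ x, |u 0 x - v 0 x| = ∫ x, |u₀ x - v₀ x| := by
    refine integral_congr_ae ?_
    filter_upwards [hu.initial_ae_eq hT hf hb hc0 htru hu₀,
      hv.initial_ae_eq hT hf hb hd0 htrv hv₀] with x h1 h2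
    rw [h1, h2]
  have hmain : ∀ t ∈ Icc 0 T, ∫ x, |u t x - v t x| ≤
      (∫ x, |u₀ x - v₀ x|) * Real.exp (K (NonlocalCL.normL1Strip T v) c d * t) := by
    intro t ht
    have h := NonlocalCL.comparison hf hf0 hT hC (hu.isBVEntropyFlow hf hb hc0 htru)
      (hv.isBVEntropyFlow hf hb hd0 htrv) hd0 (l := 0)
      (fun s hs => hv.integral_abs_le hT hf hf0 hC0 hC hb hd0 htrv (K := κ d) rfl hs)
      (fun s hs x => by
        rw [add_zero]
        exact hb.abs_nonlocalCoeff_sub_le (hu.contL1.integrable s hs)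
          (hv.contL1.integrable s hs) x)
      (fun s hs x => by
        rw [add_zero]
        exact hb.abs_nonlocalCoeffDeriv_sub_le hc0 (hu.contL1.integrable s hs)
          (hv.contL1.integrable s hs) (htru s hs) x) t ht
    rw [add_zero, add_zero, hinit] at h
    exact h
  refine ⟨fun t ht => (hmain t ht).trans (mul_le_mul_of_nonneg_left ?_
    (integral_nonneg fun _ => abs_nonneg _)), fun h0 => ?_⟩
  · have h1 : K (NonlocalCL.normL1Strip T v) c d ≤ 1 + |K (NonlocalCL.normL1Strip T v) c d| := by
      linarith [le_abs_self (K (NonlocalCL.normL1Strip T v) c d)]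
    set M := 1 + |K (NonlocalCL.normL1Strip T v) c d|
    have h2 := Real.exp_le_exp.2 (mul_le_mul_of_nonneg_right h1 ht.1)
    -- Multiplying `1 - x ≤ e^{-x}` by `e^x` gives `e^x ≤ 1 + x e^x`.
    have h3 : 1 - M * t ≤ Real.exp (-(M * t)) := by linarith [Real.add_one_le_exp (-(M * t))]
    have h4 : Real.exp (M * t) * Real.exp (-(M * t)) = 1 := by rw [← Real.exp_add]; simp
    have h5 := mul_le_mul_of_nonneg_left h3 (Real.exp_pos (M * t)).le
    linarith
  · have hz : ∫ x, |u₀ x - v₀ x| = 0 := by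
      refine integral_eq_zero_of_ae ?_
      filter_upwards [h0] with x hx
      simp [hx]
    refine NonlocalCL.ae_eq_of_forall_integral_abs_sub_eq_zero hu.integrable_strip
      hv.integrable_strip fun t ht => le_antisymm ?_ (integral_nonneg fun _ => abs_nonneg _)
    have := hmain t ht
    rwa [hz, zero_mul] at this
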